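/- Let $M$ be a compact oriented smooth three-manifold (Hausdorff, without boundary) and let $\kappa\in\mathbb{R}$. For a Riemannian metric $g$ with Levi-Civita connection $\nabla^g$ and a three-form $H$ on $M$, let $\nabla^{g,H}_u v=\nabla^g_u v-\tfrac12 H(u,v)^{\sharp_g}$ be the metric connection with totally skew torsion $-H$. Let $\mathcal{R}^{g,H}_{u,v}w=\nabla^{g,H}_u\nabla^{g,H}_v w-\nabla^{g,H}_v\nabla^{g,H}_u w-\nabla^{g,H}_{[u,v]}w$ be its curvature, viewed as a section of $\wedge^2 M\otimes\wedge^2 M$ through $\mathcal{R}^{g,H}_{u,v}(w,z)=g(\mathcal{R}^{g,H}_{u,v}w,z)$, and let $\mathrm{Ric}^{g,H}(v,w)=\mathrm{tr}(u\mapsto\mathcal{R}^{g,H}_{u,v}w)$ and $\mathrm{Ric}^g=\mathrm{Ric}^{g,0}$. In a local $g$-orthonormal frame $(e_i)$ put $$(H\circ_g H)(v,w)=\tfrac12\sum_{i,j}H(v,e_i,e_j)H(w,e_i,e_j),\qquad (\mathcal{R}^{g,H}\circ_g\mathcal{R}^{g,H})(v,w)=\tfrac12\sum_{i,j,k}\mathcal{R}^{g,H}_{v,e_i}(e_j,e_k)\,\mathcal{R}^{g,H}_{w,e_i}(e_j,e_k),$$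 $$|H|_g^2=\tfrac16\sum_{i,j,k}H(e_i,e_j,e_k)^2,\qquad |\mathcal{R}^{g,H}|_g^2=\tfrac14\sum_{i,j,k,l}\mathcal{R}^{g,H}_{e_i,e_j}(e_k,e_l)^2,\qquad \langle\mathcal{R}^{g,H}\wedge\mathcal{R}^{g,H}\rangle_g=\tfrac12\sum_{i,j}\mathcal{R}^{g,H}(e_i,e_j)\wedge\mathcal{R}^{g,H}(e_i,e_j),$$ where $\mathcal{R}^{g,H}(e_i,e_j)$ denotes the two-form obtained by evaluating the second factor. Let $\delta^g$ be the codifferential and $\nu_g$ the Riemannian volume form. A triple $(g,\varphi,f)$ of a Riemannian metric, a closed one-form and a function (all smooth) is a three-dimensional Heterotic soliton, $(g,\varphi,f)\in\mathrm{Sol}_\kappa(M)$, if with $H=f\nu_g$ $$\mathrm{Ric}^{g,H}+\nabla^{g,H}\varphi+\kappa\,\mathcal{R}^{g,H}\circ_g\mathcal{R}^{g,H}=0,\qquad \delta^g\varphi+|\varphi|_g^2-|H|_g^2+\kappa|\mathcal{R}^{g,H}|_g^2=0,\qquad \mathrm{d}H+\kappa\langle\mathcal{R}^{g,H}\wedge\mathcal{R}^{g,H}\rangle_g=0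 .$$ A smooth family $(g_t,f_t)_{t\in\mathcal{I}}$ of Riemannian metrics and functions on $M$ is a Heterotic-Ricci flow if with $H_t=f_t\nu_{g_t}$ $$\partial_t g_t=-2\big(\mathrm{Ric}^{g_t}-\tfrac12 H_t\circ_{g_t}H_t\big)-2\kappa\,\mathcal{R}^{g_t,H_t}\circ_{g_t}\mathcal{R}^{g_t,H_t},\qquad \partial_t H_t=-\mathrm{d}\delta^{g_t}H_t,\qquad \mathrm{d}H_t+\kappa\langle\mathcal{R}^{g_t,H_t}\wedge\mathcal{R}^{g_t,H_t}\rangle_{g_t}=0$$ for all $t\in\mathcal{I}$. **Proposition.** Let $(g,\varphi,f)\in\mathrm{Sol}_\kappa(M)$ be a three-dimensional Heterotic soliton. Then there are an open interval $\mathcal{I}\ni 0$ and a one-parameter family of diffeomorphisms $\{\psi_t\}_{t\in\mathcal{I}}$ of $M$, smooth in $(t,x)\in\mathcal{I}\times M$, which is the flow of $\varphi$, that is, $\psi_0=\mathrm{Id}_M$ and $\partial_t\psi_t(x)=\varphi^{\sharp_g}(\psi_t(x))$ for all $t\in\mathcal{I}$ and $x\in M$, such that $$(g_t,f_t)=(\psi_t^*g,\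 f\circ\psi_t),\qquad t\in\mathcal{I},$$ is a Heterotic-Ricci flow. -/

import Mathlib

open scoped Manifold ContDiff

noncomputable section

namespace Heterotic

/-! ## Local tensor calculus

On an open subset of `ℝⁿ` a tensor field is given by its components in the coordinate frame
`∂₀, …, ∂ₙ₋₁`. Throughout this part, `G` is a metric, `H` a three-form, `φ` a one-form and `β` a
two-form, all given by their components. -/

section LocalCalculus

variable {n : ℕ}

/-- The partial derivative `∂ᵢ F` at `y`. -/
def pd (i : Fin n) (F : EuclideanSpace ℝ (Fin n) → ℝ) (y : EuclideanSpace ℝ (Fin n)) : ℝ :=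
  fderiv ℝ F y (EuclideanSpace.single i 1)

/-- The components `g^{ij}` of the inverse metric. -/
def ginv (G : EuclideanSpace ℝ (Fin n) → Matrix (Fin n) (Fin n) ℝ)
    (y : EuclideanSpace ℝ (Fin n)) : Matrix (Fin n) (Fin n) ℝ :=
  (G y)⁻¹

/-- The Christoffel symbols of the Levi-Civita connection, `∇^g_{∂ᵢ} ∂ⱼ = ∑ₖ christoffel k i j ∂ₖ`. -/
def christoffel (G : EuclideanSpace ℝ (Fin n) → Matrix (Fin n) (Fin n) ℝ) (k i j : Fin n)
    (y : EuclideanSpace ℝ (Fin n)) : ℝ :=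
  (1 / 2) * ∑ l, ginv G y k l *
    (pd i (fun z => G z j l) y + pd j (fun z => G z i l) y - pd l (fun z => G z i j) y)

/-- The coefficients of the metric connection with torsion `-H`, that is
`∇^{g,H}_u v = ∇^g_u v - ½ H(u,v)^♯`, with `∇^{g,H}_{∂ᵢ} ∂ⱼ = ∑ₖ conn k i j ∂ₖ`. -/
def conn (G : EuclideanSpace ℝ (Fin n) → Matrix (Fin n) (Fin n) ℝ)
    (H : EuclideanSpace ℝ (Fin n) → Fin n → Fin n → Fin n → ℝ) (k i j : Fin n)
    (y : EuclideanSpace ℝ (Fin n)) : ℝ :=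
  christoffel G k i j y - (1 / 2) * ∑ l, ginv G y k l * H y i j l

/-- The curvature `R^{g,H}_{u,v} w = ∇_u ∇_v w - ∇_v ∇_u w - ∇_{[u,v]} w` of `∇^{g,H}`, with
`R^{g,H}_{∂ᵢ,∂ⱼ} ∂ₖ = ∑ₗ curv l i j k ∂ₗ`. -/
def curv (G : EuclideanSpace ℝ (Fin n) → Matrix (Fin n) (Fin n) ℝ)
    (H : EuclideanSpace ℝ (Fin n) → Fin n → Fin n → Fin n → ℝ) (l i j k : Fin n)
    (y : EuclideanSpace ℝ (Fin n)) : ℝ :=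
  pd i (conn G H l j k) y - pd j (conn G H l i k) y
    + ∑ m, (conn G H m j k y * conn G H l i m y - conn G H m i k y * conn G H l j m y)

/-- The curvature as a section of `⋀² ⊗ ⋀²`: `R^{g,H}_{∂ᵢ,∂ⱼ}(∂ₖ,∂ₗ) = g(R^{g,H}_{∂ᵢ,∂ⱼ} ∂ₖ, ∂ₗ)`. -/
def curvLow (G : EuclideanSpace ℝ (Fin n) → Matrix (Fin n) (Fin n) ℝ)
    (H : EuclideanSpace ℝ (Fin n) → Fin n → Fin n → Fin n → ℝ) (i j k l : Fin n)
    (y : EuclideanSpace ℝ (Fin n)) : ℝ :=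
  ∑ m, G y m l * curv G H m i j k y

/-- The Ricci tensor of `∇^{g,H}`: `Ric^{g,H}(v,w) = tr (u ↦ R^{g,H}_{u,v} w)`. -/
def ricci (G : EuclideanSpace ℝ (Fin n) → Matrix (Fin n) (Fin n) ℝ)
    (H : EuclideanSpace ℝ (Fin n) → Fin n → Fin n → Fin n → ℝ) (i j : Fin n)
    (y : EuclideanSpace ℝ (Fin n)) : ℝ :=
  ∑ a, curv G H a a i j y

/-- The Ricci tensor of the Levi-Civita connection (the case of vanishing torsion). -/
def ricciLC (G : EuclideanSpace ℝ (Fin n) → Matrix (Fin n) (Fin n) ℝ) (i j : Fin n)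
    (y : EuclideanSpace ℝ (Fin n)) : ℝ :=
  ricci G (fun _ _ _ _ => 0) i j y

/-- `(H ∘ H)(v,w) = ⟨v ⌟ H, w ⌟ H⟩ = ½ ∑_{a,b} H(v,e_a,e_b) H(w,e_a,e_b)`. -/
def fluxSq (G : EuclideanSpace ℝ (Fin n) → Matrix (Fin n) (Fin n) ℝ)
    (H : EuclideanSpace ℝ (Fin n) → Fin n → Fin n → Fin n → ℝ) (i j : Fin n)
    (y : EuclideanSpace ℝ (Fin n)) : ℝ :=
  (1 / 2) * ∑ a, ∑ b, ∑ c, ∑ d, ginv G y a c * ginv G y b d * H y i a b * H y j c d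

/-- `(R ∘ R)(v,w) = ½ ∑_{a,b,c} R_{v,e_a}(e_b,e_c) R_{w,e_a}(e_b,e_c)` for `R = R^{g,H}`. -/
def curvSq (G : EuclideanSpace ℝ (Fin n) → Matrix (Fin n) (Fin n) ℝ)
    (H : EuclideanSpace ℝ (Fin n) → Fin n → Fin n → Fin n → ℝ) (i j : Fin n)
    (y : EuclideanSpace ℝ (Fin n)) : ℝ :=
  (1 / 2) * ∑ a, ∑ b, ∑ c, ∑ d, ∑ p, ∑ q,
    ginv G y a d * ginv G y b p * ginv G y c q *
      curvLow G H i a b c y * curvLow G H j d p q y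

/-- `|R|² = ¼ ∑_{a,b,c,d} R_{e_a,e_b}(e_c,e_d)²` for `R = R^{g,H}`. -/
def curvNormSq (G : EuclideanSpace ℝ (Fin n) → Matrix (Fin n) (Fin n) ℝ)
    (H : EuclideanSpace ℝ (Fin n) → Fin n → Fin n → Fin n → ℝ)
    (y : EuclideanSpace ℝ (Fin n)) : ℝ :=
  (1 / 4) * ∑ a, ∑ b, ∑ c, ∑ d, ∑ p, ∑ q, ∑ r, ∑ s,
    ginv G y a p * ginv G y b q * ginv G y c r * ginv G y d s *
      curvLow G H a b c d y * curvLow G H p q r s y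

/-- The four-form `⟨R ∧ R⟩ = ½ ∑_{a,b} R(e_a,e_b) ∧ R(e_a,e_b)`: the wedge product is taken in the
first factor of `⋀² ⊗ ⋀²`, the inner product in the second one. The square of a two-form is
`(α ∧ α)_{ijkl} = 2 (α_{ij} α_{kl} - α_{ik} α_{jl} + α_{il} α_{jk})`. -/
def curvWedge (G : EuclideanSpace ℝ (Fin n) → Matrix (Fin n) (Fin n) ℝ)
    (H : EuclideanSpace ℝ (Fin n) → Fin n → Fin n → Fin n → ℝ) (i j k l : Fin n)
    (y : EuclideanSpace ℝ (Fin n)) : ℝ :=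
  (1 / 2) * ∑ a, ∑ b, ∑ c, ∑ d, ginv G y a c * ginv G y b d *
    (2 * (curvLow G H i j a b y * curvLow G H k l c d y
      - curvLow G H i k a b y * curvLow G H j l c d y
      + curvLow G H i l a b y * curvLow G H j k c d y))

/-- The determinant norm `|H|² = (1/6) ∑_{a,b,c} H(e_a,e_b,e_c)²` of a three-form. -/
def fluxNormSq (G : EuclideanSpace ℝ (Fin n) → Matrix (Fin n) (Fin n) ℝ)
    (H : EuclideanSpace ℝ (Fin n) → Fin n → Fin n → Fin n → ℝ)
    (y : EuclideanSpace ℝ (Fin n)) : ℝ :=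
  (1 / 6) * ∑ a, ∑ b, ∑ c, ∑ d, ∑ p, ∑ q,
    ginv G y a d * ginv G y b p * ginv G y c q * H y a b c * H y d p q

/-- The norm `|φ|²` of a one-form. -/
def formNormSq (G : EuclideanSpace ℝ (Fin n) → Matrix (Fin n) (Fin n) ℝ)
    (φ : EuclideanSpace ℝ (Fin n) → Fin n → ℝ) (y : EuclideanSpace ℝ (Fin n)) : ℝ :=
  ∑ a, ∑ b, ginv G y a b * φ y a * φ y b

/-- `(∇^{g,H} φ)(∂ᵢ, ∂ⱼ) = (∇^{g,H}_{∂ᵢ} φ)(∂ⱼ)`. -/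
def covForm (G : EuclideanSpace ℝ (Fin n) → Matrix (Fin n) (Fin n) ℝ)
    (H : EuclideanSpace ℝ (Fin n) → Fin n → Fin n → Fin n → ℝ)
    (φ : EuclideanSpace ℝ (Fin n) → Fin n → ℝ) (i j : Fin n)
    (y : EuclideanSpace ℝ (Fin n)) : ℝ :=
  pd i (fun z => φ z j) y - ∑ k, conn G H k i j y * φ y k

/-- The codifferential `δ^g φ = - ∑_a (∇^g_{e_a} φ)(e_a)` of a one-form. -/
def codiffForm (G : EuclideanSpace ℝ (Fin n) → Matrix (Fin n) (Fin n) ℝ)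
    (φ : EuclideanSpace ℝ (Fin n) → Fin n → ℝ) (y : EuclideanSpace ℝ (Fin n)) : ℝ :=
  -∑ a, ∑ b, ginv G y a b * covForm G (fun _ _ _ _ => 0) φ a b y

/-- `(∇^g_{∂ₐ} H)(∂ᵢ, ∂ⱼ, ∂ₖ)` for a three-form `H` and the Levi-Civita connection. -/
def covFlux (G : EuclideanSpace ℝ (Fin n) → Matrix (Fin n) (Fin n) ℝ)
    (H : EuclideanSpace ℝ (Fin n) → Fin n → Fin n → Fin n → ℝ) (a i j k : Fin n)
    (y : EuclideanSpace ℝ (Fin n)) : ℝ :=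
  pd a (fun z => H z i j k) y
    - ∑ m, (christoffel G m a i y * H y m j k + christoffel G m a j y * H y i m k
      + christoffel G m a k y * H y i j m)

/-- The codifferential `(δ^g H)(v,w) = - ∑_a (∇^g_{e_a} H)(e_a,v,w)` of a three-form. -/
def codiffFlux (G : EuclideanSpace ℝ (Fin n) → Matrix (Fin n) (Fin n) ℝ)
    (H : EuclideanSpace ℝ (Fin n) → Fin n → Fin n → Fin n → ℝ)
    (y : EuclideanSpace ℝ (Fin n)) (i j : Fin n) : ℝ :=
  -∑ a, ∑ b, ginv G y a b * covFlux G H a b i j y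

/-- The exterior derivative of a two-form. -/
def extDerivTwo (β : EuclideanSpace ℝ (Fin n) → Fin n → Fin n → ℝ) (i j k : Fin n)
    (y : EuclideanSpace ℝ (Fin n)) : ℝ :=
  pd i (fun z => β z j k) y - pd j (fun z => β z i k) y + pd k (fun z => β z i j) y

/-- The exterior derivative of a three-form. -/
def extDerivThree (H : EuclideanSpace ℝ (Fin n) → Fin n → Fin n → Fin n → ℝ) (i j k l : Fin n)
    (y : EuclideanSpace ℝ (Fin n)) : ℝ :=
  pd i (fun z => H z j k l) y - pd j (fun z => H z i k l) y
    + pd k (fun z => H z i j l) y - pd l (fun z => H z i j k) y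

/-- The Heterotic soliton system with parameter `κ` for `(g, φ, H)`, at the point `y`. -/
structure SolitonSystemAt (κ : ℝ) (G : EuclideanSpace ℝ (Fin n) → Matrix (Fin n) (Fin n) ℝ)
    (φ : EuclideanSpace ℝ (Fin n) → Fin n → ℝ)
    (H : EuclideanSpace ℝ (Fin n) → Fin n → Fin n → Fin n → ℝ)
    (y : EuclideanSpace ℝ (Fin n)) : Prop where
  /-- `dφ = 0` -/
  closed : ∀ i j, pd i (fun z => φ z j) y - pd j (fun z => φ z i) y = 0
  /-- `Ric^{g,H} + ∇^{g,H} φ + κ R^{g,H} ∘ R^{g,H} = 0` -/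
  einstein : ∀ i j, ricci G H i j y + covForm G H φ i j y + κ * curvSq G H i j y = 0
  /-- `δ^g φ + |φ|² - |H|² + κ |R^{g,H}|² = 0` -/
  dilaton : codiffForm G φ y + formNormSq G φ y - fluxNormSq G H y + κ * curvNormSq G H y = 0
  /-- `dH + κ ⟨R^{g,H} ∧ R^{g,H}⟩ = 0` -/
  bianchi : ∀ i j k l, extDerivThree H i j k l y + κ * curvWedge G H i j k l y = 0

/-- The Heterotic-Ricci flow equations with parameter `κ` for time-dependent `(g_s, H_s)`, `s ∈ I`,
at the time `t` and the point `y`. -/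
structure FlowSystemAt (κ : ℝ) (I : Set ℝ)
    (G : ℝ → EuclideanSpace ℝ (Fin n) → Matrix (Fin n) (Fin n) ℝ)
    (H : ℝ → EuclideanSpace ℝ (Fin n) → Fin n → Fin n → Fin n → ℝ)
    (t : ℝ) (y : EuclideanSpace ℝ (Fin n)) : Prop where
  /-- `∂ₜ g = -2 (Ric^g - ½ H ∘ H) - 2 κ R^{g,H} ∘ R^{g,H}` -/
  metric_eq : ∀ i j, HasDerivWithinAt (fun s => G s y i j)
    (-2 * (ricciLC (G t) i j y - (1 / 2) * fluxSq (G t) (H t) i j y)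
      - 2 * κ * curvSq (G t) (H t) i j y) I t
  /-- `∂ₜ H = - d δ^g H` -/
  flux_eq : ∀ i j k, HasDerivWithinAt (fun s => H s y i j k)
    (-extDerivTwo (codiffFlux (G t) (H t)) i j k y) I t
  /-- `dH + κ ⟨R^{g,H} ∧ R^{g,H}⟩ = 0` -/
  bianchi : ∀ i j k l, extDerivThree (H t) i j k l y + κ * curvWedge (G t) (H t) i j k l y = 0

/-- The components `ε_{ijk} √(det g)` of the Riemannian volume form in positively oriented
coordinates in dimension three, where `ε_{ijk}` is the determinant of the matrix whose rows are the
standard basis vectors number `i`, `j`, `k`. -/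
def volComp (G : EuclideanSpace ℝ (Fin 3) → Matrix (Fin 3) (Fin 3) ℝ)
    (y : EuclideanSpace ℝ (Fin 3)) (i j k : Fin 3) : ℝ :=
  √((G y).det) *
    (Matrix.of fun r s : Fin 3 => if ![i, j, k] r = s then (1 : ℝ) else 0).det

end LocalCalculus

/-! ## Tensor fields on a manifold and their components -/

section Manifolds

variable {n : ℕ} (M : Type*) [TopologicalSpace M] [ChartedSpace (EuclideanSpace ℝ (Fin n)) M]

/-- A smooth Riemannian metric on `M`. -/
abbrev Metric [IsManifold (𝓡 n) ∞ M] : Type _ :=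
  Bundle.ContMDiffRiemannianMetric (𝓡 n) ∞ (EuclideanSpace ℝ (Fin n))
    (fun x : M => TangentSpace (𝓡 n) x)

/-- A smooth one-form on `M`. -/
abbrev OneForm [IsManifold (𝓡 n) ∞ M] : Type _ :=
  ContMDiffSection (𝓡 n) (EuclideanSpace ℝ (Fin n) →L[ℝ] ℝ) ∞
    (fun x : M => TangentSpace (𝓡 n) x →L[ℝ] Bundle.Trivial M ℝ x)

/-- An orientation of `M`: a maximal oriented atlas. -/
structure OrientedAtlas where
  /-- the positively oriented charts -/
  charts : Set (OpenPartialHomeomorph M (EuclideanSpace ℝ (Fin n)))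
  smooth : charts ⊆ IsManifold.maximalAtlas (𝓡 n) ∞ M
  cover : ∀ x : M, ∃ e ∈ charts, x ∈ e.source
  compatible : ∀ e ∈ charts, ∀ e' ∈ charts, ∀ x ∈ e.source ∩ e'.source,
    0 < (fderiv ℝ (e' ∘ e.symm) (e x)).det
  maximal : ∀ e ∈ IsManifold.maximalAtlas (𝓡 n) ∞ M,
    (∀ e' ∈ charts, ∀ x ∈ e.source ∩ e'.source, 0 < (fderiv ℝ (e' ∘ e.symm) (e x)).det) →
      e ∈ charts

variable {M}

/-- The coordinate vector field `∂ᵢ` of the chart `e`, at the point with coordinates `y`. -/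
def frame (e : OpenPartialHomeomorph M (EuclideanSpace ℝ (Fin n)))
    (y : EuclideanSpace ℝ (Fin n)) (i : Fin n) : TangentSpace (𝓡 n) (e.symm y) :=
  mfderiv (𝓡 n) (𝓡 n) e.symm y (EuclideanSpace.single i (1 : ℝ) : EuclideanSpace ℝ (Fin n))

variable [IsManifold (𝓡 n) ∞ M]

/-- The components of a metric in the chart `e`. -/
def metricComp (e : OpenPartialHomeomorph M (EuclideanSpace ℝ (Fin n))) (g : Metric (n := n) M)
    (y : EuclideanSpace ℝ (Fin n)) : Matrix (Fin n) (Fin n) ℝ :=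
  Matrix.of fun i j => g.inner (e.symm y) (frame e y i) (frame e y j)

/-- The components of a one-form in the chart `e`. -/
def formComp (e : OpenPartialHomeomorph M (EuclideanSpace ℝ (Fin n))) (φ : OneForm (n := n) M)
    (y : EuclideanSpace ℝ (Fin n)) (i : Fin n) : ℝ :=
  φ (e.symm y) (frame e y i)

/-- The vector field `φ^♯` dual to the one-form `φ` with respect to `g`. -/
def sharp (g : Metric (n := n) M) (φ : OneForm (n := n) M) (x : M) : TangentSpace (𝓡 n) x :=
  (g.inner x).inverse (φ x)

/-- `φ^♯` is characterised by `g(φ^♯, v) = φ(v)`. -/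
theorem inner_sharp (g : Metric (n := n) M) (φ : OneForm (n := n) M) (x : M)
    (v : TangentSpace (𝓡 n) x) : g.inner x (sharp g φ x) v = φ x v := by
  let A : EuclideanSpace ℝ (Fin n) →L[ℝ] (EuclideanSpace ℝ (Fin n) →L[ℝ] ℝ) := g.inner x
  have hinj : Function.Injective A := by
    intro u w h
    by_contra hne
    have hpos : 0 < A (u - w) (u - w) := g.pos x (u - w) (sub_ne_zero.mpr hne)
    have hzero : A (u - w) = 0 := by rw [map_sub A u w, h, sub_self]
    rw [hzero] at hpos
    exact lt_irrefl _ hpos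
  have hdim : Module.finrank ℝ (EuclideanSpace ℝ (Fin n)) =
      Module.finrank ℝ (EuclideanSpace ℝ (Fin n) →L[ℝ] ℝ) := by
    rw [← LinearMap.toContinuousLinearMap.finrank_eq]
    exact (Subspace.dual_finrank_eq (K := ℝ) (V := EuclideanSpace ℝ (Fin n))).symm
  let L := LinearEquiv.ofInjectiveOfFinrankEq A.toLinearMap hinj hdim
  let B := L.toContinuousLinearEquiv
  have hB : A = (B : EuclideanSpace ℝ (Fin n) →L[ℝ] (EuclideanSpace ℝ (Fin n) →L[ℝ] ℝ)) := by
    ext u w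
    rfl
  have key : A (A.inverse (φ x)) = φ x := by
    rw [hB, ContinuousLinearMap.inverse_equiv]
    exact B.apply_symm_apply _
  exact congrArg (fun l : EuclideanSpace ℝ (Fin n) →L[ℝ] ℝ => l v) key

/-- `g'` is the pullback `ψ^* g`. -/
def IsPullback (ψ : Diffeomorph (𝓡 n) (𝓡 n) M M ∞) (g g' : Metric (n := n) M) : Prop :=
  ∀ (x : M) (v w : TangentSpace (𝓡 n) x), g'.inner x v w =
    g.inner (ψ x) (mfderiv (𝓡 n) (𝓡 n) ψ x v) (mfderiv (𝓡 n) (𝓡 n) ψ x w)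

end Manifolds

/-! ## The three-dimensional case -/

section ThreeManifolds

variable {M : Type*} [TopologicalSpace M] [ChartedSpace (EuclideanSpace ℝ (Fin 3)) M]
  [IsManifold (𝓡 3) ∞ M]

/-- The components of the three-form `H = f ν_g` in the positively oriented chart `e`. -/
def fluxComp (e : OpenPartialHomeomorph M (EuclideanSpace ℝ (Fin 3))) (g : Metric (n := 3) M)
    (f : M → ℝ) (y : EuclideanSpace ℝ (Fin 3)) (i j k : Fin 3) : ℝ :=
  f (e.symm y) * volComp (metricComp e g) y i j k

/-- `(g, φ, f)` is a three-dimensional Heterotic soliton on the oriented three-manifold `M`: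
`(g, φ, f ν_g)` solves the Heterotic soliton system with parameter `κ`. -/
def IsHeteroticSoliton (o : OrientedAtlas (n := 3) M) (κ : ℝ) (g : Metric (n := 3) M)
    (φ : OneForm (n := 3) M) (f : M → ℝ) : Prop :=
  ∀ e ∈ o.charts, ∀ y ∈ e.target,
    SolitonSystemAt κ (metricComp e g) (formComp e φ) (fluxComp e g f) y

/-- `(g_t, f_t)`, `t ∈ I`, is a Heterotic-Ricci flow on the oriented three-manifold `M`: a family
of Riemannian metrics and functions, smooth in space and time, such that `(g_t, f_t ν_{g_t})`
solves the Heterotic-Ricci flow equations with parameter `κ`. -/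
structure IsHeteroticRicciFlow (o : OrientedAtlas (n := 3) M) (κ : ℝ) (I : Set ℝ)
    (g : ℝ → Metric (n := 3) M) (f : ℝ → M → ℝ) : Prop where
  smooth_metric : ∀ e ∈ o.charts, ∀ i j, ContDiffOn ℝ ∞
    (fun p : ℝ × EuclideanSpace ℝ (Fin 3) => metricComp e (g p.1) p.2 i j) (I ×ˢ e.target)
  smooth_function : ∀ e ∈ o.charts, ContDiffOn ℝ ∞
    (fun p : ℝ × EuclideanSpace ℝ (Fin 3) => f p.1 (e.symm p.2)) (I ×ˢ e.target)
  equations : ∀ e ∈ o.charts, ∀ t ∈ I, ∀ y ∈ e.target,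
    FlowSystemAt κ I (fun s => metricComp e (g s)) (fun s => fluxComp e (g s) (f s)) t y

end ThreeManifolds

end Heterotic

end

/-! The torsionful Ricci tensor splits as `Ric^{g,H} = Ric^g - ½ H∘H + ½ δH`, with symmetric first
part and skew last term (`IsLocalMetric.ricci_eq`), and `∇^{g,H}φ = ∇^g φ + ½ φ^♯ ⌟ H`
(`covForm_eq`), where `∇^g φ` is symmetric because `φ` is closed. The single Einstein equation
therefore contains two. Its symmetric part says `2∇^g φ = -2(Ric^g - ½ H∘H) - 2κ R∘R`, and the left
side is the Lie derivative of `g` along `φ^♯` (`IsLocalMetric.two_covForm_of_soliton`,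
`IsLocalMetric.lieDeriv_sharp`). Its skew part says `δH = -φ^♯ ⌟ H`
(`IsLocalMetric.codiffFlux_of_soliton`), so `-dδH = d(φ^♯ ⌟ H)`, which is the Lie derivative of the
top-degree form `H`. A soliton thus satisfies the flow equations with `∂_t` replaced by the Lie
derivative along `φ^♯`, and pulling back by the flow of `φ^♯` turns Lie derivatives into time
derivatives.

Naturality under pullback is obtained without checking that curvature is a tensor. The components of
`ψ_t^* g` in a chart `e` are those of `g` in the chart `e ∘ ψ_t⁻¹` (`metricComp_pullbackMetric`,
`fluxComp_pullbackMetric`). That chart is again positively oriented, since `ψ_t` is joined to the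
identity (`transportChart_mem_charts`), and the soliton system holds in every positively oriented
chart. Only the time derivative remains: in the coordinates `e` and `e ∘ ψ_t⁻¹` the map `ψ_s` is the
identity at `s = t` with velocity the components of `φ^♯`, so differentiating the transformation
laws gives Lie derivatives (`hasDerivAt_pullback_metric`, `hasDerivAt_det_family`).

The flow, smooth jointly in time and space, is constructed in `exists_smooth_flow`. Locally it comes
from the implicit function theorem applied to the integral equation on `C([0,1], E)`
(`exists_smooth_local_flow`); uniqueness of integral curves and compactness glue the local pieces.
-/

noncomputable section
namespace Heterotic

/-! ### Local tensor calculus: partial derivatives and fields of components on an open set. -/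

section LocalCalculusLemmas

variable {n : ℕ}

theorem pd_congr {F F' : EuclideanSpace ℝ (Fin n) → ℝ} {y : EuclideanSpace ℝ (Fin n)} (i : Fin n)
    (h : F =ᶠ[nhds y] F') : pd i F y = pd i F' y := by
  unfold pd; rw [h.fderiv_eq]

theorem pd_congr_of_isOpen {F F' : EuclideanSpace ℝ (Fin n) → ℝ}
    {U : Set (EuclideanSpace ℝ (Fin n))} (hU : IsOpen U) {y : EuclideanSpace ℝ (Fin n)}
    (hy : y ∈ U) (i : Fin n) (h : ∀ z ∈ U, F z = F' z) : pd i F y = pd i F' y :=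
  pd_congr i (Filter.eventuallyEq_of_mem (hU.mem_nhds hy) h)

theorem pd_const (i : Fin n) (c : ℝ) (y : EuclideanSpace ℝ (Fin n)) :
    pd i (fun _ => c) y = 0 := by
  simp [pd]

theorem pd_sub {F F' : EuclideanSpace ℝ (Fin n) → ℝ} {y : EuclideanSpace ℝ (Fin n)} (i : Fin n)
    (hF : DifferentiableAt ℝ F y) (hF' : DifferentiableAt ℝ F' y) :
    pd i (fun z => F z - F' z) y = pd i F y - pd i F' y := by
  simp [pd, fderiv_fun_sub hF hF']

theorem pd_neg (F : EuclideanSpace ℝ (Fin n) → ℝ) (y : EuclideanSpace ℝ (Fin n)) (i : Fin n) :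
    pd i (fun z => -F z) y = -pd i F y := by
  simp [pd, fderiv_fun_neg]

theorem pd_mul {F F' : EuclideanSpace ℝ (Fin n) → ℝ} {y : EuclideanSpace ℝ (Fin n)} (i : Fin n)
    (hF : DifferentiableAt ℝ F y) (hF' : DifferentiableAt ℝ F' y) :
    pd i (fun z => F z * F' z) y = pd i F y * F' y + F y * pd i F' y := by
  simp [pd, fderiv_fun_mul hF hF']; ring

theorem pd_const_mul {F : EuclideanSpace ℝ (Fin n) → ℝ} {y : EuclideanSpace ℝ (Fin n)} (i : Fin n)
    (c : ℝ) (hF : DifferentiableAt ℝ F y) : pd i (fun z => c * F z) y = c * pd i F y := by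
  simp [pd, fderiv_const_mul hF]

theorem pd_mul_const {F : EuclideanSpace ℝ (Fin n) → ℝ} {y : EuclideanSpace ℝ (Fin n)} (i : Fin n)
    (c : ℝ) (hF : DifferentiableAt ℝ F y) : pd i (fun z => F z * c) y = pd i F y * c := by
  simp [pd, fderiv_mul_const hF]; ring

theorem pd_sum {ι : Type*} {s : Finset ι} {F : ι → EuclideanSpace ℝ (Fin n) → ℝ}
    {y : EuclideanSpace ℝ (Fin n)} (i : Fin n) (hF : ∀ a ∈ s, DifferentiableAt ℝ (F a) y) :
    pd i (fun z => ∑ a ∈ s, F a z) y = ∑ a ∈ s, pd i (F a) y := by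
  simp [pd, fderiv_fun_sum hF]

theorem contDiffOn_pd {F : EuclideanSpace ℝ (Fin n) → ℝ} {U : Set (EuclideanSpace ℝ (Fin n))}
    (hU : IsOpen U) (hF : ContDiffOn ℝ ∞ F U) (i : Fin n) : ContDiffOn ℝ ∞ (pd i F) U :=
  (hF.fderiv_of_isOpen hU (by simp)).clm_apply contDiffOn_const

theorem pd_pd_comm {F : EuclideanSpace ℝ (Fin n) → ℝ} {U : Set (EuclideanSpace ℝ (Fin n))}
    (hU : IsOpen U) (hF : ContDiffOn ℝ ∞ F U) {y : EuclideanSpace ℝ (Fin n)} (hy : y ∈ U)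
    (i j : Fin n) : pd i (pd j F) y = pd j (pd i F) y := by
  have hd : DifferentiableAt ℝ (fderiv ℝ F) y :=
    ((hF.fderiv_of_isOpen hU (m := ∞) (by simp)).contDiffAt (hU.mem_nhds hy)).differentiableAt
      (by simp)
  have key : ∀ k l : Fin n, pd k (pd l F) y =
      fderiv ℝ (fderiv ℝ F) y (EuclideanSpace.single k 1) (EuclideanSpace.single l 1) := by
    intro k l
    unfold pd
    rw [fderiv_clm_apply hd (differentiableAt_const _)]
    simp
  rw [key, key]
  exact ((hF.contDiffAt (hU.mem_nhds hy)).isSymmSndFDerivAt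
    (by simpa using (ENat.LEInfty.out : (2 : WithTop ℕ∞) ≤ ∞))) _ _

/-- `G` is a smooth field of symmetric invertible matrices on the open set `U`. -/
structure IsLocalMetric (G : EuclideanSpace ℝ (Fin n) → Matrix (Fin n) (Fin n) ℝ)
    (U : Set (EuclideanSpace ℝ (Fin n))) : Prop where
  isOpen : IsOpen U
  smooth : ∀ i j, ContDiffOn ℝ ∞ (fun z => G z i j) U
  symm : ∀ z ∈ U, (G z).IsSymm
  det_ne_zero : ∀ z ∈ U, (G z).det ≠ 0

/-- `H` is a smooth three-form on the set `U`. -/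
structure IsLocalThreeForm (H : EuclideanSpace ℝ (Fin n) → Fin n → Fin n → Fin n → ℝ)
    (U : Set (EuclideanSpace ℝ (Fin n))) : Prop where
  smooth : ∀ i j k, ContDiffOn ℝ ∞ (fun z => H z i j k) U
  swap_left : ∀ z ∈ U, ∀ i j k, H z i j k = -H z j i k
  swap_right : ∀ z ∈ U, ∀ i j k, H z i j k = -H z i k j

theorem contDiffOn_det {m : ℕ} {E : Type*} [NormedAddCommGroup E] [NormedSpace ℝ E]
    {A : E → Matrix (Fin m) (Fin m) ℝ} {U : Set E}
    (hA : ∀ i j, ContDiffOn ℝ ∞ (fun z => A z i j) U) :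
    ContDiffOn ℝ ∞ (fun z => (A z).det) U := by
  simp only [Matrix.det_apply]
  exact ContDiffOn.sum fun σ _ => (contDiffOn_prod fun i _ => hA _ _).const_smul _

/-! ### The Levi-Civita connection and the symmetry of its Ricci tensor. -/

section Metric

variable {G : EuclideanSpace ℝ (Fin n) → Matrix (Fin n) (Fin n) ℝ}
  {U : Set (EuclideanSpace ℝ (Fin n))} (hG : IsLocalMetric G U)

include hG

/-- Cramer's rule: an entry of the adjugate is the determinant of `G` with one row replaced by a
basis vector, and it is divided by a nonvanishing determinant. -/
theorem IsLocalMetric.contDiffOn_ginv (k l : Fin n) :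
    ContDiffOn ℝ ∞ (fun z => ginv G z k l) U := by
  simp only [ginv, Matrix.inv_def, Matrix.smul_apply, smul_eq_mul, Ring.inverse_eq_inv']
  refine ((contDiffOn_det hG.smooth).inv hG.det_ne_zero).mul ?_
  simp only [Matrix.adjugate_apply]
  refine contDiffOn_det fun i j => ?_
  by_cases h : i = l
  · subst h; simpa using contDiffOn_const
  · simpa [Matrix.updateRow_ne h] using hG.smooth i j

theorem IsLocalMetric.ginv_symm {z : EuclideanSpace ℝ (Fin n)} (hz : z ∈ U) (k l : Fin n) :
    ginv G z k l = ginv G z l k := by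
  have h : (ginv G z).transpose = ginv G z := by
    rw [ginv, Matrix.transpose_nonsing_inv, (hG.symm z hz).eq]
  exact congrFun (congrFun h.symm k) l

theorem IsLocalMetric.apply_symm {z : EuclideanSpace ℝ (Fin n)} (hz : z ∈ U) (k l : Fin n) :
    G z k l = G z l k := (hG.symm z hz).apply l k

theorem IsLocalMetric.ginv_mul {z : EuclideanSpace ℝ (Fin n)} (hz : z ∈ U) :
    ginv G z * G z = 1 :=
  Matrix.nonsing_inv_mul _ (isUnit_iff_ne_zero.mpr (hG.det_ne_zero z hz))

theorem IsLocalMetric.mul_ginv {z : EuclideanSpace ℝ (Fin n)} (hz : z ∈ U) :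
    G z * ginv G z = 1 :=
  Matrix.mul_nonsing_inv _ (isUnit_iff_ne_zero.mpr (hG.det_ne_zero z hz))

theorem IsLocalMetric.pd_symm {z : EuclideanSpace ℝ (Fin n)} (hz : z ∈ U) (i j k : Fin n) :
    pd i (fun w => G w j k) z = pd i (fun w => G w k j) z :=
  pd_congr_of_isOpen hG.isOpen hz i fun _ hw => hG.apply_symm hw j k

theorem IsLocalMetric.differentiableAt {z : EuclideanSpace ℝ (Fin n)} (hz : z ∈ U) (i j : Fin n) :
    DifferentiableAt ℝ (fun w => G w i j) z :=
  ((hG.smooth i j).contDiffAt (hG.isOpen.mem_nhds hz)).differentiableAt (by simp)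

theorem IsLocalMetric.differentiableAt_ginv {z : EuclideanSpace ℝ (Fin n)} (hz : z ∈ U)
    (i j : Fin n) : DifferentiableAt ℝ (fun w => ginv G w i j) z :=
  ((hG.contDiffOn_ginv i j).contDiffAt (hG.isOpen.mem_nhds hz)).differentiableAt (by simp)

theorem IsLocalMetric.contDiffOn_christoffel (k i j : Fin n) :
    ContDiffOn ℝ ∞ (christoffel G k i j) U := by
  unfold christoffel
  refine contDiffOn_const.mul (ContDiffOn.sum fun l _ => (hG.contDiffOn_ginv k l).mul ?_)
  exact ((contDiffOn_pd hG.isOpen (hG.smooth j l) i).add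
    (contDiffOn_pd hG.isOpen (hG.smooth i l) j)).sub (contDiffOn_pd hG.isOpen (hG.smooth i j) l)

theorem IsLocalMetric.christoffel_symm {z : EuclideanSpace ℝ (Fin n)} (hz : z ∈ U)
    (k i j : Fin n) : christoffel G k i j z = christoffel G k j i z := by
  unfold christoffel
  congr 1
  refine Finset.sum_congr rfl fun l _ => ?_
  rw [hG.pd_symm hz l i j]; ring

/-- The matrix form `∂ₐ g⁻¹ = - g⁻¹ (∂ₐ g) g⁻¹` of the derivative of the inverse metric. -/
theorem IsLocalMetric.pd_ginv_matrix {z : EuclideanSpace ℝ (Fin n)} (hz : z ∈ U) (a : Fin n) :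
    Matrix.of (fun k l => pd a (fun w => ginv G w k l) z) =
      -(ginv G z * Matrix.of (fun k l => pd a (fun w => G w k l) z) * ginv G z) := by
  -- Product rule applied to `g⁻¹ g = 1`, which holds on all of `U`.
  have h : Matrix.of (fun k l => pd a (fun w => ginv G w k l) z) * G z =
      -(ginv G z * Matrix.of (fun k l => pd a (fun w => G w k l) z)) := by
    rw [eq_neg_iff_add_eq_zero]
    ext k l
    have h1 : pd a (fun w => ∑ m, ginv G w k m * G w m l) z = 0 := by
      rw [← pd_const a ((1 : Matrix (Fin n) (Fin n) ℝ) k l) z]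
      refine pd_congr_of_isOpen hG.isOpen hz a fun w hw => ?_
      rw [← hG.ginv_mul hw, Matrix.mul_apply]
    rw [pd_sum a fun m _ => (hG.differentiableAt_ginv hz k m).fun_mul (hG.differentiableAt hz m l)] at h1
    simp only [pd_mul a (hG.differentiableAt_ginv hz _ _) (hG.differentiableAt hz _ _)] at h1
    simpa [Matrix.mul_apply, Finset.sum_add_distrib] using h1
  calc _ = Matrix.of (fun k l => pd a (fun w => ginv G w k l) z) * (G z * ginv G z) := by
        rw [hG.mul_ginv hz, mul_one]
    _ = _ := by rw [← mul_assoc, h, neg_mul]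

/-- Metric compatibility of the Levi-Civita connection. -/
theorem IsLocalMetric.pd_metric {z : EuclideanSpace ℝ (Fin n)} (hz : z ∈ U) (a : Fin n) :
    Matrix.of (fun k l => pd a (fun w => G w k l) z) =
      (Matrix.of fun k l => christoffel G k a l z).transpose * G z +
        G z * Matrix.of fun k l => christoffel G k a l z := by
  -- With its index lowered, `Γ_a` is ½∂ₐg plus a skew matrix; adding the transpose removes the skew
  -- matrix and leaves `∂ₐg`.
  have key : ∀ i j : Fin n, (G z * Matrix.of fun k l => christoffel G k a l z) i j =
      (1 / 2) * (pd a (fun w => G w j i) z + pd j (fun w => G w a i) z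
        - pd i (fun w => G w a j) z) := by
    intro i j
    have : (Matrix.of fun k l => christoffel G k a l z) = ginv G z * Matrix.of fun k l =>
        (1 / 2) * (pd a (fun w => G w l k) z + pd l (fun w => G w a k) z
        - pd k (fun w => G w a l) z) := by
      ext k l
      simp only [Matrix.of_apply, christoffel, Matrix.mul_apply, Finset.mul_sum]
      exact Finset.sum_congr rfl fun m _ => by ring
    rw [this, ← mul_assoc, hG.mul_ginv hz, one_mul, Matrix.of_apply]
  have ht : (Matrix.of fun k l => christoffel G k a l z).transpose * G z =
      (G z * Matrix.of fun k l => christoffel G k a l z).transpose := by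
    rw [Matrix.transpose_mul, (hG.symm z hz).eq]
  ext i j
  rw [ht, Matrix.add_apply, Matrix.transpose_apply, key, key, Matrix.of_apply, hG.pd_symm hz a j i]
  ring

/-- The inverse metric is parallel. -/
theorem IsLocalMetric.pd_ginv {z : EuclideanSpace ℝ (Fin n)} (hz : z ∈ U) (a k l : Fin n) :
    pd a (fun w => ginv G w k l) z =
      -∑ m, (christoffel G k a m z * ginv G z m l + christoffel G l a m z * ginv G z k m) := by
  have h := hG.pd_ginv_matrix hz a
  rw [hG.pd_metric hz a, mul_add, add_mul, mul_assoc, mul_assoc, hG.mul_ginv hz, mul_one,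
    ← mul_assoc, hG.ginv_mul hz, one_mul] at h
  have h' := congrFun (congrFun h k) l
  simp only [Matrix.of_apply, Matrix.neg_apply, Matrix.add_apply, Matrix.mul_apply,
    Matrix.transpose_apply] at h'
  rw [h', ← Finset.sum_add_distrib]
  congr 1
  exact Finset.sum_congr rfl fun m _ => by ring

/-- In the trace `Γ^a_{ak}` two of the three derivative terms cancel after exchanging `a` and `l`.
What is left is the gradient of `log √|det g|`, written without the logarithm. -/
theorem IsLocalMetric.sum_christoffel {z : EuclideanSpace ℝ (Fin n)} (hz : z ∈ U) (k : Fin n) :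
    ∑ a, christoffel G a a k z = ∑ a, ∑ l, (1 / 2) * (ginv G z a l * pd k (fun w => G w a l) z) := by
  have h : ∑ a, ∑ l, (1 / 2) * (ginv G z a l * pd a (fun w => G w k l) z) =
      ∑ a, ∑ l, (1 / 2) * (ginv G z a l * pd l (fun w => G w a k) z) := by
    rw [Finset.sum_comm]
    refine Finset.sum_congr rfl fun a _ => Finset.sum_congr rfl fun l _ => ?_
    rw [hG.ginv_symm hz l a, hG.pd_symm hz l k a]
  simp only [christoffel, Finset.mul_sum]
  rw [← sub_eq_zero] at h ⊢
  rw [← h]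
  simp only [← Finset.sum_sub_distrib]
  exact Finset.sum_congr rfl fun a _ => Finset.sum_congr rfl fun l _ => by ring

/-- `Γ^a_{ak}` is a gradient, hence closed. In the form used here: the second-derivative terms
commute, and the terms with `∂g⁻¹` equal `-½ tr(g⁻¹ ∂_p g g⁻¹ ∂_q g)`, symmetric in `p, q` because
the trace is cyclic. -/
theorem IsLocalMetric.pd_sum_christoffel_comm {y : EuclideanSpace ℝ (Fin n)} (hy : y ∈ U)
    (j k : Fin n) :
    ∑ a, pd j (christoffel G a a k) y = ∑ a, pd k (christoffel G a a j) y := by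
  have hd : ∀ a l m, DifferentiableAt ℝ (pd m fun w => G w a l) y := fun a l m =>
    ((contDiffOn_pd hG.isOpen (hG.smooth a l) m).contDiffAt
      (hG.isOpen.mem_nhds hy)).differentiableAt (by simp)
  have key : ∀ p q : Fin n, ∑ a, pd p (christoffel G a a q) y =
      ∑ a, ∑ l, (1 / 2) * (pd p (fun w => ginv G w a l) y * pd q (fun w => G w a l) y) +
      ∑ a, ∑ l, (1 / 2) * (ginv G y a l * pd p (pd q (fun w => G w a l)) y) := by
    intro p q
    rw [← pd_sum p fun a _ => ((hG.contDiffOn_christoffel a a q).contDiffAt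
      (hG.isOpen.mem_nhds hy)).differentiableAt (by simp),
      pd_congr_of_isOpen hG.isOpen hy p fun z hz => hG.sum_christoffel hz q]
    rw [pd_sum p fun a _ => by
      exact DifferentiableAt.fun_sum fun l _ =>
        ((hG.differentiableAt_ginv hy a l).fun_mul (hd a l q)).const_mul _]
    rw [← Finset.sum_add_distrib]
    refine Finset.sum_congr rfl fun a _ => ?_
    rw [pd_sum p fun l _ => ((hG.differentiableAt_ginv hy a l).fun_mul (hd a l q)).const_mul _,
      ← Finset.sum_add_distrib]
    refine Finset.sum_congr rfl fun l _ => ?_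
    rw [pd_const_mul p _ ((hG.differentiableAt_ginv hy a l).fun_mul (hd a l q)),
      pd_mul p (hG.differentiableAt_ginv hy a l) (hd a l q)]
    ring
  have htr : ∀ p q : Fin n,
      ∑ a, ∑ l, (1 / 2) * (pd p (fun w => ginv G w a l) y * pd q (fun w => G w a l) y) =
      -(1 / 2) * (ginv G y * Matrix.of (fun k l => pd p (fun w => G w k l) y) * ginv G y *
        Matrix.of (fun k l => pd q (fun w => G w k l) y)).trace := by
    intro p q
    have h := hG.pd_ginv_matrix hy p
    rw [← neg_eq_iff_eq_neg] at h
    rw [← h, Matrix.neg_mul, Matrix.trace_neg, neg_mul_neg, Matrix.trace, Finset.mul_sum]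
    refine Finset.sum_congr rfl fun a _ => ?_
    simp only [Matrix.diag_apply, Matrix.mul_apply, Matrix.of_apply, Finset.mul_sum]
    exact Finset.sum_congr rfl fun l _ => by rw [hG.pd_symm hy q a l]
  rw [key, key, htr, htr]
  congr 1
  · rw [mul_assoc _ (ginv G y), Matrix.trace_mul_comm, ← mul_assoc]
  · refine Finset.sum_congr rfl fun a _ => Finset.sum_congr rfl fun l _ => ?_
    rw [pd_pd_comm hG.isOpen (hG.smooth a l) hy]

omit hG in
theorem conn_zero (k i j : Fin n) :
    conn G (fun _ _ _ _ => 0) k i j = christoffel G k i j := by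
  funext y; simp [conn]

/-- Three of the four terms of the contracted curvature are symmetric because the connection is
torsion-free; the remaining one, the derivative of the trace `Γ^a_{ak}`, is covered by
`IsLocalMetric.pd_sum_christoffel_comm`. The Bianchi identity is not needed. -/
theorem IsLocalMetric.ricciLC_symm {y : EuclideanSpace ℝ (Fin n)} (hy : y ∈ U) (i j : Fin n) :
    ricciLC G i j y = ricciLC G j i y := by
  simp only [ricciLC, ricci, curv, conn_zero, Finset.sum_add_distrib, Finset.sum_sub_distrib]
  rw [hG.pd_sum_christoffel_comm hy i j]
  have h1 : ∀ a, pd a (christoffel G a i j) y = pd a (christoffel G a j i) y := fun a =>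
    pd_congr_of_isOpen hG.isOpen hy a fun z hz => hG.christoffel_symm hz a i j
  have h2 : ∑ a, ∑ m, christoffel G m a j y * christoffel G a i m y =
      ∑ a, ∑ m, christoffel G m a i y * christoffel G a j m y := by
    rw [Finset.sum_comm]
    refine Finset.sum_congr rfl fun a _ => Finset.sum_congr rfl fun m _ => ?_
    rw [hG.christoffel_symm hy a m j, hG.christoffel_symm hy m i a, mul_comm]
  simp only [h1, h2, hG.christoffel_symm hy _ i j]

/-! ### Skew torsion: the Ricci tensor of the connection and the two halves of the Einstein
equation. -/

section Torsion

variable {H : EuclideanSpace ℝ (Fin n) → Fin n → Fin n → Fin n → ℝ} (hH : IsLocalThreeForm H U)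

include hH

omit hG in
theorem IsLocalThreeForm.differentiableAt (hU : IsOpen U) {y : EuclideanSpace ℝ (Fin n)}
    (hy : y ∈ U) (i j k : Fin n) : DifferentiableAt ℝ (fun z => H z i j k) y :=
  ((hH.smooth i j k).contDiffAt (hU.mem_nhds hy)).differentiableAt (by simp)

omit hG in
theorem IsLocalThreeForm.cycle {y : EuclideanSpace ℝ (Fin n)}
    (hy : y ∈ U) (i j k : Fin n) : H y i j k = H y j k i := by
  rw [hH.swap_left y hy, hH.swap_right y hy, neg_neg]

include hG

/-- A symmetric tensor contracted with a skew one vanishes. Totally skew torsion is thus trace-free,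
which removes several terms from the Ricci contraction. -/
theorem IsLocalMetric.sum_torsion {y : EuclideanSpace ℝ (Fin n)} (hy : y ∈ U) (k : Fin n) :
    ∑ a, ∑ l, ginv G y a l * H y a k l = 0 := by
  have h : ∑ a, ∑ l, ginv G y a l * H y a k l = -∑ a, ∑ l, ginv G y a l * H y a k l := by
    conv_lhs => rw [Finset.sum_comm]
    simp only [← Finset.sum_neg_distrib]
    refine Finset.sum_congr rfl fun a _ => Finset.sum_congr rfl fun l _ => ?_
    rw [hG.ginv_symm hy l a, hH.swap_left y hy, hH.cycle hy k l a, hH.cycle hy l a k]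
    ring
  linarith

/-- The divergence of the torsion in terms of the codifferential of the three-form. -/
theorem IsLocalMetric.sum_pd_torsion {y : EuclideanSpace ℝ (Fin n)} (hy : y ∈ U) (j k : Fin n) :
    ∑ a, pd a (fun z => ∑ l, ginv G z a l * H z j k l) y =
      -codiffFlux G H y j k
      - ∑ a, ∑ m, christoffel G a a m y * ∑ l, ginv G y m l * H y j k l
      + ∑ a, ∑ m, christoffel G m a k y * ∑ l, ginv G y a l * H y j m l
      + ∑ a, ∑ m, christoffel G a j m y * ∑ l, ginv G y m l * H y a k l := by
  have h1 : ∀ a, pd a (fun z => ∑ l, ginv G z a l * H z j k l) y =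
      ∑ l, (pd a (fun z => ginv G z a l) y * H y j k l
        + ginv G y a l * pd a (fun z => H z l j k) y) := by
    intro a
    rw [pd_sum a fun l _ => (hG.differentiableAt_ginv hy a l).fun_mul
      (hH.differentiableAt hG.isOpen hy j k l)]
    refine Finset.sum_congr rfl fun l _ => ?_
    rw [pd_mul a (hG.differentiableAt_ginv hy a l) (hH.differentiableAt hG.isOpen hy j k l),
      pd_congr_of_isOpen hG.isOpen hy a fun z hz => (hH.cycle hz l j k).symm]
  have h2 : ∑ a, ∑ l, pd a (fun z => ginv G z a l) y * H y j k l =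
      - (∑ a, ∑ m, christoffel G a a m y * ∑ l, ginv G y m l * H y j k l)
      - ∑ a, ∑ l, ∑ m, ginv G y a l * (christoffel G m a l y * H y m j k) := by
    have e1 : ∑ a, ∑ l, ∑ m, christoffel G a a m y * ginv G y m l * H y j k l =
        ∑ a, ∑ m, christoffel G a a m y * ∑ l, ginv G y m l * H y j k l := by
      simp only [Finset.mul_sum]
      refine Finset.sum_congr rfl fun a _ => ?_
      rw [Finset.sum_comm]
      exact Finset.sum_congr rfl fun m _ => Finset.sum_congr rfl fun l _ => by ring
    have e2 : ∑ a, ∑ l, ∑ m, christoffel G l a m y * ginv G y a m * H y j k l =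
        ∑ a, ∑ l, ∑ m, ginv G y a l * (christoffel G m a l y * H y m j k) := by
      refine Finset.sum_congr rfl fun a _ => ?_
      rw [Finset.sum_comm]
      refine Finset.sum_congr rfl fun m _ => Finset.sum_congr rfl fun l _ => ?_
      rw [hH.cycle hy l j k]; ring
    rw [← e1, ← e2, ← neg_add', ← Finset.sum_add_distrib, ← Finset.sum_neg_distrib]
    refine Finset.sum_congr rfl fun a _ => ?_
    rw [← Finset.sum_add_distrib, ← Finset.sum_neg_distrib]
    refine Finset.sum_congr rfl fun l _ => ?_
    -- Since the inverse metric is parallel, its derivative supplies two of the Christoffel terms: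
    -- one is the trace term of the statement, the other belongs to the covariant derivative inside
    -- `codiffFlux`.
    rw [hG.pd_ginv hy, ← Finset.sum_add_distrib, ← Finset.sum_neg_distrib, ← Finset.sum_neg_distrib,
      Finset.sum_mul]
    exact Finset.sum_congr rfl fun m _ => by ring
  have h3 : ∑ a, ∑ m, christoffel G m a k y * ∑ l, ginv G y a l * H y j m l =
      ∑ a, ∑ l, ∑ m, ginv G y a l * (christoffel G m a k y * H y l j m) := by
    simp only [Finset.mul_sum]
    refine Finset.sum_congr rfl fun a _ => ?_
    rw [Finset.sum_comm]
    refine Finset.sum_congr rfl fun l _ => Finset.sum_congr rfl fun m _ => ?_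
    rw [hH.cycle hy l j m]; ring
  have h4 : ∑ a, ∑ m, christoffel G a j m y * ∑ l, ginv G y m l * H y a k l =
      ∑ a, ∑ l, ∑ m, ginv G y a l * (christoffel G m a j y * H y l m k) := by
    simp only [Finset.mul_sum]
    rw [Finset.sum_comm]
    refine Finset.sum_congr rfl fun a _ => ?_
    rw [Finset.sum_comm]
    refine Finset.sum_congr rfl fun l _ => Finset.sum_congr rfl fun m _ => ?_
    rw [hH.cycle hy l m k, hG.christoffel_symm hy m j a]; ring
  rw [h3, h4]
  simp only [h1, Finset.sum_add_distrib]
  rw [h2]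
  simp only [codiffFlux, covFlux, mul_sub, mul_add, Finset.mul_sum, Finset.sum_add_distrib,
    Finset.sum_sub_distrib]
  ring

/-- The part of the contracted curvature quadratic in the torsion; it is the source of the `H ∘ H`
term in the Ricci tensor. -/
theorem IsLocalMetric.sum_torsion_torsion {y : EuclideanSpace ℝ (Fin n)} (hy : y ∈ U)
    (j k : Fin n) :
    ∑ a, ∑ m, (∑ l, ginv G y m l * H y a k l) * (∑ l, ginv G y a l * H y j m l) =
      2 * fluxSq G H j k y := by
  simp only [fluxSq, Finset.sum_mul_sum, ← mul_assoc]
  norm_num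
  have : ∀ f : Fin n → Fin n → Fin n → Fin n → ℝ,
      ∑ a, ∑ m, ∑ l, ∑ b, f a m l b = ∑ m, ∑ b, ∑ l, ∑ a, f a m l b := by
    intro f
    rw [Finset.sum_comm]
    refine Finset.sum_congr rfl fun m _ => ?_
    rw [Finset.sum_comm, Finset.sum_congr rfl fun l _ => Finset.sum_comm, Finset.sum_comm]
  rw [this]
  refine Finset.sum_congr rfl fun m _ => Finset.sum_congr rfl fun b _ =>
    Finset.sum_congr rfl fun l _ => Finset.sum_congr rfl fun a _ => ?_
  rw [hG.ginv_symm hy a b, hH.cycle hy a k l]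
  ring

/-- The Ricci tensor of the connection with torsion `-H`. -/
theorem IsLocalMetric.ricci_eq {y : EuclideanSpace ℝ (Fin n)} (hy : y ∈ U) (j k : Fin n) :
    ricci G H j k y = ricciLC G j k y - (1 / 2) * fluxSq G H j k y
      + (1 / 2) * codiffFlux G H y j k := by
  have hC : ∀ k i j, DifferentiableAt ℝ (christoffel G k i j) y := fun k i j =>
    ((hG.contDiffOn_christoffel k i j).contDiffAt (hG.isOpen.mem_nhds hy)).differentiableAt
      (by simp)
  have hK : ∀ k i j, DifferentiableAt ℝ (fun z => ∑ l, ginv G z k l * H z i j l) y :=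
    fun k i j => DifferentiableAt.fun_sum fun l _ => (hG.differentiableAt_ginv hy k l).fun_mul
      (hH.differentiableAt hG.isOpen hy i j l)
  have hpd : ∀ a k i j, pd a (conn G H k i j) y = pd a (christoffel G k i j) y
      - (1 / 2) * pd a (fun z => ∑ l, ginv G z k l * H z i j l) y := by
    intro a k i j
    unfold conn
    rw [pd_sub a (hC k i j) ((hK k i j).const_mul _), pd_const_mul a _ (hK k i j)]
  -- The trace of the torsion vanishes on all of `U`, so its derivative at `y` does too.
  have h0 : ∑ a, pd j (fun z => ∑ l, ginv G z a l * H z a k l) y = 0 := by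
    rw [← pd_sum j fun a _ => hK a a k, ← pd_const j 0 y]
    exact pd_congr_of_isOpen hG.isOpen hy j fun z hz => hG.sum_torsion hH hz k
  have h1 : ∀ c : Fin n → ℝ, ∑ a, ∑ m, c m * ∑ l, ginv G y a l * H y a m l = 0 := by
    intro c
    rw [Finset.sum_comm]
    refine Finset.sum_eq_zero fun m _ => ?_
    rw [← Finset.mul_sum, hG.sum_torsion hH hy m, mul_zero]
  have h2 := hG.sum_pd_torsion hH hy j k
  have h3 := hG.sum_torsion_torsion hH hy j k
  have h4 := h1 fun m => christoffel G m j k y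
  have h5 := h1 fun m => ∑ l, ginv G y m l * H y j k l
  simp only [ricciLC, ricci, curv, conn_zero]
  simp only [hpd, conn]
  -- `K` is the torsion with its last index raised. Below, `e1` and `e2` contain its trace and
  -- vanish, `e3` is the quadratic term, and the mixed terms `e4`, `e5`, `e6` cancel against the
  -- Christoffel terms that `h2` needs to complete the divergence of `K` to `δH`.
  generalize hKdef : (fun (k i j : Fin n) => ∑ l, ginv G y k l * H y i j l) = K at *
  have hK' : ∀ k i j, ∑ l, ginv G y k l * H y i j l = K k i j := by
    intro k i j; rw [← hKdef]
  simp only [hK'] at *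
  simp only [sub_mul, mul_sub, Finset.sum_add_distrib, Finset.sum_sub_distrib,
    ← Finset.mul_sum, h0, h2]
  have e1 : ∑ a, ∑ m, christoffel G m j k y * (1 / 2 * K a a m) = 0 := by
    rw [← mul_zero (1 / 2 : ℝ), ← h4]; simp only [Finset.mul_sum]
    exact Finset.sum_congr rfl fun a _ => Finset.sum_congr rfl fun m _ => by ring
  have e2 : ∑ a, ∑ m, 1 / 2 * K m j k * (1 / 2 * K a a m) = 0 := by
    rw [← mul_zero (1 / 4 : ℝ), ← h5]; simp only [Finset.mul_sum]
    exact Finset.sum_congr rfl fun a _ => Finset.sum_congr rfl fun m _ => by ring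
  have e3 : ∑ a, ∑ m, 1 / 2 * K m a k * (1 / 2 * K a j m) = 1 / 2 * fluxSq G H j k y := by
    rw [show 1 / 2 * fluxSq G H j k y = 1 / 4 * (2 * fluxSq G H j k y) by ring, ← h3]
    simp only [Finset.mul_sum]
    exact Finset.sum_congr rfl fun a _ => Finset.sum_congr rfl fun m _ => by ring
  have e4 : ∑ a, ∑ m, 1 / 2 * K m j k * christoffel G a a m y =
      1 / 2 * ∑ a, ∑ m, christoffel G a a m y * K m j k := by
    simp only [Finset.mul_sum]
    exact Finset.sum_congr rfl fun a _ => Finset.sum_congr rfl fun m _ => by ring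
  have e5 : ∑ a, ∑ m, christoffel G m a k y * (1 / 2 * K a j m) =
      1 / 2 * ∑ a, ∑ m, christoffel G m a k y * K a j m := by
    simp only [Finset.mul_sum]
    exact Finset.sum_congr rfl fun a _ => Finset.sum_congr rfl fun m _ => by ring
  have e6 : ∑ a, ∑ m, 1 / 2 * K m a k * christoffel G a j m y =
      1 / 2 * ∑ a, ∑ m, christoffel G a j m y * K m a k := by
    simp only [Finset.mul_sum]
    exact Finset.sum_congr rfl fun a _ => Finset.sum_congr rfl fun m _ => by ring
  rw [e1, e2, e3, e4, e5, e6]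
  ring

theorem IsLocalMetric.codiffFlux_antisymm {y : EuclideanSpace ℝ (Fin n)} (hy : y ∈ U)
    (i j : Fin n) : codiffFlux G H y i j = -codiffFlux G H y j i := by
  simp only [codiffFlux, neg_neg, covFlux]
  rw [← sub_eq_zero, sub_eq_add_neg, ← neg_add, neg_eq_zero, ← Finset.sum_add_distrib]
  refine Finset.sum_eq_zero fun a _ => ?_
  rw [← Finset.sum_add_distrib]
  refine Finset.sum_eq_zero fun b _ => ?_
  rw [← mul_add, mul_eq_zero]
  right
  rw [pd_congr_of_isOpen hG.isOpen hy a fun z hz => hH.swap_right z hz b i j, pd_neg,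
    sub_add_sub_comm, neg_add_cancel, zero_sub, neg_eq_zero, ← Finset.sum_add_distrib]
  refine Finset.sum_eq_zero fun m _ => ?_
  rw [hH.swap_right y hy m i j, hH.swap_right y hy b m j, hH.swap_right y hy b i m]
  ring

omit hH in
theorem IsLocalMetric.fluxSq_symm {y : EuclideanSpace ℝ (Fin n)} (hy : y ∈ U)
    (i j : Fin n) : fluxSq G H i j y = fluxSq G H j i y := by
  simp only [fluxSq]
  congr 1
  have : ∀ f : Fin n → Fin n → Fin n → Fin n → ℝ,
      ∑ a, ∑ b, ∑ c, ∑ d, f a b c d = ∑ a, ∑ b, ∑ c, ∑ d, f c d a b := by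
    intro f
    simp only [← Fintype.sum_prod_type']
    exact Fintype.sum_equiv ⟨fun p => (p.2.2.1, p.2.2.2, p.1, p.2.1),
      fun p => (p.2.2.1, p.2.2.2, p.1, p.2.1), fun _ => rfl, fun _ => rfl⟩ _ _ fun _ => rfl
  rw [this]
  refine Finset.sum_congr rfl fun a _ => Finset.sum_congr rfl fun b _ =>
    Finset.sum_congr rfl fun c _ => Finset.sum_congr rfl fun d _ => ?_
  rw [hG.ginv_symm hy a c, hG.ginv_symm hy b d]
  ring

omit hH in
theorem IsLocalMetric.curvSq_symm {y : EuclideanSpace ℝ (Fin n)} (hy : y ∈ U)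
    (i j : Fin n) : curvSq G H i j y = curvSq G H j i y := by
  simp only [curvSq]
  congr 1
  have : ∀ f : Fin n → Fin n → Fin n → Fin n → Fin n → Fin n → ℝ,
      ∑ a, ∑ b, ∑ c, ∑ d, ∑ p, ∑ q, f a b c d p q =
        ∑ a, ∑ b, ∑ c, ∑ d, ∑ p, ∑ q, f d p q a b c := by
    intro f
    simp only [← Fintype.sum_prod_type']
    exact Fintype.sum_equiv ⟨fun p => (p.2.2.2.1, p.2.2.2.2.1, p.2.2.2.2.2, p.1, p.2.1, p.2.2.1),
      fun p => (p.2.2.2.1, p.2.2.2.2.1, p.2.2.2.2.2, p.1, p.2.1, p.2.2.1),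
      fun _ => rfl, fun _ => rfl⟩ _ _ fun _ => rfl
  rw [this]
  refine Finset.sum_congr rfl fun a _ => Finset.sum_congr rfl fun b _ =>
    Finset.sum_congr rfl fun c _ => Finset.sum_congr rfl fun d _ =>
    Finset.sum_congr rfl fun p _ => Finset.sum_congr rfl fun q _ => ?_
  rw [hG.ginv_symm hy d a, hG.ginv_symm hy p b, hG.ginv_symm hy q c]
  ring

variable {κ : ℝ} {φ : EuclideanSpace ℝ (Fin n) → Fin n → ℝ}

omit hH in
theorem IsLocalMetric.covForm_symm {y : EuclideanSpace ℝ (Fin n)} (hy : y ∈ U)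
    (hφ : ∀ i j, pd i (fun z => φ z j) y - pd j (fun z => φ z i) y = 0) (i j : Fin n) :
    covForm G (fun _ _ _ _ => 0) φ i j y = covForm G (fun _ _ _ _ => 0) φ j i y := by
  simp only [covForm, conn_zero, sub_eq_zero.mp (hφ i j), hG.christoffel_symm hy _ i j]

omit hG hH in
-- The torsion correction is `½ φ^♯ ⌟ H`. For a three-form `H` it is skew, so for closed `φ` this is
-- the splitting of `∇^{g,H}φ` into symmetric and skew parts.
theorem covForm_eq (i j : Fin n) (y : EuclideanSpace ℝ (Fin n)) :
    covForm G H φ i j y = covForm G (fun _ _ _ _ => 0) φ i j y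
      + (1 / 2) * ∑ k, (∑ l, ginv G y k l * H y i j l) * φ y k := by
  simp only [covForm, conn_zero]
  simp only [conn, sub_mul, Finset.sum_sub_distrib, Finset.mul_sum, Finset.sum_mul, mul_assoc]
  ring

/-- The symmetric part of the Einstein equation of a Heterotic soliton. -/
theorem IsLocalMetric.two_covForm_of_soliton {y : EuclideanSpace ℝ (Fin n)} (hy : y ∈ U)
    (hS : SolitonSystemAt κ G φ H y) (i j : Fin n) :
    2 * covForm G (fun _ _ _ _ => 0) φ i j y =
      -2 * (ricciLC G i j y - (1 / 2) * fluxSq G H i j y) - 2 * κ * curvSq G H i j y := by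
  have h1 := hS.einstein i j
  have h2 := hS.einstein j i
  rw [hG.ricci_eq hH hy, covForm_eq] at h1 h2
  have hK : ∑ k, (∑ l, ginv G y k l * H y j i l) * φ y k =
      -∑ k, (∑ l, ginv G y k l * H y i j l) * φ y k := by
    simp only [hH.swap_left y hy j i, mul_neg, Finset.sum_neg_distrib, neg_mul]
  rw [hG.ricciLC_symm hy j i, hG.fluxSq_symm hy j i, hG.curvSq_symm hy j i,
    hG.codiffFlux_antisymm hH hy j i, hG.covForm_symm hy hS.closed j i, hK] at h2
  -- Adding the equations for `(i, j)` and `(j, i)` cancels the skew terms `½ δH` and `½ φ^♯ ⌟ H`.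
  linarith

/-- The skew part of the Einstein equation of a Heterotic soliton: `φ^♯ ⌟ H = - δ H`. -/
theorem IsLocalMetric.codiffFlux_of_soliton {y : EuclideanSpace ℝ (Fin n)} (hy : y ∈ U)
    (hS : SolitonSystemAt κ G φ H y) (i j : Fin n) :
    codiffFlux G H y i j = -∑ l, (∑ k, ginv G y l k * φ y k) * H y l i j := by
  have h1 := hS.einstein i j
  have h2 := hS.einstein j i
  rw [hG.ricci_eq hH hy, covForm_eq] at h1 h2
  have hK : ∑ k, (∑ l, ginv G y k l * H y j i l) * φ y k =
      -∑ k, (∑ l, ginv G y k l * H y i j l) * φ y k := by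
    simp only [hH.swap_left y hy j i, mul_neg, Finset.sum_neg_distrib, neg_mul]
  rw [hG.ricciLC_symm hy j i, hG.fluxSq_symm hy j i, hG.curvSq_symm hy j i,
    hG.codiffFlux_antisymm hH hy j i, hG.covForm_symm hy hS.closed j i, hK] at h2
  have h3 : ∑ l, (∑ k, ginv G y l k * φ y k) * H y l i j =
      ∑ k, (∑ l, ginv G y k l * H y i j l) * φ y k := by
    simp only [Finset.sum_mul]
    rw [Finset.sum_comm]
    refine Finset.sum_congr rfl fun k _ => Finset.sum_congr rfl fun l _ => ?_
    rw [hG.ginv_symm hy l k, hH.cycle hy l i j]; ring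
  rw [h3]
  -- Subtracting the two equations leaves only the skew terms.
  linarith

omit hH in
/-- The Lie derivative of the metric along the dual of a closed one-form is twice the covariant
derivative of the form. -/
theorem IsLocalMetric.lieDeriv_sharp {y : EuclideanSpace ℝ (Fin n)} (hy : y ∈ U)
    (hφs : ∀ i, DifferentiableAt ℝ (fun z => φ z i) y)
    (hφ : ∀ i j, pd i (fun z => φ z j) y - pd j (fun z => φ z i) y = 0)
    {V : EuclideanSpace ℝ (Fin n) → Fin n → ℝ}
    (hV : ∀ z ∈ U, ∀ k, V z k = ∑ l, ginv G z k l * φ z l) (i j : Fin n) :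
    ∑ m, V y m * pd m (fun z => G z i j) y + ∑ m, G y m j * pd i (fun z => V z m) y
      + ∑ m, G y i m * pd j (fun z => V z m) y = 2 * covForm G (fun _ _ _ _ => 0) φ i j y := by
  have hVd : ∀ k, DifferentiableAt ℝ (fun z => V z k) y := fun k => by
    have : DifferentiableAt ℝ (fun z => ∑ l, ginv G z k l * φ z l) y :=
      DifferentiableAt.fun_sum fun l _ => (hG.differentiableAt_ginv hy k l).fun_mul (hφs l)
    exact this.congr_of_eventuallyEq
      (Filter.eventuallyEq_of_mem (hG.isOpen.mem_nhds hy) fun z hz => hV z hz k)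
  -- Lowering the index again, `φ_j = g_{mj} V^m`. Differentiating this identity trades the
  -- derivatives of `V` for those of `φ` and `g`, and the derivatives of `g` then combine into
  -- Christoffel symbols.
  have hφV : ∀ z ∈ U, ∀ j, φ z j = ∑ m, G z m j * V z m := by
    intro z hz j
    have h : φ z = (G z * ginv G z).mulVec (φ z) := by rw [hG.mul_ginv hz, Matrix.one_mulVec]
    have hVz : V z = (ginv G z).mulVec (φ z) := by
      funext k; rw [hV z hz k]; rfl
    rw [← Matrix.mulVec_mulVec, ← hVz] at h
    rw [congrFun h j, Matrix.mulVec, dotProduct]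
    exact Finset.sum_congr rfl fun m _ => by rw [hG.apply_symm hz j m]
  have hpd : ∀ i j, pd i (fun z => φ z j) y =
      ∑ m, pd i (fun z => G z m j) y * V y m + ∑ m, G y m j * pd i (fun z => V z m) y := by
    intro i j
    rw [pd_congr_of_isOpen hG.isOpen hy i fun z hz => hφV z hz j,
      pd_sum i fun m _ => (hG.differentiableAt hy m j).fun_mul (hVd m), ← Finset.sum_add_distrib]
    exact Finset.sum_congr rfl fun m _ => pd_mul i (hG.differentiableAt hy m j) (hVd m)
  have hΓ : ∑ k, christoffel G k i j y * φ y k = ∑ m, (1 / 2) * (pd i (fun z => G z j m) y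
      + pd j (fun z => G z i m) y - pd m (fun z => G z i j) y) * V y m := by
    simp only [christoffel, hV y hy, Finset.mul_sum, Finset.sum_mul]
    rw [Finset.sum_comm]
    refine Finset.sum_congr rfl fun m _ => Finset.sum_congr rfl fun k _ => ?_
    rw [hG.ginv_symm hy k m]; ring
  have e1 := hpd i j
  have e2 := hpd j i
  simp only [covForm, conn_zero]
  rw [hΓ]
  have e3 := hφ i j
  have e4 : ∑ m, G y i m * pd j (fun z => V z m) y = ∑ m, G y m i * pd j (fun z => V z m) y :=
    Finset.sum_congr rfl fun m _ => by rw [hG.apply_symm hy i m]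
  have e5 : ∑ m, (1 / 2) * (pd i (fun z => G z j m) y
      + pd j (fun z => G z i m) y - pd m (fun z => G z i j) y) * V y m =
      (1 / 2) * (∑ m, pd i (fun z => G z m j) y * V y m + ∑ m, pd j (fun z => G z m i) y * V y m
        - ∑ m, V y m * pd m (fun z => G z i j) y) := by
    rw [← Finset.sum_add_distrib, ← Finset.sum_sub_distrib, Finset.mul_sum]
    refine Finset.sum_congr rfl fun m _ => ?_
    rw [hG.pd_symm hy i j m, hG.pd_symm hy j i m]; ring
  rw [e4, e5]
  linarith

end Torsion

end Metric

/-! ### Algebra of the volume form in dimension three. -/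

/-- The Levi-Civita symbol `ε_{ijk}`. -/
def leviCivita (i j k : Fin 3) : ℝ :=
  (Matrix.of fun r s : Fin 3 => if ![i, j, k] r = s then (1 : ℝ) else 0).det

theorem leviCivita_swap_left (i j k : Fin 3) : leviCivita i j k = -leviCivita j i k := by
  have key : ∀ P : Fin 3 → Fin 3 → ℝ, (Matrix.of fun r s => P (![i, j, k] r) s).det =
      -(Matrix.of fun r s => P (![j, i, k] r) s).det := fun P => by
    simp only [Matrix.det_fin_three, Matrix.of_apply, Matrix.cons_val]
    ring
  exact key fun a s => if a = s then 1 else 0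

theorem leviCivita_swap_right (i j k : Fin 3) : leviCivita i j k = -leviCivita i k j := by
  have key : ∀ P : Fin 3 → Fin 3 → ℝ, (Matrix.of fun r s => P (![i, j, k] r) s).det =
      -(Matrix.of fun r s => P (![i, k, j] r) s).det := fun P => by
    simp only [Matrix.det_fin_three, Matrix.of_apply, Matrix.cons_val]
    ring
  exact key fun a s => if a = s then 1 else 0

/-- An endomorphism acts on a form of top degree, as a derivation, by its trace. With `w` the
derivative of a vector field this is the divergence formula for the exterior derivative of a
contraction. -/
theorem leviCivita_divergence (w : Fin 3 → Fin 3 → ℝ) (i j k : Fin 3) :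
    (∑ l, w i l * leviCivita l j k) - (∑ l, w j l * leviCivita l i k)
      + (∑ l, w k l * leviCivita l i j) = (∑ m, w m m) * leviCivita i j k := by
  fin_cases i <;> fin_cases j <;> fin_cases k <;>
    simp [leviCivita, Matrix.det_fin_three, Fin.sum_univ_three] <;> ring

/-- The exterior derivative of the contraction of the three-form `h dx¹dx²dx³` with a vector
field. -/
theorem extDerivTwo_contraction {U : Set (EuclideanSpace ℝ (Fin 3))} (hU : IsOpen U)
    {y : EuclideanSpace ℝ (Fin 3)} (hy : y ∈ U)
    {β : EuclideanSpace ℝ (Fin 3) → Fin 3 → Fin 3 → ℝ}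
    {V : EuclideanSpace ℝ (Fin 3) → Fin 3 → ℝ} {h : EuclideanSpace ℝ (Fin 3) → ℝ}
    (hV : ∀ k, DifferentiableAt ℝ (fun z => V z k) y) (hh : DifferentiableAt ℝ h y)
    (hβ : ∀ z ∈ U, ∀ i j, β z i j = ∑ l, V z l * (h z * leviCivita l i j)) (i j k : Fin 3) :
    extDerivTwo β i j k y =
      (∑ m, V y m * pd m h y + h y * ∑ m, pd m (fun z => V z m) y) * leviCivita i j k := by
  have key : ∀ p q r, pd p (fun z => β z q r) y =
      ∑ l, (V y l * pd p h y + h y * pd p (fun z => V z l) y) * leviCivita l q r := by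
    intro p q r
    rw [pd_congr_of_isOpen hU hy p fun z hz => hβ z hz q r,
      pd_sum p fun l _ => (hV l).fun_mul (hh.mul_const _)]
    refine Finset.sum_congr rfl fun l _ => ?_
    rw [pd_mul p (hV l) (hh.mul_const _), pd_mul_const p _ hh]
    ring
  rw [extDerivTwo, key, key, key, Finset.mul_sum, ← Finset.sum_add_distrib]
  exact leviCivita_divergence (fun p l => V y l * pd p h y + h y * pd p (fun z => V z l) y) i j k

end LocalCalculusLemmas
/-! ## Smooth dependence of the solutions of an ordinary differential equation on the data -/

section SmoothFlow

open Set Filter Topology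

universe u

/-! ### Differentiability of the composition operator `γ ↦ X ∘ γ` on continuous maps. -/

section Nemytskii

variable {K : Type*} [TopologicalSpace K] [CompactSpace K]
  {E F : Type*} [NormedAddCommGroup E] [NormedSpace ℝ E] [NormedAddCommGroup F] [NormedSpace ℝ F]

/-- The pointwise application `C(K, E →L F) × C(K, E) → C(K, F)`, as a continuous bilinear map. -/
def pointwiseApply : C(K, E →L[ℝ] F) →L[ℝ] C(K, E) →L[ℝ] C(K, F) :=
  LinearMap.mkContinuous₂
    (LinearMap.mk₂ ℝ (fun (A : C(K, E →L[ℝ] F)) (h : C(K, E)) => (⟨fun s => A s (h s), by fun_prop⟩ : C(K, F)))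
      (fun _ _ _ => by ext; simp) (fun _ _ _ => by ext; simp) (fun _ _ _ => by ext; simp)
      (fun _ _ _ => by ext; simp)) 1
    (fun A h => by
      rw [ContinuousMap.norm_le _ (by positivity)]
      intro s
      calc ‖A s (h s)‖ ≤ ‖A s‖ * ‖h s‖ := (A s).le_opNorm _
        _ ≤ 1 * ‖A‖ * ‖h‖ := by
          rw [one_mul]
          gcongr
          · exact A.norm_coe_le_norm s
          · exact h.norm_coe_le_norm s)

/-- The mean value inequality at each point `s`, on a ball where `X'` varies by at most `c`; uniform
continuity of `X'` makes the radius independent of `s`, which is what the sup norm requires. -/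
theorem hasFDerivAt_continuousMap_comp {X : C(E, F)} {X' : C(E, E →L[ℝ] F)}
    (hX : ∀ x, HasFDerivAt X (X' x) x) (hu : UniformContinuous X') (γ : C(K, E)) :
    HasFDerivAt (fun γ : C(K, E) => X.comp γ) (pointwiseApply (X'.comp γ)) γ := by
  rw [hasFDerivAt_iff_isLittleO_nhds_zero, Asymptotics.isLittleO_iff]
  intro c hc
  obtain ⟨δ, hδ, hX'⟩ := Metric.uniformContinuous_iff.mp hu c hc
  filter_upwards [Metric.ball_mem_nhds (0 : C(K, E)) hδ] with h hh
  rw [mem_ball_zero_iff] at hh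
  rw [ContinuousMap.norm_le _ (by positivity)]
  intro s
  have hs : ‖h s‖ < δ := (h.norm_coe_le_norm s).trans_lt hh
  have key : ‖X (γ s + h s) - X (γ s) - X' (γ s) (γ s + h s - γ s)‖ ≤ c * ‖γ s + h s - γ s‖ := by
    refine Convex.norm_image_sub_le_of_norm_hasFDerivWithin_le' (s := Metric.ball (γ s) δ)
      (fun x _ => (hX x).hasFDerivWithinAt) (fun x hx => ?_) (convex_ball _ _)
      (Metric.mem_ball_self hδ) (by simpa using hs)
    rw [← dist_eq_norm]
    exact (hX' hx).le
  rw [add_sub_cancel_left] at key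
  refine key.trans ?_
  gcongr
  exact h.norm_coe_le_norm s

end Nemytskii

/-- Induction on the order: the derivative of the operator is a continuous linear map applied to the
composition operator of `fderiv ℝ X`, which is again smooth with compact support. The target changes
from `F` to `E →L[ℝ] F`, so `F` is quantified inside the induction and shares the universe of `E`.
Compact support provides the uniform continuity. -/
theorem contDiff_continuousMap_comp_nat {K : Type*} [TopologicalSpace K] [CompactSpace K]
    {E : Type u} [NormedAddCommGroup E] [NormedSpace ℝ E] (m : ℕ) :
    ∀ {F : Type u} [NormedAddCommGroup F] [NormedSpace ℝ F] (X : C(E, F)),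
      ContDiff ℝ ∞ X → HasCompactSupport X →
        ContDiff ℝ m (fun γ : C(K, E) => X.comp γ) := by
  induction m with
  | zero =>
    intro F _ _ X _ _
    exact contDiff_zero.mpr (by fun_prop)
  | succ m ih =>
    intro F _ _ X hX hc
    have hX' : ContDiff ℝ ∞ (fderiv ℝ X) := hX.fderiv_right (by simp)
    let X' : C(E, E →L[ℝ] F) := ⟨fderiv ℝ X, hX'.continuous⟩
    have hc' : HasCompactSupport X' := hc.fderiv ℝ
    refine contDiff_succ_iff_hasFDerivAt.mpr ⟨fun γ => pointwiseApply (X'.comp γ), ?_, fun γ => ?_⟩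
    · exact pointwiseApply.contDiff.comp (ih X' hX' hc')
    · exact hasFDerivAt_continuousMap_comp
        (fun x => (hX.differentiable (by simp) x).hasFDerivAt)
        (hc'.uniformContinuous_of_continuous X'.continuous) γ

theorem contDiff_continuousMap_comp {K : Type*} [TopologicalSpace K] [CompactSpace K]
    {E F : Type u} [NormedAddCommGroup E] [NormedSpace ℝ E] [NormedAddCommGroup F]
    [NormedSpace ℝ F] {X : C(E, F)} (hX : ContDiff ℝ ∞ X) (hc : HasCompactSupport X) :
    ContDiff ℝ ∞ (fun γ : C(K, E) => X.comp γ) :=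
  contDiff_infty.mpr fun m => contDiff_continuousMap_comp_nat m X hX hc

/-- The implicit function of a smooth equation is smooth near the base point. -/
theorem eventually_contDiffAt_implicitFunction {E₁ E₂ F : Type*} [NormedAddCommGroup E₁]
    [NormedSpace ℝ E₁] [CompleteSpace E₁] [NormedAddCommGroup E₂] [NormedSpace ℝ E₂]
    [CompleteSpace E₂] [NormedAddCommGroup F] [NormedSpace ℝ F] [CompleteSpace F]
    {u : E₁ × E₂} {f : E₁ × E₂ → F} (hf : ContDiff ℝ ∞ f)
    (hinv : (fderiv ℝ f u ∘L .inr ℝ E₁ E₂).IsInvertible) :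
    ∀ᶠ x in 𝓝 u.1, ContDiffAt ℝ ∞
      (hf.contDiffAt.implicitFunction (by simp) hinv : E₁ → E₂) x := by
  set ψ := hf.contDiffAt.implicitFunction (by simp) hinv with hψ
  have h0 : ψ u.1 = u.2 := hf.contDiffAt.implicitFunction_apply_self (by simp) hinv
  -- Order `1` at a point spreads to a neighbourhood, while order `∞` at a point need not.
  -- Smoothness at a nearby `x` is therefore obtained below by basing the implicit function theorem
  -- anew at `(x, ψ x)` and identifying the two implicit functions near `x`.
  have hcont : ∀ᶠ x in 𝓝 u.1, ContinuousAt ψ x := by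
    have h1 : ContDiffAt ℝ 1 ψ u.1 :=
      (hf.contDiffAt.contDiffAt_implicitFunction (by simp) hinv).of_le (by simp)
    filter_upwards [h1.eventually (by simp)] with x hx using hx.continuousAt
  have hsol : ∀ᶠ x in 𝓝 u.1, f (x, ψ x) = f u :=
    hf.contDiffAt.eventually_apply_implicitFunction (by simp) hinv
  have hinv' : ∀ᶠ x in 𝓝 u.1, (fderiv ℝ f (x, ψ x) ∘L .inr ℝ E₁ E₂).IsInvertible := by
    have hc : ContinuousAt (fun x => fderiv ℝ f (x, ψ x) ∘L .inr ℝ E₁ E₂) u.1 := by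
      have h2 : ContinuousAt (fun x => fderiv ℝ f (x, ψ x)) u.1 :=
        (hf.continuous_fderiv (by simp)).continuousAt.comp
          (continuousAt_id.prodMk hcont.self_of_nhds)
      exact h2.clm_comp continuousAt_const
    obtain ⟨e, he⟩ := hinv
    have h3 : (fun x => fderiv ℝ f (x, ψ x) ∘L .inr ℝ E₁ E₂) u.1 = (e : E₂ →L[ℝ] F) := by
      simp only [h0]; exact he.symm
    have := hc.preimage_mem_nhds (h3 ▸ e.nhds)
    filter_upwards [this] with x hx
    obtain ⟨e', he'⟩ := hx
    exact ⟨e', he'⟩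
  filter_upwards [hcont, hsol.eventually_nhds, hinv'] with x hx hs hi
  have hloc := hf.contDiffAt.eventually_apply_eq_iff_implicitFunction (u := (x, ψ x)) (by simp) hi
  refine (hf.contDiffAt.contDiffAt_implicitFunction (u := (x, ψ x)) (by simp) hi).congr_of_eventuallyEq ?_
  have htend : Tendsto (fun z => (z, ψ z)) (𝓝 x) (𝓝 (x, ψ x)) :=
    (continuousAt_id.prodMk hx).tendsto
  filter_upwards [htend.eventually hloc, hs] with z hz hsz
  exact (hz.mp (hsz.trans hs.self_of_nhds.symm)).symm

/-! ### The integral equation on `C([0,1], E)` and the local flow. -/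

section Integral

variable {E : Type u} [NormedAddCommGroup E] [NormedSpace ℝ E] [CompleteSpace E]

/-- The integration operator `γ ↦ (s ↦ ∫₀ˢ γ)` on `C([0,1], E)`. -/
def integralCLM : C(Icc (0 : ℝ) 1, E) →L[ℝ] C(Icc (0 : ℝ) 1, E) :=
  LinearMap.mkContinuous
    { toFun := fun γ => ⟨fun s => ∫ r in (0 : ℝ)..s, γ (projIcc 0 1 zero_le_one r), by
        have hc : Continuous fun r : ℝ => γ (projIcc 0 1 zero_le_one r) :=
          γ.continuous.comp continuous_projIcc
        exact (intervalIntegral.continuous_primitive (fun a b => hc.intervalIntegrable a b) 0).comp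
          continuous_subtype_val⟩
      map_add' := fun γ γ' => by
        ext s
        exact intervalIntegral.integral_add
          ((γ.continuous.comp continuous_projIcc).intervalIntegrable _ _)
          ((γ'.continuous.comp continuous_projIcc).intervalIntegrable _ _)
      map_smul' := fun c γ => by
        ext s
        exact intervalIntegral.integral_smul c _ } 1 (fun γ => by
      rw [ContinuousMap.norm_le _ (by positivity)]
      intro s
      refine (intervalIntegral.norm_integral_le_of_norm_le_const (C := ‖γ‖)
        fun r _ => γ.norm_coe_le_norm _).trans ?_
      rw [sub_zero, abs_of_nonneg s.2.1, mul_comm]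
      exact mul_le_mul_of_nonneg_right s.2.2 (norm_nonneg _))

omit [CompleteSpace E] in
theorem integralCLM_apply (γ : C(Icc (0 : ℝ) 1, E)) (s : Icc (0 : ℝ) 1) :
    integralCLM γ s = ∫ r in (0 : ℝ)..s, γ (projIcc 0 1 zero_le_one r) := rfl

/-- A smooth compactly supported vector field has a local flow that is smooth in time and space. -/
theorem exists_smooth_local_flow {X : E → E} (hX : ContDiff ℝ ∞ X) (hc : HasCompactSupport X)
    (x₀ : E) : ∃ ε > 0, ∃ δ > 0, ∃ α : E → ℝ → E,
      (∀ x ∈ Metric.ball x₀ δ, α x 0 = x ∧ ∀ t ∈ Ioo (-ε) ε, HasDerivAt (α x) (X (α x t)) t) ∧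
      ContDiffOn ℝ ∞ (fun p : ℝ × E => α p.2 p.1) (Ioo (-ε) ε ×ˢ Metric.ball x₀ δ) := by
  -- Picard–Lindelöf supplies the solution curves; the implicit function theorem is needed only to
  -- show that they depend smoothly on time and initial point.
  obtain ⟨r, hr, ε, hε, H⟩ :=
    (hX.contDiffAt (x := x₀)).of_le (n := ∞) (m := 1) (by simp)
      |>.exists_forall_mem_closedBall_exists_eq_forall_mem_Ioo_hasDerivAt 0
  choose! α hα0 hα using H
  simp only [zero_sub, zero_add] at hα
  let Xc : C(E, E) := ⟨X, hX.continuous⟩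
  -- For an integral curve `α`, the rescaled curve `γ(s) = α(ts)` solves `γ(s) = x + t ∫₀ˢ X(γ)`.
  -- The interval is fixed and the time `t` becomes a parameter on the same footing as `x`, so joint
  -- smoothness follows at once.
  let Φ : (ℝ × E) × C(Icc (0 : ℝ) 1, E) → C(Icc (0 : ℝ) 1, E) := fun q =>
    q.2 - ContinuousLinearMap.const ℝ (Icc (0 : ℝ) 1) q.1.2 - q.1.1 • integralCLM (Xc.comp q.2)
  have hΦ : ContDiff ℝ ∞ Φ := by
    have h1 : ContDiff ℝ ∞ fun q : (ℝ × E) × C(Icc (0 : ℝ) 1, E) => integralCLM (Xc.comp q.2) :=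
      integralCLM.contDiff.comp ((contDiff_continuousMap_comp (X := Xc) hX hc).comp contDiff_snd)
    exact (contDiff_snd.sub ((ContinuousLinearMap.contDiff _).comp
      (contDiff_snd.comp contDiff_fst))).sub ((contDiff_fst.comp contDiff_fst).smul h1)
  -- At `t = 0` the integral term disappears, so the partial derivative of `Φ` in `γ` is the
  -- identity.
  let u : (ℝ × E) × C(Icc (0 : ℝ) 1, E) :=
    ((0, x₀), ContinuousLinearMap.const ℝ (Icc (0 : ℝ) 1) x₀)
  have hu : Φ u = 0 := by simp [Φ, u]
  have hinv : (fderiv ℝ Φ u ∘L .inr ℝ (ℝ × E) C(Icc (0 : ℝ) 1, E)).IsInvertible := by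
    have h1 : HasFDerivAt (fun γ => Φ (u.1, γ))
        (fderiv ℝ Φ u ∘L .inr ℝ (ℝ × E) C(Icc (0 : ℝ) 1, E)) u.2 :=
      HasFDerivAt.comp (g := Φ) u.2 (hΦ.differentiable (by simp) u).hasFDerivAt
        (hasFDerivAt_prodMk_right u.1 u.2)
    have h2 : HasFDerivAt (fun γ => Φ (u.1, γ))
        (ContinuousLinearMap.id ℝ C(Icc (0 : ℝ) 1, E)) u.2 := by
      simp only [Φ, u, zero_smul, sub_zero]
      exact (hasFDerivAt_id _).sub_const _
    rw [h1.unique h2]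
    exact ⟨ContinuousLinearEquiv.refl ℝ _, rfl⟩
  set ψ := hΦ.contDiffAt.implicitFunction (by simp) hinv with hψ
  have hsm : ∀ᶠ p in 𝓝 u.1, ContDiffAt ℝ ∞ ψ p := eventually_contDiffAt_implicitFunction hΦ hinv
  have huniq : ∀ᶠ q in 𝓝 u, Φ q = Φ u ↔ ψ q.1 = q.2 :=
    hΦ.contDiffAt.eventually_apply_eq_iff_implicitFunction (by simp) hinv
  obtain ⟨η, hη, hηu⟩ := Metric.eventually_nhds_iff.mp huniq
  obtain ⟨ζ, hζ, hζs⟩ := Metric.eventually_nhds_iff.mp hsm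
  obtain ⟨C, hC⟩ := hc.exists_bound_of_continuous hX.continuous
  have hC0 : 0 ≤ C := (norm_nonneg _).trans (hC x₀)
  -- `r` and `ε` keep the curves where they exist, `ζ` keeps `(t, x)` where the implicit function is
  -- smooth. The bounds by `η` place `((t, x), γ)` in the uniqueness neighbourhood: `γ` deviates
  -- from `x₀` by at most `‖x - x₀‖ + |t| C ≤ η/4 + η/4`. The `C + 1` avoids dividing by zero.
  let δ := min (min r (η / 4)) (ζ / 2)
  let ε' := min (min ε (η / (4 * (C + 1)))) (min (ζ / 2) (η / 4))
  have hδ : 0 < δ := by positivity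
  have hε' : 0 < ε' := by positivity
  have hδr : δ ≤ r := (min_le_left _ _).trans (min_le_left _ _)
  have hδη : δ ≤ η / 4 := (min_le_left _ _).trans (min_le_right _ _)
  have hδζ : δ ≤ ζ / 2 := min_le_right _ _
  have hεε : ε' ≤ ε := (min_le_left _ _).trans (min_le_left _ _)
  have hεC : ε' ≤ η / (4 * (C + 1)) := (min_le_left _ _).trans (min_le_right _ _)
  have hεζ : ε' ≤ ζ / 2 := (min_le_right _ _).trans (min_le_left _ _)
  have hεη : ε' ≤ η / 4 := (min_le_right _ _).trans (min_le_right _ _)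
  refine ⟨ε', hε', δ, hδ, α, fun x hx => ⟨hα0 x (Metric.ball_subset_closedBall
    (Metric.ball_subset_ball hδr hx)), fun t ht => hα x (Metric.ball_subset_closedBall
    (Metric.ball_subset_ball hδr hx)) t (Ioo_subset_Ioo (neg_le_neg hεε) hεε ht)⟩, ?_⟩
  -- The solution at time `t` is the rescaled curve at `s = 1`.
  have key : ∀ p ∈ Ioo (-ε') ε' ×ˢ Metric.ball x₀ δ, α p.2 p.1 = ψ p ⟨1, by simp⟩ := by
    rintro ⟨t, x⟩ ⟨ht, hx⟩
    have hxr : x ∈ Metric.closedBall x₀ r :=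
      Metric.ball_subset_closedBall (Metric.ball_subset_ball hδr hx)
    have hmem : ∀ s ∈ Icc (0 : ℝ) 1, t * s ∈ Ioo (-ε) ε := by
      intro s hs
      have : |t * s| < ε := by
        rw [abs_mul, abs_of_nonneg hs.1]
        exact (mul_le_of_le_one_right (abs_nonneg _) hs.2).trans_lt
          ((abs_lt.mpr ht).trans_le hεε)
      exact abs_lt.mp this
    have hcs : ∀ s ∈ Icc (0 : ℝ) 1, ContinuousAt (fun s => α x (t * s)) s := fun s hs =>
      ContinuousAt.comp (f := fun s => t * s) (hα x hxr _ (hmem s hs)).continuousAt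
        (by fun_prop)
    let γ : C(Icc (0 : ℝ) 1, E) := ⟨fun s => α x (t * s), by
      rw [continuous_iff_continuousAt]
      exact fun s => ContinuousAt.comp (f := Subtype.val) (hcs s s.2)
        continuous_subtype_val.continuousAt⟩
    have hγ : ∀ s : Icc (0 : ℝ) 1, γ s = x + t • integralCLM (Xc.comp γ) s := by
      intro s
      have hd : ∀ r ∈ uIcc (0 : ℝ) s, HasDerivAt (fun r => α x (t * r))
          (t • X (α x (t * r))) r := by
        intro r hr'
        rw [uIcc_of_le s.2.1] at hr'
        have hr1 : r ∈ Icc (0 : ℝ) 1 := ⟨hr'.1, hr'.2.trans s.2.2⟩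
        have := HasDerivAt.scomp (h := fun r => t * r) r (hα x hxr _ (hmem r hr1))
          ((hasDerivAt_id r).const_mul t)
        simpa [Function.comp_def] using this
      have hi : IntervalIntegrable (fun r => t • X (α x (t * r))) MeasureTheory.volume 0 s := by
        refine ContinuousOn.intervalIntegrable fun r hr' => ?_
        rw [uIcc_of_le s.2.1] at hr'
        exact ((hX.continuous.continuousAt.comp
          (hcs r ⟨hr'.1, hr'.2.trans s.2.2⟩)).const_smul t).continuousWithinAt
      have hftc := intervalIntegral.integral_eq_sub_of_hasDerivAt hd hi
      rw [intervalIntegral.integral_smul, mul_zero, hα0 x hxr] at hftc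
      have : ∫ r in (0 : ℝ)..s, X (α x (t * r)) = integralCLM (Xc.comp γ) s := by
        rw [integralCLM_apply]
        refine intervalIntegral.integral_congr fun r hr' => ?_
        rw [uIcc_of_le s.2.1] at hr'
        simp only [ContinuousMap.comp_apply]
        rw [projIcc_of_mem zero_le_one ⟨hr'.1, hr'.2.trans s.2.2⟩]
        rfl
      rw [← this, hftc]
      simp [γ]
    have hΦγ : Φ ((t, x), γ) = Φ u := by
      rw [hu]
      ext s
      have := hγ s
      simp only [Φ, ContinuousMap.sub_apply, ContinuousMap.smul_apply, ContinuousMap.zero_apply]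
      rw [this]
      simp
    have hdist : dist ((t, x), γ) u < η := by
      rw [Prod.dist_eq, Prod.dist_eq, max_lt_iff, max_lt_iff]
      refine ⟨⟨?_, ?_⟩, ?_⟩
      · rw [Real.dist_eq, sub_zero]
        exact (abs_lt.mpr ht).trans_le (hεη.trans (by linarith))
      · exact (Metric.mem_ball.mp hx).trans_le (hδη.trans (by linarith))
      · have hn : ‖integralCLM (Xc.comp γ)‖ ≤ C := by
          rw [ContinuousMap.norm_le _ hC0]
          intro s
          rw [integralCLM_apply]
          refine (intervalIntegral.norm_integral_le_of_norm_le_const (C := C)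
            fun r _ => hC _).trans ?_
          rw [sub_zero, abs_of_nonneg s.2.1]
          exact mul_le_of_le_one_right hC0 s.2.2
        have hb : dist γ u.2 ≤ η / 2 := by
          rw [ContinuousMap.dist_le (by positivity)]
          intro s
          rw [hγ s]
          have h1 : dist (x + t • integralCLM (Xc.comp γ) s) x₀ ≤ dist x x₀ + |t| * C := by
            rw [dist_eq_norm, dist_eq_norm, add_sub_right_comm]
            refine (norm_add_le _ _).trans (add_le_add_right ?_ _)
            rw [norm_smul, Real.norm_eq_abs]
            gcongr
            exact (ContinuousMap.norm_coe_le_norm _ s).trans hn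
          have h2 : |t| * C ≤ η / 4 := by
            calc |t| * C ≤ η / (4 * (C + 1)) * (C + 1) := by
                  gcongr
                  · exact ((abs_lt.mpr ht).trans_le hεC).le
                  · linarith
              _ = η / 4 := by field_simp
          have h3 : dist x x₀ ≤ η / 4 := ((Metric.mem_ball.mp hx).trans_le hδη).le
          exact h1.trans (by linarith)
        exact hb.trans_lt (by linarith)
    have := (hηu hdist).mp hΦγ
    rw [this]
    simp [γ]
  intro p hp
  have hsmooth : ContDiffAt ℝ ∞ (fun p => ψ p ⟨1, by simp⟩) p := by
    have hpζ : dist p u.1 < ζ := by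
      rw [Prod.dist_eq, max_lt_iff]
      refine ⟨?_, (Metric.mem_ball.mp hp.2).trans_le (hδζ.trans (by linarith))⟩
      rw [Real.dist_eq, sub_zero]
      exact (abs_lt.mpr hp.1).trans_le (hεζ.trans (by linarith))
    exact (ContinuousMap.evalCLM ℝ (⟨1, by simp⟩ : Icc (0 : ℝ) 1)).contDiff.contDiffAt.comp p
      (hζs hpζ)
  exact hsmooth.contDiffWithinAt.congr key (key p hp)

end Integral

end SmoothFlow

/-! ## The flow of a smooth vector field on a compact manifold -/

section ManifoldFlow

open Set Filter Topology

/-- The tangent map of a smooth map is smooth. Allowing a field along a map `b`, and `f` smooth only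
on an open set, makes this applicable to charts, their inverses and diffeomorphisms alike. -/
theorem contMDiffAt_mfderiv_section {E₁ H₁ N₁ E₂ H₂ N₂ E₃ H₃ P : Type*}
    [NormedAddCommGroup E₁] [NormedSpace ℝ E₁] [TopologicalSpace H₁] {I₁ : ModelWithCorners ℝ E₁ H₁}
    [TopologicalSpace N₁] [ChartedSpace H₁ N₁] [IsManifold I₁ ∞ N₁]
    [NormedAddCommGroup E₂] [NormedSpace ℝ E₂] [TopologicalSpace H₂] {I₂ : ModelWithCorners ℝ E₂ H₂}
    [TopologicalSpace N₂] [ChartedSpace H₂ N₂] [IsManifold I₂ ∞ N₂]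
    [NormedAddCommGroup E₃] [NormedSpace ℝ E₃] [TopologicalSpace H₃] {I₃ : ModelWithCorners ℝ E₃ H₃}
    [TopologicalSpace P] [ChartedSpace H₃ P]
    {f : N₁ → N₂} {s : Set N₁} (hs : IsOpen s) (hf : ContMDiffOn I₁ I₂ ∞ f s) {p₀ : P} {b : P → N₁}
    {w : ∀ p, TangentSpace I₁ (b p)}
    (hw : ContMDiffAt I₃ I₁.tangent ∞ (fun p => (⟨b p, w p⟩ : TangentBundle I₁ N₁)) p₀)
    (hb : b p₀ ∈ s) :
    ContMDiffAt I₃ I₂.tangent ∞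
      (fun p => (⟨f (b p), mfderiv I₁ I₂ f (b p) (w p)⟩ : TangentBundle I₂ N₂)) p₀ := by
  have h1 := hf.contMDiffOn_tangentMapWithin (m := ∞) (by simp) hs.uniqueMDiffOn
  have hopen : IsOpen (Bundle.TotalSpace.proj ⁻¹' s : Set (TangentBundle I₁ N₁)) :=
    hs.preimage (FiberBundle.continuous_proj _ _)
  have h2 : ContMDiffAt I₁.tangent I₂.tangent ∞ (tangentMap I₁ I₂ f) ⟨b p₀, w p₀⟩ := by
    refine (h1.contMDiffAt (hopen.mem_nhds hb)).congr_of_eventuallyEq ?_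
    filter_upwards [hopen.mem_nhds (show (⟨b p₀, w p₀⟩ : TangentBundle I₁ N₁) ∈
      (Bundle.TotalSpace.proj ⁻¹' s : Set (TangentBundle I₁ N₁)) from hb)] with q hq
    rw [tangentMapWithin, tangentMap, mfderivWithin_of_isOpen hs hq]
  exact h2.comp p₀ hw

variable {E : Type*} [NormedAddCommGroup E] [NormedSpace ℝ E] {M : Type*} [TopologicalSpace M]
  [ChartedSpace E M] [IsManifold 𝓘(ℝ, E) ∞ M]

omit [IsManifold 𝓘(ℝ, E) ∞ M] in
theorem mdifferentiable_of_mem_maximalAtlas {e : OpenPartialHomeomorph M E}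
    (he : e ∈ IsManifold.maximalAtlas 𝓘(ℝ, E) ∞ M) : e.MDifferentiable 𝓘(ℝ, E) 𝓘(ℝ, E) :=
  ⟨fun _ hx => ((contMDiffOn_of_mem_maximalAtlas he).mdifferentiableOn (by simp)) _ hx,
    fun _ hx => ((contMDiffOn_symm_of_mem_maximalAtlas he).mdifferentiableOn (by simp)) _ hx⟩

/-- The components of the vector field `v` in the chart `e`. -/
def chartField (e : OpenPartialHomeomorph M E) (v : ∀ x : M, TangentSpace 𝓘(ℝ, E) x) (z : E) : E :=
  mfderiv 𝓘(ℝ, E) 𝓘(ℝ, E) e (e.symm z) (v (e.symm z))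

theorem contDiffOn_chartField {e : OpenPartialHomeomorph M E}
    (he : e ∈ IsManifold.maximalAtlas 𝓘(ℝ, E) ∞ M) {v : ∀ x : M, TangentSpace 𝓘(ℝ, E) x}
    (hv : ContMDiff 𝓘(ℝ, E) 𝓘(ℝ, E).tangent ∞ fun x => (⟨x, v x⟩ : TangentBundle 𝓘(ℝ, E) M)) :
    ContDiffOn ℝ ∞ (chartField e v) e.target := by
  intro z hz
  have hsymm : ContMDiffAt 𝓘(ℝ, E) 𝓘(ℝ, E) ∞ e.symm z :=
    (contMDiffOn_symm_of_mem_maximalAtlas he).contMDiffAt (e.open_target.mem_nhds hz)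
  have h1 : ContMDiffAt 𝓘(ℝ, E) 𝓘(ℝ, E).tangent ∞
      (fun z => (⟨e (e.symm z), mfderiv 𝓘(ℝ, E) 𝓘(ℝ, E) e (e.symm z) (v (e.symm z))⟩ :
        TangentBundle 𝓘(ℝ, E) E)) z :=
    contMDiffAt_mfderiv_section e.open_source (contMDiffOn_of_mem_maximalAtlas he)
      (hv.contMDiffAt.comp z hsymm) (e.map_target hz)
  have h2 := (contMDiff_snd_tangentBundle_modelSpace E 𝓘(ℝ, E) (n := ∞)).contMDiffAt.comp z h1
  exact (contMDiffAt_iff_contDiffAt.mp h2).contDiffWithinAt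

omit [IsManifold 𝓘(ℝ, E) ∞ M] in
theorem mfderiv_symm_chartField {e : OpenPartialHomeomorph M E}
    (he : e ∈ IsManifold.maximalAtlas 𝓘(ℝ, E) ∞ M) (v : ∀ x : M, TangentSpace 𝓘(ℝ, E) x) {z : E}
    (hz : z ∈ e.target) :
    mfderiv 𝓘(ℝ, E) 𝓘(ℝ, E) e.symm z (chartField e v z : E) = v (e.symm z) := by
  have h := (mdifferentiable_of_mem_maximalAtlas he).symm_comp_deriv (e.map_target hz)
  have h' := congrArg (fun L => L (v (e.symm z))) h
  simp only [ContinuousLinearMap.comp_apply] at h'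
  rw [e.right_inv hz] at h'
  exact h'

omit [IsManifold 𝓘(ℝ, E) ∞ M] in
theorem isMIntegralCurveOn_chart_symm_comp {e : OpenPartialHomeomorph M E}
    (he : e ∈ IsManifold.maximalAtlas 𝓘(ℝ, E) ∞ M) {v : ∀ x : M, TangentSpace 𝓘(ℝ, E) x} {s : Set ℝ}
    {α : ℝ → E} (hα : ∀ t ∈ s, α t ∈ e.target)
    (hd : ∀ t ∈ s, HasDerivAt α (chartField e v (α t)) t) :
    IsMIntegralCurveOn (fun t => e.symm (α t)) v s := by
  intro t ht
  have h1 : HasMFDerivAt 𝓘(ℝ, ℝ) 𝓘(ℝ, E) α t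
      ((1 : ℝ →L[ℝ] ℝ).smulRight (chartField e v (α t) : E)) :=
    (hd t ht).hasFDerivAt.hasMFDerivAt
  have h2 := (((mdifferentiable_of_mem_maximalAtlas he).mdifferentiableAt_symm
    (hα t ht)).hasMFDerivAt).comp t h1
  have h3 : (mfderiv 𝓘(ℝ, E) 𝓘(ℝ, E) e.symm (α t)).comp
      ((1 : ℝ →L[ℝ] ℝ).smulRight (chartField e v (α t) : E)) =
      (1 : ℝ →L[ℝ] ℝ).smulRight (v (e.symm (α t))) := by
    rw [← mfderiv_symm_chartField he v (hα t ht)]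
    ext
    change mfderiv 𝓘(ℝ, E) 𝓘(ℝ, E) e.symm (α t) ((1 : ℝ) • chartField e v (α t) : E) =
      (1 : ℝ) • mfderiv 𝓘(ℝ, E) 𝓘(ℝ, E) e.symm (α t) (chartField e v (α t) : E)
    rw [one_smul, one_smul]
  exact (h2.congr_mfderiv h3).hasMFDerivWithinAt

omit [IsManifold 𝓘(ℝ, E) ∞ M] in
theorem hasDerivAt_chart_comp_of_isMIntegralCurveOn {e : OpenPartialHomeomorph M E}
    (he : e ∈ IsManifold.maximalAtlas 𝓘(ℝ, E) ∞ M) {v : ∀ x : M, TangentSpace 𝓘(ℝ, E) x} {s : Set ℝ}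
    {γ : ℝ → M} (hγ : IsMIntegralCurveOn γ v s) {t : ℝ} (hs : s ∈ 𝓝 t) (ht : γ t ∈ e.source) :
    HasDerivAt (fun r => e (γ r)) (chartField e v (e (γ t))) t := by
  have h1 := (hγ t (mem_of_mem_nhds hs)).hasMFDerivAt hs
  have h2 := (((mdifferentiable_of_mem_maximalAtlas he).mdifferentiableAt ht).hasMFDerivAt).comp t h1
  have h3 : HasMFDerivAt 𝓘(ℝ, ℝ) 𝓘(ℝ, E) (fun r => e (γ r)) t
      ((1 : ℝ →L[ℝ] ℝ).smulRight (chartField e v (e (γ t)) : E)) := by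
    refine h2.congr_mfderiv ?_
    ext
    rw [chartField, e.left_inv ht]
    change mfderiv 𝓘(ℝ, E) 𝓘(ℝ, E) e (γ t) ((1 : ℝ) • v (γ t)) =
      (1 : ℝ) • mfderiv 𝓘(ℝ, E) 𝓘(ℝ, E) e (γ t) (v (γ t))
    rw [map_smul]
  have h4 : HasFDerivAt (fun r => e (γ r))
      ((1 : ℝ →L[ℝ] ℝ).smulRight (chartField e v (e (γ t)) : E)) t := h3.hasFDerivAt
  simpa using h4.hasDerivAt

variable [FiniteDimensional ℝ E]

/-- In a chart the field is multiplied by a bump function so that it extends to a compactly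
supported field on `E`. For small times the curves stay in the ball where the bump equals `1`, and
there they are integral curves of `v` itself. -/
theorem exists_smooth_local_flow_manifold {v : ∀ x : M, TangentSpace 𝓘(ℝ, E) x}
    (hv : ContMDiff 𝓘(ℝ, E) 𝓘(ℝ, E).tangent ∞ fun x => (⟨x, v x⟩ : TangentBundle 𝓘(ℝ, E) M))
    (x₀ : M) : ∃ ε > 0, ∃ U : Set M, IsOpen U ∧ x₀ ∈ U ∧ ∃ β : M → ℝ → M,
      (∀ x ∈ U, β x 0 = x ∧ IsMIntegralCurveOn (β x) v (Ioo (-ε) ε)) ∧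
      ContMDiffOn (𝓘(ℝ, ℝ).prod 𝓘(ℝ, E)) 𝓘(ℝ, E) ∞ (fun p : ℝ × M => β p.2 p.1)
        (Ioo (-ε) ε ×ˢ U) := by
  have : CompleteSpace E := FiniteDimensional.complete ℝ E
  let e := chartAt E x₀
  have he : e ∈ IsManifold.maximalAtlas 𝓘(ℝ, E) ∞ M := IsManifold.chart_mem_maximalAtlas x₀
  have hx₀ : x₀ ∈ e.source := mem_chart_source E x₀
  obtain ⟨R, hR, hRt⟩ := Metric.isOpen_iff.mp e.open_target (e x₀) (e.map_source hx₀)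
  -- The bump is `1` on the ball of radius `R / 4`; its support, of radius `R / 2`, lies inside the
  -- chart target.
  let b : ContDiffBump (e x₀) := ⟨R / 4, R / 2, by positivity, by linarith⟩
  have hbt : tsupport b ⊆ e.target := by
    rw [b.tsupport_eq]
    exact (Metric.closedBall_subset_ball (by simp only [b]; linarith)).trans hRt
  let X : E → E := fun z => b z • chartField e v z
  have hX : ContDiff ℝ ∞ X := by
    rw [contDiff_iff_contDiffAt]
    intro z
    by_cases hz : z ∈ tsupport b
    · exact b.contDiff.contDiffAt.smul
        ((contDiffOn_chartField he hv).contDiffAt (e.open_target.mem_nhds (hbt hz)))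
    · have : X =ᶠ[𝓝 z] fun _ => 0 := by
        filter_upwards [notMem_tsupport_iff_eventuallyEq.mp hz] with w hw
        simp [X, hw]
      exact contDiffAt_const.congr_of_eventuallyEq this
  have hXc : HasCompactSupport X := b.hasCompactSupport.smul_right
  obtain ⟨ε, hε, δ, hδ, α, hα, hαs⟩ := exists_smooth_local_flow hX hXc (e x₀)
  have hc : ContinuousAt (fun p : ℝ × E => α p.2 p.1) (0, e x₀) :=
    hαs.continuousOn.continuousAt ((isOpen_Ioo.prod Metric.isOpen_ball).mem_nhds
      ⟨⟨by linarith, hε⟩, Metric.mem_ball_self hδ⟩)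
  have hc0 : (fun p : ℝ × E => α p.2 p.1) (0, e x₀) ∈ Metric.ball (e x₀) (R / 4) := by
    simp only [(hα _ (Metric.mem_ball_self hδ)).1]
    exact Metric.mem_ball_self (by positivity)
  obtain ⟨r, hr, hrα⟩ := Metric.eventually_nhds_iff.mp
    (hc.eventually (Metric.isOpen_ball.mem_nhds hc0))
  let ε' := min ε r
  let δ' := min δ r
  have hα' : ∀ x ∈ Metric.ball (e x₀) δ', ∀ t ∈ Ioo (-ε') ε',
      α x t ∈ Metric.ball (e x₀) (R / 4) := by
    intro x hx t ht
    refine hrα (y := (t, x)) ?_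
    rw [Prod.dist_eq, max_lt_iff]
    refine ⟨?_, (Metric.mem_ball.mp hx).trans_le (min_le_right _ _)⟩
    rw [Real.dist_eq, sub_zero]
    exact (abs_lt.mpr ht).trans_le (min_le_right _ _)
  have htgt : Metric.ball (e x₀) (R / 4) ⊆ e.target :=
    (Metric.ball_subset_ball (by linarith)).trans hRt
  refine ⟨ε', lt_min hε hr, e.source ∩ e ⁻¹' Metric.ball (e x₀) δ',
    e.isOpen_inter_preimage Metric.isOpen_ball,
    ⟨hx₀, Metric.mem_ball_self (lt_min hδ hr)⟩, fun x t => e.symm (α (e x) t), ?_, ?_⟩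
  · rintro x ⟨hx, hxb⟩
    have hxδ : e x ∈ Metric.ball (e x₀) δ := Metric.ball_subset_ball (min_le_left _ _) hxb
    refine ⟨by simp only [(hα _ hxδ).1, e.left_inv hx], ?_⟩
    refine isMIntegralCurveOn_chart_symm_comp he (fun t ht => htgt (hα' _ hxb t ht)) fun t ht => ?_
    have hd := (hα _ hxδ).2 t (Ioo_subset_Ioo (neg_le_neg (min_le_left _ _)) (min_le_left _ _) ht)
    have : X (α (e x) t) = chartField e v (α (e x) t) := by
      simp only [X]
      rw [b.one_of_mem_closedBall (Metric.ball_subset_closedBall (hα' _ hxb t ht)), one_smul]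
    rwa [this] at hd
  · have h1 : ContMDiffOn (𝓘(ℝ, ℝ).prod 𝓘(ℝ, E)) 𝓘(ℝ, ℝ × E) ∞
        (fun p : ℝ × M => (p.1, e p.2))
        (Ioo (-ε') ε' ×ˢ (e.source ∩ e ⁻¹' Metric.ball (e x₀) δ')) :=
      contMDiffOn_fst.prodMk_space ((contMDiffOn_of_mem_maximalAtlas he).comp contMDiffOn_snd
        fun p hp => hp.2.1)
    have h2 : ContMDiffOn (𝓘(ℝ, ℝ).prod 𝓘(ℝ, E)) 𝓘(ℝ, E) ∞
        (fun p : ℝ × M => α (e p.2) p.1)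
        (Ioo (-ε') ε' ×ˢ (e.source ∩ e ⁻¹' Metric.ball (e x₀) δ')) :=
      hαs.contMDiffOn.comp h1 fun p hp => ⟨Ioo_subset_Ioo (neg_le_neg (min_le_left _ _))
        (min_le_left _ _) hp.1, Metric.ball_subset_ball (min_le_left _ _) hp.2.2⟩
    exact (contMDiffOn_symm_of_mem_maximalAtlas he).comp h2
      fun p hp => htgt (hα' _ hp.2.2 _ hp.1)

variable [T2Space M] [CompactSpace M]

/-- The flow of a smooth vector field on a compact manifold, for small times. -/
theorem exists_smooth_flow {v : ∀ x : M, TangentSpace 𝓘(ℝ, E) x}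
    (hv : ContMDiff 𝓘(ℝ, E) 𝓘(ℝ, E).tangent ∞ fun x => (⟨x, v x⟩ : TangentBundle 𝓘(ℝ, E) M)) :
    ∃ ε > 0, ∃ ψ : ℝ → Diffeomorph 𝓘(ℝ, E) 𝓘(ℝ, E) M M ∞,
      ContMDiffOn (𝓘(ℝ, ℝ).prod 𝓘(ℝ, E)) 𝓘(ℝ, E) ∞ (fun p : ℝ × M => ψ p.1 p.2)
        (Ioo (-ε) ε ×ˢ univ) ∧
      (∀ x, ψ 0 x = x) ∧ ∀ x, IsMIntegralCurveOn (fun t => ψ t x) v (Ioo (-ε) ε) := by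
  have : IsManifold 𝓘(ℝ, E) 1 M := IsManifold.of_le (n := ∞) (by simp)
  have : CompleteSpace E := FiniteDimensional.complete ℝ E
  choose ε hε U hUo hxU β hβ hβs using exists_smooth_local_flow_manifold hv
  obtain ⟨T, hT⟩ := isCompact_univ.elim_finite_subcover U hUo
    fun x _ => mem_iUnion.mpr ⟨x, hxU x⟩
  -- A common existence time for the finite subcover; the value `1` covers the empty manifold.
  obtain ⟨ε₀, hε₀, hεT⟩ : ∃ ε₀ > 0, ∀ i ∈ T, ε₀ ≤ ε i := by
    rcases T.eq_empty_or_nonempty with h | h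
    · exact ⟨1, one_pos, by simp [h]⟩
    · obtain ⟨i, _, hi⟩ := T.exists_min_image ε h
      exact ⟨ε i, hε i, hi⟩
  have hcov : ∀ x, ∃ i ∈ T, x ∈ U i := fun x => by
    simpa using hT (mem_univ x)
  choose c hcT hcU using hcov
  let Ψ : ℝ → M → M := fun t x => β (c x) x t
  have hv1 : ContMDiff 𝓘(ℝ, E) 𝓘(ℝ, E).tangent 1 fun x => (⟨x, v x⟩ : TangentBundle 𝓘(ℝ, E) M) :=
    hv.of_le (by simp)
  have hint : ∀ i ∈ T, ∀ x ∈ U i, IsMIntegralCurveOn (β i x) v (Ioo (-ε₀) ε₀) := fun i hi x hx =>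
    ((hβ i x hx).2).mono (Ioo_subset_Ioo (neg_le_neg (hεT i hi)) (hεT i hi))
  have hΨ0 : ∀ x, Ψ 0 x = x := fun x => (hβ (c x) x (hcU x)).1
  have hΨint : ∀ x, IsMIntegralCurveOn (fun t => Ψ t x) v (Ioo (-ε₀) ε₀) := fun x =>
    hint _ (hcT x) x (hcU x)
  -- `Ψ` is defined through an arbitrary choice of index at each point. Uniqueness of integral
  -- curves makes it agree with every local flow, which gives its smoothness.
  have hΨeq : ∀ i ∈ T, ∀ x ∈ U i, ∀ t ∈ Ioo (-ε₀) ε₀, Ψ t x = β i x t := by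
    intro i hi x hx t ht
    exact isMIntegralCurveOn_Ioo_eqOn_of_contMDiff_boundaryless (t₀ := 0) ⟨by linarith, hε₀⟩ hv1
      (hΨint x) (hint i hi x hx) (by rw [hΨ0, (hβ i x hx).1]) ht
  have hΨs : ContMDiffOn (𝓘(ℝ, ℝ).prod 𝓘(ℝ, E)) 𝓘(ℝ, E) ∞ (fun p : ℝ × M => Ψ p.1 p.2)
      (Ioo (-ε₀) ε₀ ×ˢ univ) := by
    rintro ⟨t, x⟩ ⟨ht, _⟩
    have hmem : Ioo (-ε₀) ε₀ ×ˢ U (c x) ∈ 𝓝 (t, x) :=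
      (isOpen_Ioo.prod (hUo _)).mem_nhds ⟨ht, hcU x⟩
    refine ContMDiffAt.contMDiffWithinAt ?_
    have h1 : ContMDiffAt (𝓘(ℝ, ℝ).prod 𝓘(ℝ, E)) 𝓘(ℝ, E) ∞
        (fun p : ℝ × M => β (c x) p.2 p.1) (t, x) :=
      ((hβs (c x)).mono (prod_mono (Ioo_subset_Ioo (neg_le_neg (hεT _ (hcT x))) (hεT _ (hcT x)))
        Subset.rfl)).contMDiffAt hmem
    refine h1.congr_of_eventuallyEq ?_
    filter_upwards [hmem] with p hp
    exact hΨeq _ (hcT x) _ hp.2 _ hp.1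
  have hgroup : ∀ t ∈ Ioo (-ε₀) ε₀, ∀ x, Ψ (-t) (Ψ t x) = x := by
    intro t ht x
    -- `(a, b)` is the set of `s` with both `s` and `s + t` in `(-ε₀, ε₀)`. It contains `0`, where
    -- the curves `Ψ_s(Ψ_t x)` and `Ψ_{s+t} x` agree, and `-t`, where their equality gives the
    -- inverse.
    let a := max (-ε₀) (-ε₀ - t)
    let b := min ε₀ (ε₀ - t)
    have hab : ∀ s, s ∈ Ioo a b → s ∈ Ioo (-ε₀) ε₀ ∧ s + t ∈ Ioo (-ε₀) ε₀ := by
      intro s hs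
      have h1 := (le_max_left (-ε₀) (-ε₀ - t)).trans_lt hs.1
      have h2 := (le_max_right (-ε₀) (-ε₀ - t)).trans_lt hs.1
      have h3 := hs.2.trans_le (min_le_left ε₀ (ε₀ - t))
      have h4 := hs.2.trans_le (min_le_right ε₀ (ε₀ - t))
      exact ⟨⟨h1, h3⟩, by linarith, by linarith⟩
    have h0 : (0 : ℝ) ∈ Ioo a b :=
      ⟨max_lt (by linarith) (by linarith [ht.1]), lt_min hε₀ (by linarith [ht.2])⟩
    have ht' : -t ∈ Ioo a b :=
      ⟨max_lt (by linarith [ht.2]) (by linarith), lt_min (by linarith [ht.1]) (by linarith)⟩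
    have h1 : IsMIntegralCurveOn (fun s => Ψ s (Ψ t x)) v (Ioo a b) :=
      (hΨint _).mono fun s hs => (hab s hs).1
    have h2 : IsMIntegralCurveOn (fun s => Ψ (s + t) x) v (Ioo a b) := by
      have := (hΨint x).comp_add t
      exact this.mono fun s hs => (hab s hs).2
    have := isMIntegralCurveOn_Ioo_eqOn_of_contMDiff_boundaryless h0 hv1 h1 h2
      (by simp [hΨ0]) ht'
    simpa [hΨ0] using this
  have hslice : ∀ t ∈ Ioo (-ε₀) ε₀, ContMDiff 𝓘(ℝ, E) 𝓘(ℝ, E) ∞ (Ψ t) := by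
    intro t ht x
    have h1 : ContMDiffAt (𝓘(ℝ, ℝ).prod 𝓘(ℝ, E)) 𝓘(ℝ, E) ∞ (fun p : ℝ × M => Ψ p.1 p.2) (t, x) :=
      hΨs.contMDiffAt ((isOpen_Ioo.prod isOpen_univ).mem_nhds ⟨ht, mem_univ _⟩)
    exact h1.comp x (contMDiffAt_const.prodMk contMDiffAt_id)
  have hneg : ∀ t ∈ Ioo (-ε₀) ε₀, -t ∈ Ioo (-ε₀) ε₀ := fun t ht =>
    ⟨by linarith [ht.2], by linarith [ht.1]⟩
  classical
  -- The identity outside the interval is a default value.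
  let ψ : ℝ → Diffeomorph 𝓘(ℝ, E) 𝓘(ℝ, E) M M ∞ := fun t =>
    if ht : t ∈ Ioo (-ε₀) ε₀ then
      { toFun := Ψ t
        invFun := Ψ (-t)
        left_inv := hgroup t ht
        right_inv := fun x => by
          have := hgroup (-t) (hneg t ht) x
          rwa [neg_neg] at this
        contMDiff_toFun := hslice t ht
        contMDiff_invFun := hslice (-t) (hneg t ht) }
    else Diffeomorph.refl _ _ _
  have hψ : ∀ t ∈ Ioo (-ε₀) ε₀, ∀ x, ψ t x = Ψ t x := by
    intro t ht x
    simp only [ψ, dif_pos ht]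
    rfl
  refine ⟨ε₀, hε₀, ψ, hΨs.congr fun p hp => hψ _ hp.1 _, fun x => ?_, fun x t ht => ?_⟩
  · rw [hψ 0 ⟨by linarith, hε₀⟩, hΨ0]
  · have h1 : HasMFDerivWithinAt 𝓘(ℝ, ℝ) 𝓘(ℝ, E) (fun t => Ψ t x) (Ioo (-ε₀) ε₀) t
        ((1 : ℝ →L[ℝ] ℝ).smulRight (v (Ψ t x))) := hΨint x t ht
    rw [← hψ t ht x] at h1
    exact h1.congr_of_eventuallyEq (eventuallyEq_of_mem self_mem_nhdsWithin
      fun s hs => hψ s hs x) (hψ t ht x)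

end ManifoldFlow

/-! ## Components of tensor fields in charts -/

section Components

open Set Filter Topology Bundle

variable {n : ℕ} {M : Type*} [TopologicalSpace M] [ChartedSpace (EuclideanSpace ℝ (Fin n)) M]
  [IsManifold (𝓡 n) ∞ M]

section Apply

variable {E' H' P : Type*} [NormedAddCommGroup E'] [NormedSpace ℝ E'] [TopologicalSpace H']
  {J : ModelWithCorners ℝ E' H'} [TopologicalSpace P] [ChartedSpace H' P]

theorem contMDiffAt_inner_apply (g : Metric (n := n) M) {p₀ : P} {b : P → M}
    {w w' : ∀ p, TangentSpace (𝓡 n) (b p)}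
    (hw : ContMDiffAt J (𝓡 n).tangent ∞ (fun p => (⟨b p, w p⟩ : TangentBundle (𝓡 n) M)) p₀)
    (hw' : ContMDiffAt J (𝓡 n).tangent ∞ (fun p => (⟨b p, w' p⟩ : TangentBundle (𝓡 n) M)) p₀) :
    ContMDiffAt J 𝓘(ℝ, ℝ) ∞ (fun p => g.inner (b p) (w p) (w' p)) p₀ := by
  have hb : ContMDiffAt J (𝓡 n) ∞ b p₀ := by
    simp only [contMDiffAt_totalSpace] at hw
    exact hw.1
  have : ContMDiffAt J ((𝓡 n).prod 𝓘(ℝ, ℝ)) ∞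
      (fun m ↦ TotalSpace.mk' ℝ (E := Bundle.Trivial M ℝ) (b m) (g.inner (b m) (w m) (w' m))) p₀ := by
    apply ContMDiffAt.clm_bundle_apply₂ (F₁ := EuclideanSpace ℝ (Fin n))
      (F₂ := EuclideanSpace ℝ (Fin n))
    · exact ContMDiffAt.comp p₀ g.contMDiff.contMDiffAt hb
    · exact hw
    · exact hw'
  simp only [contMDiffAt_totalSpace] at this
  exact this.2

theorem contMDiffAt_form_apply (φ : OneForm (n := n) M) {p₀ : P} {b : P → M}
    {w : ∀ p, TangentSpace (𝓡 n) (b p)}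
    (hw : ContMDiffAt J (𝓡 n).tangent ∞ (fun p => (⟨b p, w p⟩ : TangentBundle (𝓡 n) M)) p₀) :
    ContMDiffAt J 𝓘(ℝ, ℝ) ∞ (fun p => (φ (b p) (w p) : ℝ)) p₀ := by
  have hb : ContMDiffAt J (𝓡 n) ∞ b p₀ := by
    simp only [contMDiffAt_totalSpace] at hw
    exact hw.1
  have : ContMDiffAt J ((𝓡 n).prod 𝓘(ℝ, ℝ)) ∞
      (fun m ↦ TotalSpace.mk' ℝ (E := Bundle.Trivial M ℝ) (b m) (φ (b m) (w m))) p₀ := by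
    apply ContMDiffAt.clm_bundle_apply (F₁ := EuclideanSpace ℝ (Fin n))
    · exact ContMDiffAt.comp p₀ φ.contMDiff.contMDiffAt hb
    · exact hw
  simp only [contMDiffAt_totalSpace] at this
  exact this.2

end Apply

variable {e : OpenPartialHomeomorph M (EuclideanSpace ℝ (Fin n))}
  (he : e ∈ IsManifold.maximalAtlas (𝓡 n) ∞ M)

include he

theorem contMDiffAt_frame {z : EuclideanSpace ℝ (Fin n)} (hz : z ∈ e.target) (i : Fin n) :
    ContMDiffAt (𝓡 n) (𝓡 n).tangent ∞
      (fun z => (⟨e.symm z, frame e z i⟩ : TangentBundle (𝓡 n) M)) z := by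
  refine contMDiffAt_mfderiv_section e.open_target (contMDiffOn_symm_of_mem_maximalAtlas he)
    (b := fun z => z) (w := fun _ => (EuclideanSpace.single i (1 : ℝ) : EuclideanSpace ℝ (Fin n)))
    ?_ hz
  exact contMDiffAt_vectorSpace_iff_contDiffAt.mpr contDiffAt_const

omit [IsManifold (𝓡 n) ∞ M] he in
theorem mfderiv_symm_eq_sum (z a : EuclideanSpace ℝ (Fin n)) :
    mfderiv (𝓡 n) (𝓡 n) e.symm z a = ∑ i, a i • frame e z i := by
  have ha : a = ∑ i, a i • EuclideanSpace.single i (1 : ℝ) := by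
    ext j; simp [Finset.sum_apply, Pi.single_apply]
  let A : EuclideanSpace ℝ (Fin n) →L[ℝ] EuclideanSpace ℝ (Fin n) :=
    mfderiv (𝓡 n) (𝓡 n) e.symm z
  change A a = ∑ i, a i • A (EuclideanSpace.single i 1)
  conv_lhs => rw [ha]
  simp

omit he in
theorem metricComp_quadratic (g : Metric (n := n) M) (z a b : EuclideanSpace ℝ (Fin n)) :
    g.inner (e.symm z) (mfderiv (𝓡 n) (𝓡 n) e.symm z a) (mfderiv (𝓡 n) (𝓡 n) e.symm z b) =
      ∑ i, ∑ j, a i * b j * metricComp e g z i j := by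
  rw [mfderiv_symm_eq_sum, mfderiv_symm_eq_sum]
  let B : EuclideanSpace ℝ (Fin n) →L[ℝ] EuclideanSpace ℝ (Fin n) →L[ℝ] ℝ := g.inner (e.symm z)
  let w : Fin n → EuclideanSpace ℝ (Fin n) := fun i => frame e z i
  change B (∑ i, a i • w i) (∑ i, b i • w i) = ∑ i, ∑ j, a i * b j * B (w i) (w j)
  rw [map_sum, Finset.sum_comm]
  refine Finset.sum_congr rfl fun j _ => ?_
  rw [map_sum, sum_apply]
  refine Finset.sum_congr rfl fun i _ => ?_
  rw [map_smul, map_smul, smul_apply, smul_eq_mul, smul_eq_mul]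
  ring

theorem metricComp_posDef (g : Metric (n := n) M) {z : EuclideanSpace ℝ (Fin n)}
    (hz : z ∈ e.target) : (metricComp e g z).PosDef := by
  refine Matrix.PosDef.of_dotProduct_mulVec_pos ?_ fun x hx => ?_
  · ext i j
    simpa [metricComp] using g.symm (e.symm z) (frame e z j) (frame e z i)
  · have h := metricComp_quadratic (e := e) g z (WithLp.toLp 2 x) (WithLp.toLp 2 x)
    have hinj := (mdifferentiable_of_mem_maximalAtlas he).symm.mfderiv_injective (x := z) hz
    have hne : mfderiv (𝓡 n) (𝓡 n) e.symm z (WithLp.toLp 2 x) ≠ 0 := by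
      intro h0
      apply hx
      have := hinj (h0.trans (map_zero _).symm)
      exact congrArg (WithLp.ofLp (p := 2)) this
    have hpos := g.pos (e.symm z) _ hne
    rw [h] at hpos
    refine hpos.trans_eq ?_
    simp only [dotProduct, Matrix.mulVec, Finset.mul_sum]
    refine Finset.sum_congr rfl fun i _ => Finset.sum_congr rfl fun j _ => ?_
    rw [Pi.star_apply, star_trivial]; ring

theorem isLocalMetric_metricComp (g : Metric (n := n) M) :
    IsLocalMetric (metricComp e g) e.target where
  isOpen := e.open_target
  smooth i j z hz := (contMDiffAt_iff_contDiffAt.mp (contMDiffAt_inner_apply g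
    (contMDiffAt_frame he hz i) (contMDiffAt_frame he hz j))).contDiffWithinAt
  symm z _ := by
    ext i j
    exact g.symm (e.symm z) (frame e z j) (frame e z i)
  det_ne_zero z hz := (metricComp_posDef he g hz).det_pos.ne'

theorem contDiffOn_formComp (φ : OneForm (n := n) M) (i : Fin n) :
    ContDiffOn ℝ ∞ (fun z => formComp e φ z i) e.target := fun _ hz =>
  (contMDiffAt_iff_contDiffAt.mp
    (contMDiffAt_form_apply φ (contMDiffAt_frame he hz i))).contDiffWithinAt

/-- The components `φ^k = g^{kl} φ_l` of the dual vector field. -/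
theorem chartField_sharp (g : Metric (n := n) M) (φ : OneForm (n := n) M)
    {z : EuclideanSpace ℝ (Fin n)} (hz : z ∈ e.target) (k : Fin n) :
    chartField e (sharp g φ) z k = ∑ l, ginv (metricComp e g) z k l * formComp e φ z l := by
  have h : ∀ l, ∑ m, metricComp e g z l m * chartField e (sharp g φ) z m = formComp e φ z l := by
    intro l
    have h1 := inner_sharp g φ (e.symm z) (frame e z l)
    rw [← mfderiv_symm_chartField he (sharp g φ) hz] at h1
    have h2 := metricComp_quadratic (e := e) g z (chartField e (sharp g φ) z)
      (EuclideanSpace.single l 1)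
    have h3 : formComp e φ z l = ∑ i, ∑ j, chartField e (sharp g φ) z i *
        (EuclideanSpace.single l (1 : ℝ) : EuclideanSpace ℝ (Fin n)) j * metricComp e g z i j := by
      rw [← h2]; exact h1.symm
    rw [h3]
    refine Finset.sum_congr rfl fun m _ => ?_
    rw [(isLocalMetric_metricComp he g).apply_symm hz l m]
    simp [mul_comm]
  have h' : (metricComp e g z).mulVec
      (WithLp.ofLp (chartField e (sharp g φ) z : EuclideanSpace ℝ (Fin n))) = formComp e φ z := funext h
  have := congrArg ((ginv (metricComp e g) z).mulVec) h'
  rw [Matrix.mulVec_mulVec, (isLocalMetric_metricComp he g).ginv_mul hz, Matrix.one_mulVec] at this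
  exact congrFun this k

omit he in
-- `sharp` is a pointwise inverse, so smoothness is read off the formula `g^{kl} φ_l` in a chart and
-- carried back by the inverse chart.
theorem contMDiff_sharp (g : Metric (n := n) M) (φ : OneForm (n := n) M) :
    ContMDiff (𝓡 n) (𝓡 n).tangent ∞ fun x => (⟨x, sharp g φ x⟩ : TangentBundle (𝓡 n) M) := by
  intro x₀
  let e := chartAt (EuclideanSpace ℝ (Fin n)) x₀
  have he : e ∈ IsManifold.maximalAtlas (𝓡 n) ∞ M := IsManifold.chart_mem_maximalAtlas x₀
  have hx₀ : x₀ ∈ e.source := mem_chart_source _ x₀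
  have hG := isLocalMetric_metricComp he g
  have hV : ContDiffOn ℝ ∞ (chartField e (sharp g φ)) e.target := by
    rw [contDiffOn_euclidean]
    intro k
    refine ContDiffOn.congr (f := fun z => ∑ l, ginv (metricComp e g) z k l * formComp e φ z l) ?_
      fun z hz => chartField_sharp he g φ hz k
    exact ContDiffOn.sum fun l _ => (hG.contDiffOn_ginv k l).mul (contDiffOn_formComp he φ l)
  have h1 : ContMDiffAt (𝓡 n) (𝓡 n).tangent ∞
      (fun z => (⟨z, (chartField e (sharp g φ) z : EuclideanSpace ℝ (Fin n))⟩ :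
        TangentBundle (𝓡 n) (EuclideanSpace ℝ (Fin n))))
      (e x₀) :=
    contMDiffAt_vectorSpace_iff_contDiffAt.mpr
      (hV.contDiffAt (e.open_target.mem_nhds (e.map_source hx₀)))
  have h2 := contMDiffAt_mfderiv_section e.open_target (contMDiffOn_symm_of_mem_maximalAtlas he)
    h1 (e.map_source hx₀)
  have h3 := h2.comp x₀ ((contMDiffOn_of_mem_maximalAtlas he).contMDiffAt
    (e.open_source.mem_nhds hx₀))
  refine h3.congr_of_eventuallyEq ?_
  filter_upwards [e.open_source.mem_nhds hx₀] with x hx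
  simp only [Function.comp_apply]
  rw [mfderiv_symm_chartField he (sharp g φ) (e.map_source hx), e.left_inv hx]

end Components

/-! ## Pullback of a metric -/

section Pullback

open Set Filter Topology Bundle

variable {n : ℕ} {M : Type*} [TopologicalSpace M] [ChartedSpace (EuclideanSpace ℝ (Fin n)) M]

/-- A map into the bilinear forms on `ℝⁿ` is smooth if its matrix entries are. -/
theorem contMDiffAt_bilinear_of_apply {E' H' P : Type*} [NormedAddCommGroup E'] [NormedSpace ℝ E']
    [TopologicalSpace H'] {J : ModelWithCorners ℝ E' H'} [TopologicalSpace P] [ChartedSpace H' P]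
    {A : P → EuclideanSpace ℝ (Fin n) →L[ℝ] EuclideanSpace ℝ (Fin n) →L[ℝ] ℝ} {p₀ : P}
    (hA : ∀ u v, ContMDiffAt J 𝓘(ℝ, ℝ) ∞ (fun p => A p u v) p₀) :
    ContMDiffAt J 𝓘(ℝ, EuclideanSpace ℝ (Fin n) →L[ℝ] EuclideanSpace ℝ (Fin n) →L[ℝ] ℝ) ∞ A p₀ := by
  let b : Fin n → EuclideanSpace ℝ (Fin n) := fun i => EuclideanSpace.single i 1
  let q : Fin n → EuclideanSpace ℝ (Fin n) →L[ℝ] ℝ := fun i => EuclideanSpace.proj i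
  have hexp : A = fun p => ∑ i, ∑ j, A p (b i) (b j) •
      (q i).smulRight (q j) := by
    funext p
    ext u v
    have hu : ∀ a : EuclideanSpace ℝ (Fin n), a = ∑ i, a i • b i := by
      intro a; ext j; simp [b, Finset.sum_apply, Pi.single_apply]
    conv_lhs => rw [hu u, hu v]
    simp only [map_sum, map_smul, sum_apply, smul_apply, smul_eq_mul, Finset.mul_sum,
      ContinuousLinearMap.smulRight_apply, q]
    rw [Finset.sum_comm]
    refine Finset.sum_congr rfl fun i _ => Finset.sum_congr rfl fun j _ => ?_
    change v j * (u i * A p (b i) (b j)) = A p (b i) (b j) * (u i * v j)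
    ring
  rw [hexp]
  refine ContMDiffAt.sum fun i _ => ContMDiffAt.sum fun j _ => ?_
  exact (hA (b i) (b j)).smul contMDiffAt_const

variable [IsManifold (𝓡 n) ∞ M]

/-- A field of bilinear forms is smooth if it maps pairs of smooth vector fields to smooth
functions. -/
theorem contMDiff_bilinear_of_apply
    {G : ∀ x : M, TangentSpace (𝓡 n) x →L[ℝ] TangentSpace (𝓡 n) x →L[ℝ] ℝ}
    (hG : ∀ (x₀ : M) (w w' : ∀ x : M, TangentSpace (𝓡 n) x),
      ContMDiffAt (𝓡 n) (𝓡 n).tangent ∞ (fun x => (⟨x, w x⟩ : TangentBundle (𝓡 n) M)) x₀ →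
      ContMDiffAt (𝓡 n) (𝓡 n).tangent ∞ (fun x => (⟨x, w' x⟩ : TangentBundle (𝓡 n) M)) x₀ →
      ContMDiffAt (𝓡 n) 𝓘(ℝ, ℝ) ∞ (fun x => G x (w x) (w' x)) x₀) :
    ContMDiff (𝓡 n) ((𝓡 n).prod
      𝓘(ℝ, EuclideanSpace ℝ (Fin n) →L[ℝ] EuclideanSpace ℝ (Fin n) →L[ℝ] ℝ)) ∞
      (fun x => TotalSpace.mk' (EuclideanSpace ℝ (Fin n) →L[ℝ] EuclideanSpace ℝ (Fin n) →L[ℝ] ℝ)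
        (E := fun x : M => TangentSpace (𝓡 n) x →L[ℝ] TangentSpace (𝓡 n) x →L[ℝ] ℝ) x (G x)) := by
  intro x₀
  rw [contMDiffAt_hom_bundle]
  refine ⟨contMDiffAt_id, contMDiffAt_bilinear_of_apply fun u v => ?_⟩
  -- Constant vectors in a local trivialization are smooth local vector fields, and the coordinate
  -- entries of `G` are its values on them.
  let T := trivializationAt (EuclideanSpace ℝ (Fin n)) (TangentSpace (𝓡 n) : M → Type _) x₀
  have hT : x₀ ∈ T.baseSet := FiberBundle.mem_baseSet_trivializationAt' x₀
  have hs : ∀ u : EuclideanSpace ℝ (Fin n), ContMDiffAt (𝓡 n) (𝓡 n).tangent ∞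
      (fun x => (⟨x, T.symm x u⟩ : TangentBundle (𝓡 n) M)) x₀ := by
    intro u
    have h1 := (T.contMDiffOn_symm (n := ∞) (IB := 𝓡 n)).contMDiffAt (x := (x₀, u))
      (T.open_target.mem_nhds (T.mem_target.mpr hT))
    have h2 : ContMDiffAt (𝓡 n) ((𝓡 n).prod (𝓡 n)) ∞ (fun x : M => (x, u)) x₀ :=
      contMDiffAt_id.prodMk contMDiffAt_const
    refine (h1.comp x₀ h2).congr_of_eventuallyEq ?_
    filter_upwards [T.open_baseSet.mem_nhds hT] with x hx
    exact T.mk_symm hx u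
  refine (hG x₀ _ _ (hs u) (hs v)).congr_of_eventuallyEq ?_
  filter_upwards [T.open_baseSet.mem_nhds hT] with x hx
  rw [inCoordinates_apply_eq₂ hx hx (Set.mem_univ _)]
  simp [T]

/-- The pullback `ψ^* g` of a metric at the point `x`, as a bilinear form. -/
def pullbackInner (ψ : Diffeomorph (𝓡 n) (𝓡 n) M M ∞) (g : Metric (n := n) M) (x : M) :
    TangentSpace (𝓡 n) x →L[ℝ] TangentSpace (𝓡 n) x →L[ℝ] ℝ :=
  let A : EuclideanSpace ℝ (Fin n) →L[ℝ] EuclideanSpace ℝ (Fin n) →L[ℝ] ℝ := g.inner (ψ x)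
  let D : EuclideanSpace ℝ (Fin n) →L[ℝ] EuclideanSpace ℝ (Fin n) := mfderiv (𝓡 n) (𝓡 n) ψ x
  A.bilinearComp D D

/-- The pullback `ψ^* g` of a metric. -/
def pullbackMetric (ψ : Diffeomorph (𝓡 n) (𝓡 n) M M ∞) (g : Metric (n := n) M) :
    Metric (n := n) M where
  inner := pullbackInner ψ g
  symm x v w := g.symm (ψ x) _ _
  pos x v hv := by
    refine g.pos (ψ x) _ fun h => hv ?_
    exact (ψ.mfderivToContinuousLinearEquiv (by simp) x).map_eq_zero_iff.mp h
  isVonNBounded x := by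
    -- The unit ball of the pullback is the image of the unit ball of `g` under the inverse of the
    -- differential of `ψ`.
    let D := ψ.mfderivToContinuousLinearEquiv (by simp) x
    refine ((g.isVonNBounded (ψ x)).image (D.symm : _ →L[ℝ] _)).subset fun v hv => ?_
    exact ⟨D v, hv, D.symm_apply_apply v⟩
  contMDiff := by
    refine contMDiff_bilinear_of_apply fun x₀ w w' hw hw' => ?_
    have h : ∀ w : ∀ x : M, TangentSpace (𝓡 n) x,
        ContMDiffAt (𝓡 n) (𝓡 n).tangent ∞ (fun x => (⟨x, w x⟩ : TangentBundle (𝓡 n) M)) x₀ →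
        ContMDiffAt (𝓡 n) (𝓡 n).tangent ∞ (fun x =>
          (⟨ψ x, mfderiv (𝓡 n) (𝓡 n) ψ x (w x)⟩ : TangentBundle (𝓡 n) M)) x₀ := fun w hw =>
      contMDiffAt_mfderiv_section isOpen_univ ψ.contMDiff.contMDiffOn (b := fun x => x) hw
        (mem_univ _)
    exact contMDiffAt_inner_apply g (h w hw) (h w' hw')

theorem isPullback_pullbackMetric (ψ : Diffeomorph (𝓡 n) (𝓡 n) M M ∞) (g : Metric (n := n) M) :
    IsPullback ψ g (pullbackMetric ψ g) := fun _ _ _ => rfl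

end Pullback

/-! ## Transition maps and transported charts -/

section Transport

open Set Filter Topology Bundle

variable {n : ℕ} {M : Type*} [TopologicalSpace M] [ChartedSpace (EuclideanSpace ℝ (Fin n)) M]
  [IsManifold (𝓡 n) ∞ M]
  {e₁ e₂ e₃ : OpenPartialHomeomorph M (EuclideanSpace ℝ (Fin n))}

omit [IsManifold (𝓡 n) ∞ M] in
theorem contDiffAt_transition (h₁ : e₁ ∈ IsManifold.maximalAtlas (𝓡 n) ∞ M)
    (h₂ : e₂ ∈ IsManifold.maximalAtlas (𝓡 n) ∞ M) {z : EuclideanSpace ℝ (Fin n)}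
    (hz : z ∈ e₁.target) (hz₂ : e₁.symm z ∈ e₂.source) :
    ContDiffAt ℝ ∞ (e₂ ∘ e₁.symm) z :=
  contMDiffAt_iff_contDiffAt.mp (((contMDiffOn_of_mem_maximalAtlas h₂).contMDiffAt
    (e₂.open_source.mem_nhds hz₂)).comp z ((contMDiffOn_symm_of_mem_maximalAtlas h₁).contMDiffAt
      (e₁.open_target.mem_nhds hz)))

omit [IsManifold (𝓡 n) ∞ M] in
theorem fderiv_transition_comp (h₁ : e₁ ∈ IsManifold.maximalAtlas (𝓡 n) ∞ M)
    (h₂ : e₂ ∈ IsManifold.maximalAtlas (𝓡 n) ∞ M) (h₃ : e₃ ∈ IsManifold.maximalAtlas (𝓡 n) ∞ M)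
    {z : EuclideanSpace ℝ (Fin n)} (hz : z ∈ e₁.target) (hz₂ : e₁.symm z ∈ e₂.source)
    (hz₃ : e₁.symm z ∈ e₃.source) :
    fderiv ℝ (e₃ ∘ e₁.symm) z =
      (fderiv ℝ (e₃ ∘ e₂.symm) (e₂ (e₁.symm z))).comp (fderiv ℝ (e₂ ∘ e₁.symm) z) := by
  have hd₁ := (contDiffAt_transition h₁ h₂ hz hz₂).differentiableAt (by simp)
  have hd₂ := (contDiffAt_transition h₂ h₃ (e₂.map_source hz₂)
    (by rwa [e₂.left_inv hz₂])).differentiableAt (by simp)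
  refine Eq.trans ?_ (fderiv_comp z hd₂ hd₁)
  refine Filter.EventuallyEq.fderiv_eq ?_
  filter_upwards [e₁.symm.continuousAt hz (e₂.open_source.mem_nhds hz₂)] with w hw
  exact congrArg e₃ (e₂.left_inv hw).symm

omit [IsManifold (𝓡 n) ∞ M] in
theorem det_fderiv_transition_comp (h₁ : e₁ ∈ IsManifold.maximalAtlas (𝓡 n) ∞ M)
    (h₂ : e₂ ∈ IsManifold.maximalAtlas (𝓡 n) ∞ M) (h₃ : e₃ ∈ IsManifold.maximalAtlas (𝓡 n) ∞ M)
    {z : EuclideanSpace ℝ (Fin n)} (hz : z ∈ e₁.target) (hz₂ : e₁.symm z ∈ e₂.source)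
    (hz₃ : e₁.symm z ∈ e₃.source) :
    (fderiv ℝ (e₃ ∘ e₁.symm) z).det =
      (fderiv ℝ (e₃ ∘ e₂.symm) (e₂ (e₁.symm z))).det * (fderiv ℝ (e₂ ∘ e₁.symm) z).det := by
  rw [fderiv_transition_comp h₁ h₂ h₃ hz hz₂ hz₃]
  exact LinearMap.det_comp _ _

omit [ChartedSpace (EuclideanSpace ℝ (Fin n)) M] [IsManifold (𝓡 n) ∞ M] in
theorem fderiv_transition_self {z : EuclideanSpace ℝ (Fin n)} (hz : z ∈ e₁.target) :
    fderiv ℝ (e₁ ∘ e₁.symm) z = ContinuousLinearMap.id ℝ _ := by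
  rw [← fderiv_id]
  refine Filter.EventuallyEq.fderiv_eq ?_
  filter_upwards [e₁.open_target.mem_nhds hz] with w hw
  exact e₁.right_inv hw

omit [IsManifold (𝓡 n) ∞ M] in
theorem det_fderiv_transition_ne_zero (h₁ : e₁ ∈ IsManifold.maximalAtlas (𝓡 n) ∞ M)
    (h₂ : e₂ ∈ IsManifold.maximalAtlas (𝓡 n) ∞ M) {z : EuclideanSpace ℝ (Fin n)}
    (hz : z ∈ e₁.target) (hz₂ : e₁.symm z ∈ e₂.source) :
    (fderiv ℝ (e₂ ∘ e₁.symm) z).det ≠ 0 := by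
  have h := det_fderiv_transition_comp h₁ h₂ h₁ hz hz₂ (e₁.map_target hz)
  rw [fderiv_transition_self hz] at h
  intro h0
  rw [h0, mul_zero] at h
  exact one_ne_zero ((LinearMap.det_id (A := ℝ) (M := EuclideanSpace ℝ (Fin n))).symm.trans h)

/-- The chart `e ∘ ψ⁻¹`. -/
def transportChart (ψ : Diffeomorph (𝓡 n) (𝓡 n) M M ∞)
    (e : OpenPartialHomeomorph M (EuclideanSpace ℝ (Fin n))) :
    OpenPartialHomeomorph M (EuclideanSpace ℝ (Fin n)) :=
  ψ.symm.toHomeomorph.transOpenPartialHomeomorph e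

variable (ψ : Diffeomorph (𝓡 n) (𝓡 n) M M ∞)

omit [IsManifold (𝓡 n) ∞ M] in
theorem transportChart_symm_apply (e : OpenPartialHomeomorph M (EuclideanSpace ℝ (Fin n)))
    (z : EuclideanSpace ℝ (Fin n)) : (transportChart ψ e).symm z = ψ (e.symm z) := rfl

theorem transportChart_mem_maximalAtlas {e : OpenPartialHomeomorph M (EuclideanSpace ℝ (Fin n))}
    (he : e ∈ IsManifold.maximalAtlas (𝓡 n) ∞ M) :
    transportChart ψ e ∈ IsManifold.maximalAtlas (𝓡 n) ∞ M := by
  refine OpenPartialHomeomorph.mem_maximalAtlas_of_contMDiffOn _ ?_ ?_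
  · exact (contMDiffOn_of_mem_maximalAtlas he).comp ψ.symm.contMDiff.contMDiffOn fun _ hx => hx
  · exact ψ.contMDiff.comp_contMDiffOn (contMDiffOn_symm_of_mem_maximalAtlas he)

omit [IsManifold (𝓡 n) ∞ M] in
-- The chain rule. Where `e.symm` is not differentiable both sides are zero, `ψ` being a
-- diffeomorphism; so no restriction on `z` is needed and the component identities below are
-- equalities of functions.
theorem frame_transportChart (e : OpenPartialHomeomorph M (EuclideanSpace ℝ (Fin n)))
    (z : EuclideanSpace ℝ (Fin n)) (i : Fin n) :
    frame (transportChart ψ e) z i = mfderiv (𝓡 n) (𝓡 n) ψ (e.symm z) (frame e z i) := by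
  by_cases h : MDifferentiableAt (𝓡 n) (𝓡 n) e.symm z
  · have hψ : MDifferentiableAt (𝓡 n) (𝓡 n) ψ (e.symm z) := ψ.mdifferentiable (by simp) _
    have := mfderiv_comp z hψ h
    exact congrArg (fun L : EuclideanSpace ℝ (Fin n) →L[ℝ] EuclideanSpace ℝ (Fin n) =>
      L (EuclideanSpace.single i 1)) this
  · have h' : ¬ MDifferentiableAt (𝓡 n) (𝓡 n) (transportChart ψ e).symm z := by
      intro h'
      apply h
      have hψ : MDifferentiableAt (𝓡 n) (𝓡 n) ψ.symm ((transportChart ψ e).symm z) :=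
        ψ.symm.mdifferentiable (by simp) _
      have := hψ.comp z h'
      refine this.congr_of_eventuallyEq (Eventually.of_forall fun w => ?_)
      exact (ψ.symm_apply_apply (e.symm w)).symm
    have h1 := mfderiv_zero_of_not_mdifferentiableAt h
    have h2 := mfderiv_zero_of_not_mdifferentiableAt h'
    have h3 : frame e z i = (0 : EuclideanSpace ℝ (Fin n)) :=
      congrArg (fun L : EuclideanSpace ℝ (Fin n) →L[ℝ] EuclideanSpace ℝ (Fin n) =>
        L (EuclideanSpace.single i 1)) h1
    have h4 : frame (transportChart ψ e) z i = (0 : EuclideanSpace ℝ (Fin n)) :=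
      congrArg (fun L : EuclideanSpace ℝ (Fin n) →L[ℝ] EuclideanSpace ℝ (Fin n) =>
        L (EuclideanSpace.single i 1)) h2
    let D : EuclideanSpace ℝ (Fin n) →L[ℝ] EuclideanSpace ℝ (Fin n) :=
      mfderiv (𝓡 n) (𝓡 n) ψ (e.symm z)
    let a : EuclideanSpace ℝ (Fin n) := frame e z i
    have h5 : D a = 0 := (congrArg D h3).trans (map_zero D)
    exact h4.trans h5.symm

/-- Exchanging a pullback for a change of chart makes every expression in the components natural
under diffeomorphisms, curvature included, with no transformation law to prove. -/
theorem metricComp_pullbackMetric (g : Metric (n := n) M)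
    (e : OpenPartialHomeomorph M (EuclideanSpace ℝ (Fin n))) :
    metricComp e (pullbackMetric ψ g) = metricComp (transportChart ψ e) g := by
  funext z
  ext i j
  change g.inner (ψ (e.symm z)) (mfderiv (𝓡 n) (𝓡 n) ψ (e.symm z) (frame e z i))
    (mfderiv (𝓡 n) (𝓡 n) ψ (e.symm z) (frame e z j)) = g.inner (ψ (e.symm z))
      (frame (transportChart ψ e) z i) (frame (transportChart ψ e) z j)
  rw [frame_transportChart, frame_transportChart]

theorem fluxComp_pullbackMetric {M : Type*} [TopologicalSpace M]
    [ChartedSpace (EuclideanSpace ℝ (Fin 3)) M] [IsManifold (𝓡 3) ∞ M]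
    (ψ : Diffeomorph (𝓡 3) (𝓡 3) M M ∞) (g : Metric (n := 3) M) (f : M → ℝ)
    (e : OpenPartialHomeomorph M (EuclideanSpace ℝ (Fin 3))) :
    fluxComp e (pullbackMetric ψ g) (fun x => f (ψ x)) = fluxComp (transportChart ψ e) g f := by
  funext z i j k
  simp only [fluxComp, metricComp_pullbackMetric, transportChart_symm_apply]

end Transport

/-! ## Families of diffeomorphisms -/

section Family

open Set Filter Topology Bundle

variable {n : ℕ} {M : Type*} [TopologicalSpace M] [ChartedSpace (EuclideanSpace ℝ (Fin n)) M]
  [IsManifold (𝓡 n) ∞ M]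
  {ψ : ℝ → Diffeomorph (𝓡 n) (𝓡 n) M M ∞} {I : Set ℝ} (hI : IsOpen I)
  (hψ : ContMDiffOn (𝓘(ℝ, ℝ).prod (𝓡 n)) (𝓡 n) ∞ (fun p : ℝ × M => ψ p.1 p.2) (I ×ˢ univ))
  {e e' : OpenPartialHomeomorph M (EuclideanSpace ℝ (Fin n))}
  (he : e ∈ IsManifold.maximalAtlas (𝓡 n) ∞ M)

include hI hψ he

omit [IsManifold (𝓡 n) ∞ M] in
theorem contMDiffAt_family_symm {s : ℝ} (hs : s ∈ I) {z : EuclideanSpace ℝ (Fin n)}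
    (hz : z ∈ e.target) :
    ContMDiffAt 𝓘(ℝ, ℝ × EuclideanSpace ℝ (Fin n)) (𝓡 n) ∞
      (fun p : ℝ × EuclideanSpace ℝ (Fin n) => ψ p.1 (e.symm p.2)) (s, z) := by
  have h1 : ContMDiffAt (𝓘(ℝ, ℝ).prod (𝓡 n)) (𝓡 n) ∞ (fun p : ℝ × M => ψ p.1 p.2)
      (s, e.symm z) :=
    hψ.contMDiffAt ((hI.prod isOpen_univ).mem_nhds ⟨hs, mem_univ _⟩)
  rw [modelWithCornersSelf_prod, ← chartedSpaceSelf_prod]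
  have h2 : ContMDiffAt (𝓘(ℝ, ℝ).prod (𝓡 n)) (𝓘(ℝ, ℝ).prod (𝓡 n)) ∞
      (fun p : ℝ × EuclideanSpace ℝ (Fin n) => (p.1, e.symm p.2)) (s, z) :=
    contMDiffAt_fst.prodMk (((contMDiffOn_symm_of_mem_maximalAtlas he).contMDiffAt
      (e.open_target.mem_nhds hz)).comp (s, z) contMDiffAt_snd)
  exact h1.comp (s, z) h2

omit [IsManifold (𝓡 n) ∞ M] in
theorem contDiffAt_family_chart (he' : e' ∈ IsManifold.maximalAtlas (𝓡 n) ∞ M) {s : ℝ}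
    (hs : s ∈ I) {z : EuclideanSpace ℝ (Fin n)} (hz : z ∈ e.target)
    (hz' : ψ s (e.symm z) ∈ e'.source) :
    ContDiffAt ℝ ∞ (fun p : ℝ × EuclideanSpace ℝ (Fin n) => e' (ψ p.1 (e.symm p.2))) (s, z) := by
  rw [← contMDiffAt_iff_contDiffAt]
  exact ((contMDiffOn_of_mem_maximalAtlas he').contMDiffAt
    (e'.open_source.mem_nhds hz')).comp (s, z) (contMDiffAt_family_symm hI hψ he hs hz)

omit [IsManifold (𝓡 n) ∞ M] in
theorem continuousAt_fderiv_family_chart (he' : e' ∈ IsManifold.maximalAtlas (𝓡 n) ∞ M) {s : ℝ}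
    (hs : s ∈ I) {z : EuclideanSpace ℝ (Fin n)} (hz : z ∈ e.target)
    (hz' : ψ s (e.symm z) ∈ e'.source) :
    ContinuousAt (fun r => fderiv ℝ (fun w => e' (ψ r (e.symm w))) z) s :=
  (ContDiffAt.fderiv (f := fun r w => e' (ψ r (e.symm w))) (g := fun _ => z) (m := 0) (n := ∞)
    (contDiffAt_family_chart hI hψ he he' hs hz hz') contDiffAt_const
    (by simp)).continuousAt

omit he in
/-- A smooth family of diffeomorphisms containing the identity preserves orientations. -/
theorem transportChart_mem_charts (hIc : IsPreconnected I) (h0 : (0 : ℝ) ∈ I)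
    (hψ0 : ∀ x, ψ 0 x = x) (o : OrientedAtlas (n := n) M) {t : ℝ} (ht : t ∈ I)
    (he : e ∈ o.charts) : transportChart (ψ t) e ∈ o.charts := by
  have hea := o.smooth he
  refine o.maximal _ (transportChart_mem_maximalAtlas (ψ t) hea) fun e₁ he₁ x hx => ?_
  let p := (ψ t).symm x
  have hp : p ∈ e.source := hx.1
  have hxp : ψ t p = x := (ψ t).apply_symm_apply x
  set z := e p with hz
  have hzt : z ∈ e.target := e.map_source hp
  have hzp : e.symm z = p := e.left_inv hp
  change 0 < (fderiv ℝ (fun w => e₁ (ψ t (e.symm w))) z).det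
  -- `D e' s` is the Jacobian determinant of `ψ s` at `p` in the charts `e` and `e'`.
  let D : OpenPartialHomeomorph M (EuclideanSpace ℝ (Fin n)) → ℝ → ℝ :=
    fun e' s => (fderiv ℝ (fun w => e' (ψ s (e.symm w))) z).det
  have hDc : ∀ e' ∈ o.charts, ∀ s ∈ I, ψ s p ∈ e'.source → ContinuousAt (D e') s := by
    intro e' he' s hs hsp
    have := continuousAt_fderiv_family_chart hI hψ hea (o.smooth he') hs hzt (by rwa [hzp])
    exact ContinuousLinearMap.continuous_det.continuousAt.comp this
  have hcomp : ∀ e' ∈ o.charts, ∀ e'' ∈ o.charts, ∀ s, ψ s p ∈ e'.source → ψ s p ∈ e''.source →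
      0 < D e' s → 0 < D e'' s := by
    intro e' he' e'' he'' s hs' hs'' hpos
    have := det_fderiv_transition_comp (transportChart_mem_maximalAtlas (ψ s) hea)
      (o.smooth he') (o.smooth he'') (z := z) hzt
      (by rwa [transportChart_symm_apply, hzp]) (by rwa [transportChart_symm_apply, hzp])
    have hc := o.compatible e' he' e'' he'' (ψ s p) ⟨hs', hs''⟩
    rw [transportChart_symm_apply, hzp] at this
    exact (mul_pos hc hpos).trans_eq this.symm
  have hne : ∀ e' ∈ o.charts, ∀ s, ψ s p ∈ e'.source → D e' s ≠ 0 := by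
    intro e' he' s hs'
    exact det_fderiv_transition_ne_zero (transportChart_mem_maximalAtlas (ψ s) hea)
      (o.smooth he') (z := z) hzt (by rwa [transportChart_symm_apply, hzp])
  have hcont : ∀ s ∈ I, ContinuousAt (fun r => ψ r p) s := by
    intro s hs
    have h1 : ContinuousAt (fun q : ℝ × M => ψ q.1 q.2) (s, p) :=
      (hψ.contMDiffAt ((hI.prod isOpen_univ).mem_nhds ⟨hs, mem_univ _⟩)).continuousAt
    exact h1.comp (f := fun r => (r, p)) (continuousAt_id.prodMk continuousAt_const)
  -- The times at which `ψ s` preserves, respectively (`T`) reverses, orientation at `p`. The sign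
  -- of `D` does not depend on the oriented chart, so these open sets are disjoint; they cover the
  -- connected set `I`, and `0` lies in `S`.
  let S : Set ℝ := {s | s ∈ I ∧ ∃ e' ∈ o.charts, ψ s p ∈ e'.source ∧ 0 < D e' s}
  let T : Set ℝ := {s | s ∈ I ∧ ∃ e' ∈ o.charts, ψ s p ∈ e'.source ∧ D e' s < 0}
  have hS : IsOpen S := by
    rw [isOpen_iff_mem_nhds]
    rintro s ⟨hs, e', he', hs', hpos⟩
    filter_upwards [hI.mem_nhds hs, (hcont s hs) (e'.open_source.mem_nhds hs'),
      (hDc e' he' s hs hs') (Ioi_mem_nhds hpos)] with r h1 h2 h3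
    exact ⟨h1, e', he', h2, h3⟩
  have hT : IsOpen T := by
    rw [isOpen_iff_mem_nhds]
    rintro s ⟨hs, e', he', hs', hneg⟩
    filter_upwards [hI.mem_nhds hs, (hcont s hs) (e'.open_source.mem_nhds hs'),
      (hDc e' he' s hs hs') (Iio_mem_nhds hneg)] with r h1 h2 h3
    exact ⟨h1, e', he', h2, h3⟩
  have hdisj : Disjoint S T := by
    rw [Set.disjoint_left]
    rintro s ⟨_, e', he', hs', hpos⟩ ⟨_, e'', he'', hs'', hneg⟩
    exact lt_asymm hneg (hcomp e' he' e'' he'' s hs' hs'' hpos)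
  have hcov : I ⊆ S ∪ T := by
    intro s hs
    obtain ⟨e', he', hs'⟩ := o.cover (ψ s p)
    rcases lt_or_gt_of_ne (hne e' he' s hs') with h | h
    · exact Or.inr ⟨hs, e', he', hs', h⟩
    · exact Or.inl ⟨hs, e', he', hs', h⟩
  have h0S : (I ∩ S).Nonempty := by
    refine ⟨0, h0, h0, e, he, by rwa [hψ0], ?_⟩
    have : (fun w => e (ψ 0 (e.symm w))) = e ∘ e.symm := by
      funext w; rw [hψ0]; rfl
    change 0 < (fderiv ℝ (fun w => e (ψ 0 (e.symm w))) z).det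
    rw [this, fderiv_transition_self hzt]
    exact zero_lt_one.trans_eq (LinearMap.det_id (A := ℝ) (M := EuclideanSpace ℝ (Fin n))).symm
  obtain ⟨_, e', he', hs', hpos⟩ :=
    hIc.subset_left_of_subset_union hS hT hdisj hcov h0S ht
  exact hcomp e' he' e₁ he₁ t hs' (by rw [hxp]; exact hx.2) hpos

end Family

/-! ## The time derivative of a pulled back tensor in coordinates -/

section TimeDerivative

open Set Filter Topology

variable {n : ℕ}

theorem fderiv_apply_eq_sum (F : EuclideanSpace ℝ (Fin n) → ℝ) (y v : EuclideanSpace ℝ (Fin n)) :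
    fderiv ℝ F y v = ∑ m, v m * pd m F y := by
  have hv : v = ∑ i, v i • EuclideanSpace.single i (1 : ℝ) := by
    ext j; simp [Finset.sum_apply, Pi.single_apply]
  conv_lhs => rw [hv]
  simp [pd]

variable {η : ℝ × EuclideanSpace ℝ (Fin n) → EuclideanSpace ℝ (Fin n)} {t : ℝ}
  {y : EuclideanSpace ℝ (Fin n)} (hη : ContDiffAt ℝ ∞ η (t, y))

include hη

theorem contDiffAt_pd_family (a i : Fin n) :
    ContDiffAt ℝ ∞ (fun p : ℝ × EuclideanSpace ℝ (Fin n) => pd i (fun z => η (p.1, z) a) p.2)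
      (t, y) := by
  have h1 : ContDiffAt ℝ ∞ (Function.uncurry fun (p : ℝ × EuclideanSpace ℝ (Fin n))
      (z : EuclideanSpace ℝ (Fin n)) => η (p.1, z) a) ((t, y), y) := by
    have h2 : ContDiffAt ℝ ∞ (fun p => η p a) (t, y) := contDiffAt_euclidean.mp hη a
    have h3 : ContDiffAt ℝ ∞ (fun q : (ℝ × EuclideanSpace ℝ (Fin n)) × EuclideanSpace ℝ (Fin n) =>
      (q.1.1, q.2)) ((t, y), y) := by fun_prop
    exact h2.comp ((t, y), y) h3
  have h4 := ContDiffAt.fderiv (g := fun p : ℝ × EuclideanSpace ℝ (Fin n) => p.2) (x₀ := (t, y))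
    (m := ∞) h1 contDiffAt_snd (by simp)
  exact h4.clm_apply contDiffAt_const

/-- Symmetry of the second derivative of `η` in the joint variable: `∂_t ∂_i η = ∂_i ∂_t η = ∂_i V`.
-/
theorem hasDerivAt_pd_family {V : EuclideanSpace ℝ (Fin n) → EuclideanSpace ℝ (Fin n)}
    (hV : ∀ᶠ z in 𝓝 y, HasDerivAt (fun s => η (s, z)) (V z) t) (a i : Fin n) :
    HasDerivAt (fun s => pd i (fun z => η (s, z) a) y) (pd i (fun z => V z a) y) t := by
  let F : ℝ × EuclideanSpace ℝ (Fin n) → ℝ := fun p => η p a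
  have hF : ContDiffAt ℝ ∞ F (t, y) := contDiffAt_euclidean.mp hη a
  have hF' : DifferentiableAt ℝ (fderiv ℝ F) (t, y) :=
    (hF.fderiv_right (m := 1) (by exact (ENat.LEInfty.out : (2 : WithTop ℕ∞) ≤ ∞))).differentiableAt
      (by simp)
  have hd : ∀ᶠ p in 𝓝 (t, y), DifferentiableAt ℝ F p := by
    filter_upwards [(hF.of_le (m := 1) (by simp)).eventually (by simp)] with p hp
      using hp.differentiableAt (by simp)
  let b : EuclideanSpace ℝ (Fin n) := EuclideanSpace.single i 1
  have hsymm : fderiv ℝ (fderiv ℝ F) (t, y) (1, 0) (0, b) =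
      fderiv ℝ (fderiv ℝ F) (t, y) (0, b) (1, 0) :=
    (hF.isSymmSndFDerivAt (by
      simpa using (ENat.LEInfty.out : (2 : WithTop ℕ∞) ≤ ∞))) (1, 0) (0, b)
  have hpd : (fun s => pd i (fun z => η (s, z) a) y) =ᶠ[𝓝 t] fun s => fderiv ℝ F (s, y) (0, b) := by
    have hc : Tendsto (fun s : ℝ => (s, y)) (𝓝 t) (𝓝 (t, y)) :=
      (continuous_id.prodMk continuous_const).tendsto t
    filter_upwards [hc.eventually hd] with s hs
    have h1 : HasFDerivAt (fun z : EuclideanSpace ℝ (Fin n) => (s, z))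
        (ContinuousLinearMap.inr ℝ ℝ (EuclideanSpace ℝ (Fin n))) y := hasFDerivAt_prodMk_right s y
    have h2 := hs.hasFDerivAt.comp y h1
    exact congrArg (fun L => L b) h2.fderiv
  have hVF : (fun z => V z a) =ᶠ[𝓝 y] fun z => fderiv ℝ F (t, z) (1, 0) := by
    have hc : Tendsto (fun z : EuclideanSpace ℝ (Fin n) => (t, z)) (𝓝 y) (𝓝 (t, y)) :=
      (continuous_const.prodMk continuous_id).tendsto y
    filter_upwards [hc.eventually hd, hV] with z hz hzV
    have h1 : HasDerivAt (fun s : ℝ => (s, z)) ((1 : ℝ), (0 : EuclideanSpace ℝ (Fin n))) t :=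
      (hasDerivAt_id t).prodMk (hasDerivAt_const t z)
    have h2 := hz.hasFDerivAt.comp_hasDerivAt t h1
    have h3 : HasDerivAt (fun s => η (s, z) a) (V z a) t := (EuclideanSpace.proj a :
      EuclideanSpace ℝ (Fin n) →L[ℝ] ℝ).hasFDerivAt.comp_hasDerivAt t hzV
    exact h3.unique h2
  have h1 : HasDerivAt (fun s : ℝ => fderiv ℝ F (s, y) (0, b))
      (fderiv ℝ (fderiv ℝ F) (t, y) (1, 0) (0, b)) t := by
    have h2 : HasDerivAt (fun s : ℝ => (s, y)) ((1 : ℝ), (0 : EuclideanSpace ℝ (Fin n))) t :=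
      (hasDerivAt_id t).prodMk (hasDerivAt_const t y)
    have h3 := hF'.hasFDerivAt.comp_hasDerivAt t h2
    simpa using h3.clm_apply (hasDerivAt_const t ((0 : ℝ), b))
  have h4 : pd i (fun z => V z a) y = fderiv ℝ (fderiv ℝ F) (t, y) (0, b) (1, 0) := by
    have h5 : HasFDerivAt (fun z : EuclideanSpace ℝ (Fin n) => (t, z))
        (ContinuousLinearMap.inr ℝ ℝ (EuclideanSpace ℝ (Fin n))) y := hasFDerivAt_prodMk_right t y
    have h6 := hF'.hasFDerivAt.comp y h5
    have h7 := h6.clm_apply (hasFDerivAt_const ((1 : ℝ), (0 : EuclideanSpace ℝ (Fin n))) y)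
    have h8 := (h7.congr_of_eventuallyEq hVF).fderiv
    have h9 := congrArg (fun L => L b) h8
    simpa [pd] using h9
  rw [h4, ← hsymm]
  exact h1.congr_of_eventuallyEq hpd

omit hη in
theorem pd_family_eq_one (hη0 : ∀ᶠ z in 𝓝 y, η (t, z) = z) (a i : Fin n) :
    pd i (fun z => η (t, z) a) y = (1 : Matrix (Fin n) (Fin n) ℝ) a i := by
  have h1 : (fun z => η (t, z) a) =ᶠ[𝓝 y] fun z => z a := by
    filter_upwards [hη0] with z hz
    rw [hz]
  have h2 : HasFDerivAt (fun z : EuclideanSpace ℝ (Fin n) => z a)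
      (EuclideanSpace.proj a : EuclideanSpace ℝ (Fin n) →L[ℝ] ℝ) y :=
    (EuclideanSpace.proj a : EuclideanSpace ℝ (Fin n) →L[ℝ] ℝ).hasFDerivAt
  rw [pd, h1.fderiv_eq, h2.fderiv]
  simp [Matrix.one_apply]

omit hη in
theorem hasDerivAt_comp_family {V : EuclideanSpace ℝ (Fin n) → EuclideanSpace ℝ (Fin n)}
    (hη0 : η (t, y) = y) (hV : HasDerivAt (fun s => η (s, y)) (V y) t)
    {F : EuclideanSpace ℝ (Fin n) → ℝ} (hF : DifferentiableAt ℝ F y) :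
    HasDerivAt (fun s => F (η (s, y))) (∑ m, V y m * pd m F y) t := by
  rw [← fderiv_apply_eq_sum]
  have h : HasFDerivAt F (fderiv ℝ F y) (η (t, y)) := by rw [hη0]; exact hF.hasFDerivAt
  exact h.comp_hasDerivAt t hV

variable {V : EuclideanSpace ℝ (Fin n) → EuclideanSpace ℝ (Fin n)}
  (hη0 : ∀ᶠ z in 𝓝 y, η (t, z) = z)
  (hV : ∀ᶠ z in 𝓝 y, HasDerivAt (fun s => η (s, z)) (V z) t)

include hη0 hV

/-- The time derivative of the components of a pulled back metric is its Lie derivative. -/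
theorem hasDerivAt_pullback_metric {G : EuclideanSpace ℝ (Fin n) → Matrix (Fin n) (Fin n) ℝ}
    (hG : ∀ a b, DifferentiableAt ℝ (fun z => G z a b) y) (i j : Fin n) :
    HasDerivAt (fun s => ∑ a, ∑ b, pd i (fun z => η (s, z) a) y * pd j (fun z => η (s, z) b) y *
        G (η (s, y)) a b)
      (∑ m, V y m * pd m (fun z => G z i j) y + ∑ m, G y m j * pd i (fun z => V z m) y +
        ∑ m, G y i m * pd j (fun z => V z m) y) t := by
  have h : ∀ a b, HasDerivAt (fun s => pd i (fun z => η (s, z) a) y *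
      pd j (fun z => η (s, z) b) y * G (η (s, y)) a b) _ t := fun a b =>
    ((hasDerivAt_pd_family hη hV a i).mul (hasDerivAt_pd_family hη hV b j)).mul
      (hasDerivAt_comp_family hη0.self_of_nhds hV.self_of_nhds (hG a b))
  refine (HasDerivAt.fun_sum fun a _ => HasDerivAt.fun_sum fun b _ => h a b).congr_deriv ?_
  -- At `s = t` the Jacobian is the identity, so the double sums collapse to the three terms of the
  -- Lie derivative.
  simp only [pd_family_eq_one hη0, hη0.self_of_nhds, Matrix.one_apply, Pi.mul_apply, add_mul,
    Finset.sum_add_distrib, ite_mul, mul_ite, mul_one, one_mul, mul_zero, zero_mul,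
    Finset.sum_ite_eq', Finset.mem_univ, if_true, Finset.sum_ite_irrel, Finset.sum_const_zero]
  have h1 : ∀ m, pd i (fun z => V z m) y * G y m j = G y m j * pd i (fun z => V z m) y :=
    fun m => mul_comm _ _
  have h2 : ∀ m, pd j (fun z => V z m) y * G y i m = G y i m * pd j (fun z => V z m) y :=
    fun m => mul_comm _ _
  simp only [h1, h2]
  ring

end TimeDerivative

section TimeDerivativeThree

open Set Filter Topology

variable {η : ℝ × EuclideanSpace ℝ (Fin 3) → EuclideanSpace ℝ (Fin 3)} {t : ℝ}
  {y : EuclideanSpace ℝ (Fin 3)} (hη : ContDiffAt ℝ ∞ η (t, y))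
  {V : EuclideanSpace ℝ (Fin 3) → EuclideanSpace ℝ (Fin 3)}
  (hη0 : ∀ᶠ z in 𝓝 y, η (t, z) = z)
  (hV : ∀ᶠ z in 𝓝 y, HasDerivAt (fun s => η (s, z)) (V z) t)

include hη hη0 hV

/-- The derivative of the Jacobian determinant of a flow is the divergence. -/
theorem hasDerivAt_det_family :
    HasDerivAt (fun s => (Matrix.of fun a i => pd i (fun z => η (s, z) a) y).det)
      (∑ m, pd m (fun z => V z m) y) t := by
  simp only [Matrix.det_fin_three, Matrix.of_apply]
  have h := hasDerivAt_pd_family hη hV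
  refine ((((((((h 0 0).mul (h 1 1)).mul (h 2 2)).sub (((h 0 0).mul (h 1 2)).mul (h 2 1))).sub
    (((h 0 1).mul (h 1 0)).mul (h 2 2))).add (((h 0 1).mul (h 1 2)).mul (h 2 0))).add
    (((h 0 2).mul (h 1 0)).mul (h 2 1))).sub (((h 0 2).mul (h 1 1)).mul (h 2 0))).congr_deriv ?_
  simp [pd_family_eq_one hη0, Fin.sum_univ_three]

end TimeDerivativeThree

/-! ## Change of coordinates for the components of a metric -/

section Transformation

open Set Filter Topology Bundle

variable {n : ℕ} {M : Type*} [TopologicalSpace M] [ChartedSpace (EuclideanSpace ℝ (Fin n)) M]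
  [IsManifold (𝓡 n) ∞ M] {e₁ e₂ : OpenPartialHomeomorph M (EuclideanSpace ℝ (Fin n))}
  (h₁ : e₁ ∈ IsManifold.maximalAtlas (𝓡 n) ∞ M) (h₂ : e₂ ∈ IsManifold.maximalAtlas (𝓡 n) ∞ M)

include h₁ h₂

omit [IsManifold (𝓡 n) ∞ M] in
-- The chain rule for `e₁.symm = e₂.symm ∘ (e₂ ∘ e₁.symm)`. It is stated in the tangent bundle
-- because the two base points agree only propositionally.
theorem frame_transition {z : EuclideanSpace ℝ (Fin n)} (hz : z ∈ e₁.target)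
    (hz₂ : e₁.symm z ∈ e₂.source) (i : Fin n) :
    (⟨e₁.symm z, frame e₁ z i⟩ : TangentBundle (𝓡 n) M) =
      ⟨e₂.symm (e₂ (e₁.symm z)), mfderiv (𝓡 n) (𝓡 n) e₂.symm (e₂ (e₁.symm z))
        (fderiv ℝ (e₂ ∘ e₁.symm) z (EuclideanSpace.single i 1))⟩ := by
  have hd₁ : HasMFDerivAt (𝓡 n) (𝓡 n) (e₂ ∘ e₁.symm) z (fderiv ℝ (e₂ ∘ e₁.symm) z) :=
    ((contDiffAt_transition h₁ h₂ hz hz₂).differentiableAt (by simp)).hasFDerivAt.hasMFDerivAt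
  have hd₂ : HasMFDerivAt (𝓡 n) (𝓡 n) e₂.symm ((e₂ ∘ e₁.symm) z)
      (mfderiv (𝓡 n) (𝓡 n) e₂.symm ((e₂ ∘ e₁.symm) z)) :=
    ((mdifferentiable_of_mem_maximalAtlas h₂).symm.mdifferentiableAt
      (e₂.map_source hz₂)).hasMFDerivAt
  have hcomp := hd₂.comp z hd₁
  have heq : e₁.symm =ᶠ[𝓝 z] e₂.symm ∘ (e₂ ∘ e₁.symm) := by
    filter_upwards [e₁.symm.continuousAt hz (e₂.open_source.mem_nhds hz₂)] with w hw
    exact (e₂.left_inv hw).symm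
  have hm := (hcomp.congr_of_eventuallyEq heq).mfderiv
  have hpt : e₂.symm (e₂ (e₁.symm z)) = e₁.symm z := e₂.left_inv hz₂
  have hv : (frame e₁ z i : EuclideanSpace ℝ (Fin n)) =
      (mfderiv (𝓡 n) (𝓡 n) e₂.symm (e₂ (e₁.symm z))
        (fderiv ℝ (e₂ ∘ e₁.symm) z (EuclideanSpace.single i 1)) : EuclideanSpace ℝ (Fin n)) :=
    congrArg (fun L : EuclideanSpace ℝ (Fin n) →L[ℝ] EuclideanSpace ℝ (Fin n) =>
      L (EuclideanSpace.single i 1)) hm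
  exact Bundle.TotalSpace.ext hpt.symm (heq_of_eq hv)

theorem metricComp_transition (g : Metric (n := n) M) {z : EuclideanSpace ℝ (Fin n)}
    (hz : z ∈ e₁.target) (hz₂ : e₁.symm z ∈ e₂.source) (i j : Fin n) :
    metricComp e₁ g z i j = ∑ a, ∑ b, pd i (fun w => e₂ (e₁.symm w) a) z *
      pd j (fun w => e₂ (e₁.symm w) b) z * metricComp e₂ g (e₂ (e₁.symm z)) a b := by
  have hpd : ∀ i a, pd i (fun w => e₂ (e₁.symm w) a) z =
      fderiv ℝ (e₂ ∘ e₁.symm) z (EuclideanSpace.single i 1) a := by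
    intro i a
    have h := ((contDiffAt_transition h₁ h₂ hz hz₂).differentiableAt (by simp)).hasFDerivAt
    have h' := (EuclideanSpace.proj a :
      EuclideanSpace ℝ (Fin n) →L[ℝ] ℝ).hasFDerivAt.comp z h
    exact congrArg (fun L => L (EuclideanSpace.single i 1)) h'.fderiv
  simp only [hpd]
  rw [← metricComp_quadratic]
  let K : TangentBundle (𝓡 n) M → EuclideanSpace ℝ (Fin n) → ℝ := fun p w => g.inner p.1 p.2 w
  have h1 := congrArg K (frame_transition h₁ h₂ hz hz₂ i)
  have h2 : (frame e₁ z j : EuclideanSpace ℝ (Fin n)) =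
      (mfderiv (𝓡 n) (𝓡 n) e₂.symm (e₂ (e₁.symm z))
        (fderiv ℝ (e₂ ∘ e₁.symm) z (EuclideanSpace.single j 1)) : EuclideanSpace ℝ (Fin n)) :=
    congrArg (fun p : TangentBundle (𝓡 n) M => (p.2 : EuclideanSpace ℝ (Fin n)))
      (frame_transition h₁ h₂ hz hz₂ j)
  exact (congrFun h1 _).trans (congrArg _ h2)

theorem metricComp_transition_eq_mul (g : Metric (n := n) M) {z : EuclideanSpace ℝ (Fin n)}
    (hz : z ∈ e₁.target) (hz₂ : e₁.symm z ∈ e₂.source) :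
    metricComp e₁ g z = (Matrix.of fun a i => pd i (fun w => e₂ (e₁.symm w) a) z).transpose *
      metricComp e₂ g (e₂ (e₁.symm z)) *
        Matrix.of fun a i => pd i (fun w => e₂ (e₁.symm w) a) z := by
  ext i j
  rw [metricComp_transition h₁ h₂ g hz hz₂, Finset.sum_comm]
  simp only [Matrix.mul_apply, Matrix.transpose_apply, Matrix.of_apply, Finset.sum_mul]
  refine Finset.sum_congr rfl fun b _ => Finset.sum_congr rfl fun a _ => ?_
  ring

end Transformation

/-! ### The density of the three-form `f ν_g` and its change of coordinates. -/

section Flux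

variable {M : Type*} [TopologicalSpace M] [ChartedSpace (EuclideanSpace ℝ (Fin 3)) M]
  [IsManifold (𝓡 3) ∞ M] {e e₁ e₂ : OpenPartialHomeomorph M (EuclideanSpace ℝ (Fin 3))}

/-- The function `h` with `f ν_g = h dx⁰ ∧ dx¹ ∧ dx²` in the chart `e`. -/
def fluxDensity (e : OpenPartialHomeomorph M (EuclideanSpace ℝ (Fin 3))) (g : Metric (n := 3) M)
    (f : M → ℝ) (z : EuclideanSpace ℝ (Fin 3)) : ℝ :=
  f (e.symm z) * √((metricComp e g z).det)

theorem fluxComp_eq (e : OpenPartialHomeomorph M (EuclideanSpace ℝ (Fin 3)))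
    (g : Metric (n := 3) M) (f : M → ℝ) (z : EuclideanSpace ℝ (Fin 3)) (i j k : Fin 3) :
    fluxComp e g f z i j k = fluxDensity e g f z * leviCivita i j k :=
  (mul_assoc _ _ _).symm

theorem contDiffOn_fluxDensity (he : e ∈ IsManifold.maximalAtlas (𝓡 3) ∞ M)
    (g : Metric (n := 3) M) {f : M → ℝ} (hf : ContMDiff (𝓡 3) 𝓘(ℝ, ℝ) ∞ f) :
    ContDiffOn ℝ ∞ (fluxDensity e g f) e.target := by
  have h1 : ContDiffOn ℝ ∞ (fun z => f (e.symm z)) e.target :=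
    contMDiffOn_iff_contDiffOn.mp
      (hf.comp_contMDiffOn (contMDiffOn_symm_of_mem_maximalAtlas he))
  have hG := isLocalMetric_metricComp he g
  exact h1.mul ((contDiffOn_det hG.smooth).sqrt fun z hz => hG.det_ne_zero z hz)

theorem isLocalThreeForm_fluxComp (he : e ∈ IsManifold.maximalAtlas (𝓡 3) ∞ M)
    (g : Metric (n := 3) M) {f : M → ℝ} (hf : ContMDiff (𝓡 3) 𝓘(ℝ, ℝ) ∞ f) :
    IsLocalThreeForm (fluxComp e g f) e.target where
  smooth i j k := by
    simp only [fluxComp_eq]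
    exact (contDiffOn_fluxDensity he g hf).mul contDiffOn_const
  swap_left z _ i j k := by
    rw [fluxComp_eq, fluxComp_eq, leviCivita_swap_left, mul_neg]
  swap_right z _ i j k := by
    rw [fluxComp_eq, fluxComp_eq, leviCivita_swap_right, mul_neg]

/-- `√(det g)` transforms with the absolute value of the Jacobian determinant; positivity removes
the absolute value. -/
theorem fluxDensity_transition (h₁ : e₁ ∈ IsManifold.maximalAtlas (𝓡 3) ∞ M)
    (h₂ : e₂ ∈ IsManifold.maximalAtlas (𝓡 3) ∞ M) (g : Metric (n := 3) M) (f : M → ℝ)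
    {z : EuclideanSpace ℝ (Fin 3)} (hz : z ∈ e₁.target) (hz₂ : e₁.symm z ∈ e₂.source)
    (hpos : 0 < (Matrix.of fun a i => pd i (fun w => e₂ (e₁.symm w) a) z).det) :
    fluxDensity e₁ g f z = fluxDensity e₂ g f (e₂ (e₁.symm z)) *
      (Matrix.of fun a i => pd i (fun w => e₂ (e₁.symm w) a) z).det := by
  rw [fluxDensity, fluxDensity, metricComp_transition_eq_mul h₁ h₂ g hz hz₂, Matrix.det_mul,
    Matrix.det_mul, Matrix.det_transpose, e₂.left_inv hz₂]
  set d := (Matrix.of fun a i => pd i (fun w => e₂ (e₁.symm w) a) z).det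
  rw [show d * (metricComp e₂ g (e₂ (e₁.symm z))).det * d =
      (metricComp e₂ g (e₂ (e₁.symm z))).det * d ^ 2 by ring,
    Real.sqrt_mul' _ (sq_nonneg d), Real.sqrt_sq hpos.le, mul_assoc]

end Flux

/-! ## The flow of a soliton -/

section SolitonFlow

open Set Filter Topology Bundle

section Smoothness

variable {n : ℕ} {M : Type*} [TopologicalSpace M] [ChartedSpace (EuclideanSpace ℝ (Fin n)) M]
  [IsManifold (𝓡 n) ∞ M]
  {ψ : ℝ → Diffeomorph (𝓡 n) (𝓡 n) M M ∞} {I : Set ℝ} (hI : IsOpen I)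
  (hψ : ContMDiffOn (𝓘(ℝ, ℝ).prod (𝓡 n)) (𝓡 n) ∞ (fun p : ℝ × M => ψ p.1 p.2) (I ×ˢ univ))
  {e : OpenPartialHomeomorph M (EuclideanSpace ℝ (Fin n))}
  (he : e ∈ IsManifold.maximalAtlas (𝓡 n) ∞ M)

/-- The map `ψ_s` in the coordinates `e` and `e ∘ ψ_t⁻¹`. -/
def flowCoord (ψ : ℝ → Diffeomorph (𝓡 n) (𝓡 n) M M ∞) (t : ℝ)
    (e : OpenPartialHomeomorph M (EuclideanSpace ℝ (Fin n)))
    (p : ℝ × EuclideanSpace ℝ (Fin n)) : EuclideanSpace ℝ (Fin n) :=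
  transportChart (ψ t) e (ψ p.1 (e.symm p.2))

omit [IsManifold (𝓡 n) ∞ M] in
theorem flowCoord_self {t : ℝ} {z : EuclideanSpace ℝ (Fin n)} (hz : z ∈ e.target) :
    flowCoord ψ t e (t, z) = z :=
  (transportChart (ψ t) e).right_inv hz

omit [IsManifold (𝓡 n) ∞ M] in
theorem mem_source_transportChart {t : ℝ} {z : EuclideanSpace ℝ (Fin n)} (hz : z ∈ e.target) :
    ψ t (e.symm z) ∈ (transportChart (ψ t) e).source :=
  (transportChart (ψ t) e).map_target hz

include hI hψ he

omit [IsManifold (𝓡 n) ∞ M] in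
theorem eventually_mem_source_transportChart {t : ℝ} (ht : t ∈ I) {z : EuclideanSpace ℝ (Fin n)}
    (hz : z ∈ e.target) : ∀ᶠ p : ℝ × EuclideanSpace ℝ (Fin n) in 𝓝 (t, z),
      p.2 ∈ e.target ∧ ψ p.1 (e.symm p.2) ∈ (transportChart (ψ t) e).source :=
  (continuousAt_snd.eventually (e.open_target.mem_nhds hz)).and
    ((contMDiffAt_family_symm hI hψ he ht hz).continuousAt.eventually
      ((transportChart (ψ t) e).open_source.mem_nhds (mem_source_transportChart hz)))

theorem contDiffAt_flowCoord {t : ℝ} (ht : t ∈ I) {z : EuclideanSpace ℝ (Fin n)}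
    (hz : z ∈ e.target) : ContDiffAt ℝ ∞ (flowCoord ψ t e) (t, z) :=
  contDiffAt_family_chart hI hψ he (transportChart_mem_maximalAtlas (ψ t) he) ht hz
    (mem_source_transportChart hz)

/-- The components of `ψ_s^* g` in terms of those of `ψ_t^* g`. -/
theorem eventually_metricComp_pullbackMetric (g : Metric (n := n) M) {t : ℝ} (ht : t ∈ I)
    {z : EuclideanSpace ℝ (Fin n)} (hz : z ∈ e.target) (i j : Fin n) :
    ∀ᶠ p : ℝ × EuclideanSpace ℝ (Fin n) in 𝓝 (t, z),
      metricComp e (pullbackMetric (ψ p.1) g) p.2 i j =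
        ∑ a, ∑ b, pd i (fun w => flowCoord ψ t e (p.1, w) a) p.2 *
          pd j (fun w => flowCoord ψ t e (p.1, w) b) p.2 *
            metricComp (transportChart (ψ t) e) g (flowCoord ψ t e p) a b := by
  filter_upwards [eventually_mem_source_transportChart hI hψ he ht hz] with p hp
  rw [metricComp_pullbackMetric]
  exact metricComp_transition (transportChart_mem_maximalAtlas (ψ p.1) he)
    (transportChart_mem_maximalAtlas (ψ t) he) g hp.1 hp.2 i j

theorem contDiffOn_metricComp_pullbackMetric (g : Metric (n := n) M) (i j : Fin n) :
    ContDiffOn ℝ ∞ (fun p : ℝ × EuclideanSpace ℝ (Fin n) =>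
      metricComp e (pullbackMetric (ψ p.1) g) p.2 i j) (I ×ˢ e.target) := by
  rintro ⟨t, z⟩ ⟨ht, hz⟩
  refine ContDiffAt.contDiffWithinAt ?_
  have hη := contDiffAt_flowCoord hI hψ he ht hz
  refine ContDiffAt.congr_of_eventuallyEq ?_
    (eventually_metricComp_pullbackMetric hI hψ he g ht hz i j)
  refine ContDiffAt.sum fun a _ => ContDiffAt.sum fun b _ =>
    ((contDiffAt_pd_family hη a i).mul (contDiffAt_pd_family hη b j)).mul ?_
  have hG := isLocalMetric_metricComp (transportChart_mem_maximalAtlas (ψ t) he) g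
  have hG' : ContDiffAt ℝ ∞ (fun w => metricComp (transportChart (ψ t) e) g w a b)
      (flowCoord ψ t e (t, z)) := by
    rw [flowCoord_self hz]
    exact (hG.smooth a b).contDiffAt (hG.isOpen.mem_nhds hz)
  exact hG'.comp (t, z) hη

end Smoothness

variable {M : Type*} [TopologicalSpace M] [ChartedSpace (EuclideanSpace ℝ (Fin 3)) M]
  [IsManifold (𝓡 3) ∞ M]
  {ψ : ℝ → Diffeomorph (𝓡 3) (𝓡 3) M M ∞} {I : Set ℝ} (hI : IsOpen I)
  (hψ : ContMDiffOn (𝓘(ℝ, ℝ).prod (𝓡 3)) (𝓡 3) ∞ (fun p : ℝ × M => ψ p.1 p.2) (I ×ˢ univ))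
  {g : Metric (n := 3) M} {φ : OneForm (n := 3) M} {f : M → ℝ}
  (hf : ContMDiff (𝓡 3) 𝓘(ℝ, ℝ) ∞ f)

include hI hψ

/-- For `s` near `t` the Jacobian of `flowCoord` is close to the identity, so its determinant is
positive and `fluxDensity_transition` applies. -/
theorem eventually_fluxDensity_pullbackMetric {e : OpenPartialHomeomorph M (EuclideanSpace ℝ (Fin 3))}
    (he : e ∈ IsManifold.maximalAtlas (𝓡 3) ∞ M) {t : ℝ} (ht : t ∈ I)
    {y : EuclideanSpace ℝ (Fin 3)} (hy : y ∈ e.target) :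
    ∀ᶠ s in 𝓝 t, fluxDensity (transportChart (ψ s) e) g f y =
      fluxDensity (transportChart (ψ t) e) g f (flowCoord ψ t e (s, y)) *
        (Matrix.of fun a i => pd i (fun z => flowCoord ψ t e (s, z) a) y).det := by
  have hη := contDiffAt_flowCoord hI hψ he ht hy
  have hc : Tendsto (fun s : ℝ => (s, y)) (𝓝 t) (𝓝 (t, y)) :=
    (continuous_id.prodMk continuous_const).tendsto t
  have hη0 : ∀ᶠ z in 𝓝 y, flowCoord ψ t e (t, z) = z := by
    filter_upwards [e.open_target.mem_nhds hy] with z hz using flowCoord_self hz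
  have hdet : ContinuousAt (fun s => (Matrix.of fun a i =>
      pd i (fun z => flowCoord ψ t e (s, z) a) y).det) t := by
    refine ContinuousAt.comp (f := fun s => Matrix.of fun a i =>
      pd i (fun z => flowCoord ψ t e (s, z) a) y) (g := Matrix.det)
      (continuous_id.matrix_det).continuousAt ?_
    refine continuousAt_pi.mpr fun a => continuousAt_pi.mpr fun i => ?_
    exact ContinuousAt.comp (f := fun s : ℝ => (s, y)) (contDiffAt_pd_family hη a i).continuousAt hc
  have hone : (Matrix.of fun a i => pd i (fun z => flowCoord ψ t e (t, z) a) y) = 1 := by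
    ext a i
    exact pd_family_eq_one hη0 a i
  have hpos : (0 : ℝ) < (Matrix.of fun a i =>
      pd i (fun z => flowCoord ψ t e (t, z) a) y).det := by
    rw [hone, Matrix.det_one]; exact one_pos
  filter_upwards [hc.eventually (eventually_mem_source_transportChart hI hψ he ht hy),
    hdet.eventually (Ioi_mem_nhds hpos)] with s hs hspos
  exact fluxDensity_transition (transportChart_mem_maximalAtlas (ψ s) he)
    (transportChart_mem_maximalAtlas (ψ t) he) g f hs.1 hs.2 hspos

include hf

/-- The pullback of a Heterotic soliton along the flow of `φ^♯` is a Heterotic-Ricci flow. -/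
theorem isHeteroticRicciFlow_pullbackMetric (hIc : IsPreconnected I) (h0 : (0 : ℝ) ∈ I)
    (hψ0 : ∀ x, ψ 0 x = x) (hint : ∀ x, IsMIntegralCurveOn (fun t => ψ t x) (sharp g φ) I)
    {o : OrientedAtlas (n := 3) M} {κ : ℝ} (hsol : IsHeteroticSoliton o κ g φ f) :
    IsHeteroticRicciFlow o κ I (fun t => pullbackMetric (ψ t) g) (fun t x => f (ψ t x)) where
  smooth_metric e he := contDiffOn_metricComp_pullbackMetric hI hψ (o.smooth he) g
  smooth_function e he := by
    rintro ⟨t, z⟩ ⟨ht, hz⟩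
    refine ContDiffAt.contDiffWithinAt (contMDiffAt_iff_contDiffAt.mp ?_)
    exact hf.contMDiffAt.comp (t, z) (contMDiffAt_family_symm hI hψ (o.smooth he) ht hz)
  equations e he t ht y hy := by
    have hea := o.smooth he
    set e' := transportChart (ψ t) e with he'
    have hea' : e' ∈ IsManifold.maximalAtlas (𝓡 3) ∞ M := transportChart_mem_maximalAtlas (ψ t) hea
    have heo' : e' ∈ o.charts := transportChart_mem_charts hI hψ hIc h0 hψ0 o ht he
    have hS := hsol e' heo'
    have hG := isLocalMetric_metricComp hea' g
    have hH := isLocalThreeForm_fluxComp hea' g hf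
    have hy' : y ∈ e'.target := hy
    let V : EuclideanSpace ℝ (Fin 3) → EuclideanSpace ℝ (Fin 3) := chartField e' (sharp g φ)
    have hVφ : ∀ z ∈ e'.target, ∀ k, V z k =
        ∑ l, ginv (metricComp e' g) z k l * formComp e' φ z l :=
      fun z hz k => chartField_sharp hea' g φ hz k
    have hη := contDiffAt_flowCoord hI hψ hea ht hy
    have hη0 : ∀ᶠ z in 𝓝 y, flowCoord ψ t e (t, z) = z := by
      filter_upwards [e.open_target.mem_nhds hy] with z hz using flowCoord_self hz
    have hηV : ∀ᶠ z in 𝓝 y, HasDerivAt (fun s => flowCoord ψ t e (s, z)) (V z) t := by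
      filter_upwards [e.open_target.mem_nhds hy] with z hz
      have h := hasDerivAt_chart_comp_of_isMIntegralCurveOn hea' (hint (e.symm z))
        (hI.mem_nhds ht) (mem_source_transportChart hz)
      have hz' : e' (ψ t (e.symm z)) = z := flowCoord_self hz
      rw [hz'] at h
      exact h
    have hφs : ∀ i, DifferentiableAt ℝ (fun z => formComp e' φ z i) y := fun i =>
      ((contDiffOn_formComp hea' φ i).contDiffAt (e'.open_target.mem_nhds hy')).differentiableAt
        (by simp)
    have hc : Tendsto (fun s : ℝ => (s, y)) (𝓝 t) (𝓝 (t, y)) :=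
      (continuous_id.prodMk continuous_const).tendsto t
    have hh : DifferentiableAt ℝ (fluxDensity e' g f) y :=
      ((contDiffOn_fluxDensity hea' g hf).contDiffAt
        (e'.open_target.mem_nhds hy')).differentiableAt (by simp)
    -- From here on time enters only through the charts `e ∘ ψ_s⁻¹`, and at `s = t` the equations
    -- concern the fixed pair `(g, f)` in the chart `e'`.
    simp only [metricComp_pullbackMetric, fluxComp_pullbackMetric]
    -- The Bianchi equation is literally that of the soliton in `e'`; the two evolution equations
    -- require a time derivative.
    refine ⟨fun i j => ?_, fun i j k => ?_, (hS y hy').bianchi⟩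
    · refine HasDerivAt.hasDerivWithinAt ?_
      rw [← he', ← hG.two_covForm_of_soliton hH hy' (hS y hy'),
        ← hG.lieDeriv_sharp hy' hφs (hS y hy').closed hVφ]
      refine (hasDerivAt_pullback_metric hη hη0 hηV (G := metricComp e' g)
        (fun a b => ((hG.smooth a b).contDiffAt
          (hG.isOpen.mem_nhds hy')).differentiableAt (by simp)) i j).congr_of_eventuallyEq ?_
      filter_upwards [hc.eventually
        (eventually_metricComp_pullbackMetric hI hψ hea g ht hy i j)] with s hs
      rw [metricComp_pullbackMetric] at hs
      exact hs
    · refine HasDerivAt.hasDerivWithinAt ?_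
      have hVd : ∀ k, DifferentiableAt ℝ (fun z => V z k) y := fun k => by
        have h : ContDiffOn ℝ ∞
            (fun z => ∑ l, ginv (metricComp e' g) z k l * formComp e' φ z l) e'.target :=
          ContDiffOn.sum fun l _ => (hG.contDiffOn_ginv k l).mul (contDiffOn_formComp hea' φ l)
        exact ((h.congr fun z hz => hVφ z hz k).contDiffAt
          (e'.open_target.mem_nhds hy')).differentiableAt (by simp)
      -- `δH = -φ^♯ ⌟ H` must hold near `y`, not only at `y`, since it is differentiated next.
      -- Writing `h` for the density of `H`, it gives `-dδH = div(hV) dx⁰ ∧ dx¹ ∧ dx²`.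
      have hβ : ∀ z ∈ e'.target, ∀ i j, codiffFlux (metricComp e' g) (fluxComp e' g f) z i j =
          ∑ l, V z l * (-fluxDensity e' g f z * leviCivita l i j) := by
        intro z hz i j
        rw [hG.codiffFlux_of_soliton hH hz (hS z hz), ← Finset.sum_neg_distrib]
        refine Finset.sum_congr rfl fun l _ => ?_
        rw [← hVφ z hz l, fluxComp_eq]
        ring
      rw [← he', extDerivTwo_contraction e'.open_target hy' (V := fun z k => V z k)
        (h := fun z => -fluxDensity e' g f z) hVd hh.neg hβ]
      simp only [pd_neg]
      -- The product rule for the density `h(η) det(∂η)` yields `V·∂h + h div V`, which is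
      -- `div(hV)`.
      have hd := ((hasDerivAt_comp_family hη0.self_of_nhds hηV.self_of_nhds hh).mul
        (hasDerivAt_det_family hη hη0 hηV)).mul_const (leviCivita i j k)
      have hone : (Matrix.of fun a i => pd i (fun z => flowCoord ψ t e (t, z) a) y) = 1 := by
        ext a i
        exact pd_family_eq_one hη0 a i
      rw [hone, Matrix.det_one, hη0.self_of_nhds] at hd
      refine (hd.congr_of_eventuallyEq ?_).congr_deriv ?_
      · filter_upwards [eventually_fluxDensity_pullbackMetric (g := g) (f := f) hI hψ hea ht hy]
          with s hs
        rw [fluxComp_eq, hs]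
        rfl
      · simp only [mul_neg, Finset.sum_neg_distrib]
        ring

end SolitonFlow

end Heterotic
end

theorem mainTheorem10 {M : Type*} [TopologicalSpace M]
    [ChartedSpace (EuclideanSpace ℝ (Fin 3)) M] [IsManifold (𝓡 3) ∞ M]
    [T2Space M] [CompactSpace M] (o : Heterotic.OrientedAtlas (n := 3) M)
    (κ : ℝ) (g : Heterotic.Metric (n := 3) M) (φ : Heterotic.OneForm (n := 3) M) (f : M → ℝ)
    (hf : ContMDiff (𝓡 3) 𝓘(ℝ, ℝ) ∞ f)
    (hsol : Heterotic.IsHeteroticSoliton o κ g φ f) :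
    ∃ (I : Set ℝ) (ψ : ℝ → Diffeomorph (𝓡 3) (𝓡 3) M M ∞) (gt : ℝ → Heterotic.Metric (n := 3) M),
      IsOpen I ∧ I.OrdConnected ∧ (0 : ℝ) ∈ I ∧
      ContMDiffOn (𝓘(ℝ, ℝ).prod (𝓡 3)) (𝓡 3) ∞ (fun p : ℝ × M => ψ p.1 p.2)
        (I ×ˢ Set.univ) ∧
      (∀ x, ψ 0 x = x) ∧
      (∀ x, IsMIntegralCurveOn (fun t => ψ t x) (Heterotic.sharp g φ) I) ∧
      (∀ t ∈ I, Heterotic.IsPullback (ψ t) g (gt t)) ∧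
      Heterotic.IsHeteroticRicciFlow o κ I gt (fun t x => f (ψ t x)) := by
  obtain ⟨ε, hε, ψ, hψ, hψ0, hint⟩ := Heterotic.exists_smooth_flow (Heterotic.contMDiff_sharp g φ)
  have h0 : (0 : ℝ) ∈ Set.Ioo (-ε) ε := ⟨neg_lt_zero.mpr hε, hε⟩
  exact ⟨Set.Ioo (-ε) ε, ψ, fun t => Heterotic.pullbackMetric (ψ t) g, isOpen_Ioo,
    Set.ordConnected_Ioo, h0, hψ, hψ0, hint,
    fun t _ => Heterotic.isPullback_pullbackMetric (ψ t) g,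
    Heterotic.isHeteroticRicciFlow_pullbackMetric isOpen_Ioo hψ hf isPreconnected_Ioo h0 hψ0 hint
      hsol⟩
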